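/- \textbf{Setting.} On Minkowski spacetime with signature $(-,+,+,+)$ and Cartesian coordinates $(\tilde t,\tilde x)\in\mathbb R\times\mathbb R^3$ put $\tilde\rho=|\tilde x|$, $\tilde u=\tilde t-\tilde\rho$, $\tilde v=\tilde t+\tilde\rho$, $L=\partial_{\tilde t}+\partial_{\tilde\rho}$, $\underline L=\partial_{\tilde t}-\partial_{\tilde\rho}$, $\tilde\square=-\partial_{\tilde t}^2+\Delta$. On $|\tilde t|<\tilde\rho$ put $$\tau=\tilde t/\tilde\rho,\qquad \rho=\tilde\rho/(\tilde\rho^2-\tilde t^2),\qquad \Theta=1/\tilde\rho=\rho(1-\tau^2),\qquad \kappa=\frac{1+\tau}{1-\tau}=-\frac{\tilde v}{\tilde u};$$ the cylinder at spatial infinity is $I=\{\rho=0,\ |\tau|<1\}$. Fix $\rho_0>0$ and let $N=\{|\tau|<1,\ 0<\rho<\rho_0\}$. All fields are complex valued (real fields are a special case); $Y_{\ell m}$ are the standard spherical harmonics on the unit sphere, evaluated at $\tilde x/\tilde\rho$. \textbf{Hypotheses.} Let $\tilde\Phi,\tilde\phi_u$ be $C^2$ on $N$. (1) $\tilde\square\tilde\Phi=0$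 on $N$, and $\tilde\Phi$ arises from analytic data near $I$ in the sense that $\tilde\Phi=\Theta\phi$ with $$\phi=\sum_{p=0}^\infty\sum_{\ell=0}^p\sum_{m=-\ell}^{\ell}\frac1{p!}\,a_{p;\ell,m}(\tau)\,Y_{\ell m}\,\rho^p ,$$ where the $a_{p;\ell,m}$ are $C^2$ on $(-1,1)$ and the series and its $\tau$-derivatives up to order two converge normally on compact subsets of $\{|\tau|<1,\ \rho<\rho_0\}$ (for all $0<\tau_1<1$, $0<\rho_1<\rho_0$, the numbers $\frac{\rho_1^p}{p!}|a^{(k)}_{p;\ell,m}(\tau)|$, $k\le2$, $|\tau|\le\tau_1$, are bounded by some $M_p$ with $\sum_p M_p<\infty$). (2) $\tilde\Phi=\tilde\rho\,\underline L\tilde\phi_u$ on $N$, integrated from past null infinity: $\tilde\phi_u\to0$ as $\tilde u\to-\infty$ along every incoming null ray ($\tilde v$ and direction fixed) with $\tilde v>1/(2\rho_0)$. That is, $\tilde\phi_u=\frac12\int_{-\infty}^{\tilde u}\tilde\Phi(\bar u,\tilde v)/\tilde\rho(\bar u,\tilde v)\,d\bar u$. (3) The data are such that the source $Q:=\tilde\square\tilde\phi_u-\tilde\rho^{-1}(L\tilde\phi_u+\underline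 L\tilde\phi_u)$ vanishes on $N$, i.e. $\tilde\phi_u$ solves the ugly equation $\tilde\square\tilde\phi_u=\frac{2}{\tilde\rho}\partial_{\tilde t}\tilde\phi_u$. Define the constants of the first modes of $\tilde\Phi$ by $$C_{ppm}=2^{2p}a_{p;p,m}(0),\quad D_{ppm}=2^{2p}\dot a_{p;p,m}(0),\quad A_{100}=a_{1;0,0}(0)-\dot a_{1;0,0}(0),\quad B_{100}=a_{1;0,0}(0)+\dot a_{1;0,0}(0),$$ so that $a_{0;0,0}=C_{000}+D_{000}\int_0^\tau\frac{ds}{1-s^2}$, $a_{1;0,0}=A_{100}\frac{1-\tau}2+B_{100}\frac{1+\tau}2$, $a_{1;1,m}=\frac{1-\tau^2}{4}\bigl(C_{11m}+D_{11m}\int_0^\tau\frac{ds}{(1-s^2)^2}\bigr)$. \textbf{Conclusion.} Then $A_{100}=D_{000}=D_{11-1}=D_{110}=D_{111}=0$, so no $\log\kappa$ term is inherited from the good field at this order, and near $I$ $$\tilde\phi_u=\frac{C_{000}Y_{00}}{\tilde\rho}-\frac{B_{100}Y_{00}}{2\tilde v\tilde\rho}-\frac{B_{100}Y_{00}}{\tilde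 v^2}\log\Bigl(-\frac{\tilde u}{2\tilde\rho}\Bigr)+\frac{C_{11-1}Y_{1-1}+C_{110}Y_{10}+C_{111}Y_{11}}{8\tilde\rho^2}+\mathcal O(\tilde\rho^{-3}),$$ where the error is uniform in $\tau$ on compact subsets of $(-1,1)$ and in the angles: for every $\tau_1\in(0,1)$ there are $K$ and $R>0$ such that every point with $\tilde\rho\ge R$, $|\tilde t|\le\tau_1\tilde\rho$ lies in $N$ and the error there is at most $K\tilde\rho^{-3}$. (Equivalently, with $A,B,C,D$ denoting instead the constants of $\frac12\tilde\Phi=\tilde\rho\,\partial_{\tilde u}\tilde\phi_u$, the expansion reads $\frac{2C_{000}Y_{00}}{\tilde\rho}-\frac{B_{100}Y_{00}}{\tilde v\tilde\rho}-\frac{2B_{100}Y_{00}}{\tilde v^2}\log(-\frac{\tilde u}{2\tilde\rho})+\frac{\sum_m C_{11m}Y_{1m}}{4\tilde\rho^2}+\mathcal O(\tilde\rho^{-3})$.) -/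

import Mathlib

open Filter Topology

namespace GBU

noncomputable section

/-! ## Minkowski spacetime, its wave operator and its null derivatives -/

/-- Euclidean three-space. -/
abbrev Space : Type := EuclideanSpace ℝ (Fin 3)

/-- Minkowski spacetime in Cartesian coordinates `(t, x)`; the signature is `(-,+,+,+)`. -/
abbrev Spacetime : Type := ℝ × Space

/-- The unit direction `x / |x|`, a point of the unit sphere when `x ≠ 0`. -/
def direction (x : Space) : Space := ‖x‖⁻¹ • x

/-- Retarded time `u = t - r`, where `r = |x|`. -/
def retarded (q : Spacetime) : ℝ := q.1 - ‖q.2‖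

/-- Advanced time `v = t + r`. -/
def advanced (q : Spacetime) : ℝ := q.1 + ‖q.2‖

/-- The time derivative `∂_t F`. -/
def timeDeriv (F : Spacetime → ℂ) (q : Spacetime) : ℂ := fderiv ℝ F q (1, 0)

/-- The radial derivative `∂_r F`. -/
def radialDeriv (F : Spacetime → ℂ) (q : Spacetime) : ℂ := fderiv ℝ F q (0, direction q.2)

/-- The derivative along the incoming null vector `∂_t - ∂_r`. -/
def incomingDeriv (F : Spacetime → ℂ) (q : Spacetime) : ℂ := timeDeriv F q - radialDeriv F q

/-- The wave operator `-∂_t² + Δ` of the Minkowski metric. -/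
def waveOp (F : Spacetime → ℂ) (q : Spacetime) : ℂ :=
  -iteratedDeriv 2 (fun s : ℝ => F (s, q.2)) q.1
    + Laplacian.laplacian (fun y : Space => F (q.1, y)) q.2

/-! ## Spherical harmonics -/

/-- Legendre polynomials, by Rodrigues' formula. -/
def legendrePoly (ℓ : ℕ) : Polynomial ℝ :=
  Polynomial.C (((2 : ℝ) ^ ℓ * (ℓ.factorial : ℝ))⁻¹) *
    (Polynomial.derivative^[ℓ]) ((Polynomial.X ^ 2 - 1) ^ ℓ)

/-- `Y_{ℓ m}` for `0 ≤ m ≤ ℓ`, at a point `n` of the unit sphere. With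
`n = (sin θ cos φ, sin θ sin φ, cos θ)` this is the usual
`√((2ℓ+1)/(4π) (ℓ-m)!/(ℓ+m)!) P_ℓ^m(cos θ) e^{imφ}` (Condon--Shortley phase), because
`P_ℓ^m(z) = (-1)^m (1-z²)^{m/2} (d/dz)^m P_ℓ(z)` and `sin^m θ e^{imφ} = (n₀ + i n₁)^m`. -/
def sphHarmNat (ℓ m : ℕ) (n : Space) : ℂ :=
  (-1) ^ m *
    (Real.sqrt ((2 * ℓ + 1) / (4 * Real.pi) *
      (((ℓ - m).factorial : ℝ) / ((ℓ + m).factorial : ℝ))) : ℂ) *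
    ((((Polynomial.derivative^[m]) (legendrePoly ℓ)).eval (n 2) : ℝ) : ℂ) *
    ((n 0 : ℂ) + (n 1 : ℂ) * Complex.I) ^ m

/-- The spherical harmonics `Y_{ℓ m}`, `|m| ≤ ℓ`, with `Y_{ℓ,-m} = (-1)^m conj Y_{ℓ m}`. -/
def sphHarm (ℓ : ℕ) (m : ℤ) (n : Space) : ℂ :=
  if 0 ≤ m then sphHarmNat ℓ m.natAbs n
  else (-1) ^ m.natAbs * (starRingEnd ℂ) (sphHarmNat ℓ m.natAbs n)

/-! ## The cylinder at spatial infinity -/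

/-- The coordinate `τ = t / r` of the cylinder at spatial infinity. -/
def cylTau (q : Spacetime) : ℝ := q.1 / ‖q.2‖

/-- The coordinate `ρ = r / (r² - t²)`; the cylinder `I` is `ρ = 0`, `|τ| < 1`. -/
def cylRho (q : Spacetime) : ℝ := ‖q.2‖ / (‖q.2‖ ^ 2 - q.1 ^ 2)

/-- The neighbourhood `|τ| < 1`, `0 < ρ < ρ₀` of the cylinder, as a subset of Minkowski
spacetime; it lies in the complement of the light cone of the origin (`u < 0 < v`). -/
def nearCylinder (ρ₀ : ℝ) : Set Spacetime :=
  {q | |q.1| < ‖q.2‖ ∧ cylRho q < ρ₀}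

/-- The coefficient of `ρ^p / p!` in the Ansatz:
`∑_{ℓ=0}^{p} ∑_{m=-ℓ}^{ℓ} a_{p;ℓ,m}(τ) Y_{ℓ m}(n)`. -/
def modeSum (a : ℕ → ℕ → ℤ → ℝ → ℂ) (p : ℕ) (τ : ℝ) (n : Space) : ℂ :=
  ∑ ℓ ∈ Finset.range (p + 1), ∑ m ∈ Finset.Icc (-(ℓ : ℤ)) (ℓ : ℤ), a p ℓ m τ * sphHarm ℓ m n

/-- The modes `a_{p;ℓ,m}` are twice continuously differentiable on `(-1,1)`, and the series
`∑ a_{p;ℓ,m}(τ) Y_{ℓ m} ρ^p / p!` and its `τ`-derivatives of order at most two converge normally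
on the compact subsets of `|τ| < 1`, `ρ < ρ₀` (in particular the data on `τ = 0` are analytic
in `ρ` at `ρ = 0`). -/
def ModesConverge (ρ₀ : ℝ) (a : ℕ → ℕ → ℤ → ℝ → ℂ) : Prop :=
  (∀ (p ℓ : ℕ) (m : ℤ), ℓ ≤ p → |m| ≤ (ℓ : ℤ) →
    ContDiffOn ℝ 2 (a p ℓ m) (Set.Ioo (-1) 1)) ∧
  ∀ τ₁ ∈ Set.Ioo (0 : ℝ) 1, ∀ ρ₁ ∈ Set.Ioo (0 : ℝ) ρ₀, ∃ M : ℕ → ℝ, Summable M ∧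
    ∀ (p ℓ : ℕ) (m : ℤ), ℓ ≤ p → |m| ≤ (ℓ : ℤ) → ∀ k ≤ 2, ∀ τ : ℝ, |τ| ≤ τ₁ →
      ρ₁ ^ p / (p.factorial : ℝ) * ‖iteratedDeriv k (a p ℓ m) τ‖ ≤ M p

/-- `Φ` is given near the cylinder by the Ansatz: `Φ = Θ φ` with `Θ = 1 / r` and
`φ = ∑_p ∑_{ℓ ≤ p} ∑_{|m| ≤ ℓ} (1/p!) a_{p;ℓ,m}(τ) Y_{ℓ m} ρ^p`. -/
def HasCylinderExpansion (ρ₀ : ℝ) (a : ℕ → ℕ → ℤ → ℝ → ℂ) (Φ : Spacetime → ℂ) : Prop :=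
  ModesConverge ρ₀ a ∧
  ∀ q ∈ nearCylinder ρ₀,
    HasSum (fun p : ℕ => ((cylRho q ^ p / (p.factorial : ℝ) : ℝ) : ℂ) *
        modeSum a p (cylTau q) (direction q.2))
      ((‖q.2‖ : ℂ) * Φ q)

/-! The constants of the first modes of the good field, in terms of the initial data
`a_{p;ℓ,m}(0)`, `ȧ_{p;ℓ,m}(0)`. They are those for which
`a_{0;0,0} = C₀₀₀ + D₀₀₀ ∫₀^τ ds/(1-s²)`,
`a_{1;0,0} = A₁₀₀ (1-τ)/2 + B₁₀₀ (1+τ)/2` and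
`a_{1;1,m} = (1-τ²)/4 (C₁₁ₘ + D₁₁ₘ ∫₀^τ ds/(1-s²)²)`. -/

/-- The constant `A₁₀₀`. -/
def constA100 (a : ℕ → ℕ → ℤ → ℝ → ℂ) : ℂ := a 1 0 0 0 - deriv (a 1 0 0) 0

/-- The constant `B₁₀₀`. -/
def constB100 (a : ℕ → ℕ → ℤ → ℝ → ℂ) : ℂ := a 1 0 0 0 + deriv (a 1 0 0) 0

/-- The constants `C_{ppm} = 2^{2p} a_{p;p,m}(0)`. -/
def constC (a : ℕ → ℕ → ℤ → ℝ → ℂ) (p : ℕ) (m : ℤ) : ℂ := 2 ^ (2 * p) * a p p m 0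

/-- The constants `D_{ppm} = 2^{2p} ȧ_{p;p,m}(0)`. -/
def constD (a : ℕ → ℕ → ℤ → ℝ → ℂ) (p : ℕ) (m : ℤ) : ℂ := 2 ^ (2 * p) * deriv (a p p m) 0

/-! ## The ugly field -/

/-- `F → 0` at past null infinity: `F → 0` as `u → -∞` along each incoming null ray (`v` and the
direction `n` constant) that stays near the cylinder, i.e. each one with `v > 1 / (2 ρ₀)`; note
`ρ = (1/v + 1/|u|) / 2`, `t = (u + v)/2` and `r = (v - u)/2`. -/
def VanishesAtPastNullInfinity (ρ₀ : ℝ) (F : Spacetime → ℂ) : Prop :=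
  ∀ v : ℝ, 1 / (2 * ρ₀) < v → ∀ n : Space, ‖n‖ = 1 →
    Tendsto (fun u : ℝ => F ((u + v) / 2, ((v - u) / 2) • n)) atBot (𝓝 0)

/-- `φ` is an ugly field near the cylinder that is built from the auxiliary good field `Φ`:
`□Φ = 0`, `Φ = r (∂_t - ∂_r) φ` integrated from past null infinity, and the source
`Q = □φ - (2/r) ∂_t φ` vanishes. -/
structure IsUglyBuiltFrom (ρ₀ : ℝ) (Φ φ : Spacetime → ℂ) : Prop where
  contDiffOn_good : ContDiffOn ℝ 2 Φ (nearCylinder ρ₀)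
  contDiffOn_ugly : ContDiffOn ℝ 2 φ (nearCylinder ρ₀)
  good : ∀ q ∈ nearCylinder ρ₀, waveOp Φ q = 0
  auxiliary : ∀ q ∈ nearCylinder ρ₀, Φ q = (‖q.2‖ : ℂ) * incomingDeriv φ q
  ugly : ∀ q ∈ nearCylinder ρ₀, waveOp φ q = (2 / ‖q.2‖ : ℂ) * timeDeriv φ q
  pastNull : VanishesAtPastNullInfinity ρ₀ φ

/-- The explicit part of the expansion of the ugly field. -/
def uglyExpansion (a : ℕ → ℕ → ℤ → ℝ → ℂ) (q : Spacetime) : ℂ :=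
  constC a 0 0 * sphHarm 0 0 (direction q.2) / (‖q.2‖ : ℂ)
    - constB100 a * sphHarm 0 0 (direction q.2) / (2 * (advanced q : ℂ) * (‖q.2‖ : ℂ))
    - constB100 a * sphHarm 0 0 (direction q.2) / (advanced q : ℂ) ^ 2
        * (Real.log (-retarded q / (2 * ‖q.2‖)) : ℂ)
    + (∑ m ∈ Finset.Icc (-1 : ℤ) 1, constC a 1 m * sphHarm 1 m (direction q.2))
        / (8 * (‖q.2‖ : ℂ) ^ 2)

end

end GBU

namespace GBU

noncomputable section

open MeasureTheory Set

/-! ## The rotation invariant measure on the unit sphere -/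

/-! Write `L = ∂_t + ∂_r` and `r = |x|`. Since `Φ = r (∂_t - ∂_r) φ`, the ugly equation is the same
as `L(rΦ) = Δ_S φ`, with `Δ_S` the Laplacian of the unit sphere. Projected to `Y_{ℓ m}` this reads
`L(r Φ_{ℓm}) = -ℓ(ℓ+1) φ_{ℓm}` (`hasDerivAt_sphProj_good`), and this identity yields all the
vanishing constants.

Monopole. For `ℓ = 0`, `r Φ₀₀` is a function of `u` alone. As `ρ(1+τ) = 1/(-u)`, comparing power
series on an outgoing ray gives `a_{p;0,0}(τ) = a_{p;0,0}(0) (1+τ)^p` (`monopole_modes`). Hence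
`ȧ_{p;0,0}(0) = p a_{p;0,0}(0)`, which is `D₀₀₀ = 0` for `p = 0` and `A₁₀₀ = 0` for `p = 1`.

Bounds up to past null infinity. The assumed convergence is uniform only for `|τ| ≤ τ₁ < 1`, while
the integral defining `φ` runs to `τ = -1`. Projecting `□Φ = 0` and comparing powers of `1/r` at
constant `τ` gives the equation `(1-τ²) a'' + 2(p-1) τ a' + (ℓ(ℓ+1) - p(p-1)) a = 0`
(`mode_equation`). For `p ≥ 1` an energy estimate bounds its solutions on all of `(-1,1)` by
`e^{9p}` times the data at `τ = 0` (`norm_mode_le`), so the bounds stay geometric in `p`. The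
estimate fails for `p = 0`, but that mode is constant by the monopole step. So the expansion, on a
smaller range of `ρ`, has remainders uniform up to `τ = ±1` (`ModesBounded.norm_expansion_sub_le`),
and integration along incoming rays gives `φ = O(1/r)` (`ModesBounded.norm_ugly_le`).

Dipole. The modes `a_{1;1,m}` are combinations of `1-τ²` and an odd solution with value `-1/2` at `τ
= -1` (`dipole_modes`). Now `L(r Φ_{1m}) = -2 φ_{1m} = O(1/r)`, so as `u → -∞` with `v` fixed, the
values of `r Φ_{1m}` at `v` and at `2v` have the same limit. But these limits are `α/(2v) + O(v⁻²)`
and `α/(4v) + O(v⁻²)`, where `α = a_{1;1,m}(-1)`. Letting `v → ∞` gives `α = 0`, so the odd solution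
is absent and `D₁₁ₘ = 0` (`deriv_dipole`).

Expansion. With these constants gone, the terms `p = 0, 1` of `rΦ` are `c + b/(2(-u)) + d/(2(v-u))`,
where `c`, `b`, `d` depend on the direction only (`sum_expansion_two`). Since `∂_u φ = 2 rΦ/(v-u)²`,
these terms have an elementary primitive vanishing at past null infinity: the stated expansion. The
`O(ρ²)` remainder integrates to `O(ρ²)/r` (`ModesBounded.norm_ugly_sub_le`), which is `O(r⁻³)` for
`|τ| ≤ τ₁`. -/

/-- The unit sphere of `Space`. -/
abbrev unitSphere : Set Space := Metric.sphere 0 1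

/-- A rotation invariant finite measure on `Space`, carried by the unit sphere: the push-forward
of Lebesgue measure on the unit ball under the radial projection. -/
def sphereMeasure : Measure Space :=
  (volume.restrict (Metric.ball (0 : Space) 1)).map direction

lemma measurable_direction : Measurable direction := by
  unfold direction
  fun_prop

lemma norm_direction {x : Space} (hx : x ≠ 0) : ‖direction x‖ = 1 := by
  have : ‖x‖ ≠ 0 := norm_ne_zero_iff.2 hx
  rw [direction, norm_smul, norm_inv, norm_norm, inv_mul_cancel₀ this]

lemma norm_smul_direction {x : Space} (hx : x ≠ 0) : ‖x‖ • direction x = x := by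
  have : ‖x‖ ≠ 0 := norm_ne_zero_iff.2 hx
  rw [direction, smul_smul, mul_inv_cancel₀ this, one_smul]

lemma direction_smul {r : ℝ} (hr : 0 < r) {n : Space} (hn : ‖n‖ = 1) :
    direction (r • n) = n := by
  rw [direction, norm_smul, hn, Real.norm_of_nonneg hr.le, mul_one, smul_smul,
    inv_mul_cancel₀ hr.ne', one_smul]

instance : IsFiniteMeasure sphereMeasure := by
  have : IsFiniteMeasure (volume.restrict (Metric.ball (0 : Space) 1)) :=
    ⟨by simp⟩
  unfold sphereMeasure
  infer_instance

/-- The origin is the only point that the radial projection does not send to the sphere, and it is a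
null set. -/
lemma ae_mem_unitSphere : ∀ᵐ n ∂sphereMeasure, n ∈ unitSphere := by
  rw [sphereMeasure]
  refine (ae_map_iff measurable_direction.aemeasurable
    (p := fun n => n ∈ unitSphere) Metric.isClosed_sphere.measurableSet).2 ?_
  refine ae_restrict_of_ae ?_
  have h : ∀ᵐ x : Space, x ≠ 0 := by
    rw [ae_iff]
    simp
  filter_upwards [h] with x hx
  simpa using norm_direction hx

lemma sphereMeasure_restrict : sphereMeasure.restrict unitSphere = sphereMeasure :=
  Measure.restrict_eq_self_of_ae_mem ae_mem_unitSphere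

/-- The fields are regular only near the cylinder, so the integrands are controlled on the sphere
and not on all of `Space`. Because the measure is carried by the compact sphere, continuity there
suffices. -/
lemma aestronglyMeasurable_sphere {E : Type*} [NormedAddCommGroup E] {F : Space → E}
    (hF : ContinuousOn F unitSphere) : AEStronglyMeasurable F sphereMeasure := by
  rw [← sphereMeasure_restrict]
  exact hF.aestronglyMeasurable_of_isCompact (isCompact_sphere 0 1)
    Metric.isClosed_sphere.measurableSet

lemma integrable_sphere {E : Type*} [NormedAddCommGroup E] {F : Space → E}
    (hF : ContinuousOn F unitSphere) : Integrable F sphereMeasure := by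
  rw [← sphereMeasure_restrict]
  exact hF.integrableOn_compact (isCompact_sphere 0 1)

lemma integral_sphere_congr {E : Type*} [NormedAddCommGroup E] [NormedSpace ℝ E] {F G : Space → E}
    (h : ∀ n ∈ unitSphere, F n = G n) : ∫ n, F n ∂sphereMeasure = ∫ n, G n ∂sphereMeasure :=
  integral_congr_ae (ae_mem_unitSphere.mono h)

lemma norm_integral_sphere_le {F : Space → ℂ} {C : ℝ} (h : ∀ n ∈ unitSphere, ‖F n‖ ≤ C) :
    ‖∫ n, F n ∂sphereMeasure‖ ≤ C * sphereMeasure.real univ :=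
  norm_integral_le_of_norm_le_const (ae_mem_unitSphere.mono h)

/-- A non-negative function that is positive somewhere on the sphere has positive integral. -/
lemma integral_sphere_pos {F : Space → ℝ} (hF : Continuous F) (h0 : ∀ n, 0 ≤ F n)
    {n : Space} (hn : n ∈ unitSphere) (hp : 0 < F n) : 0 < ∫ n, F n ∂sphereMeasure := by
  have hn1 : ‖n‖ = 1 := by simpa using hn
  rw [integral_pos_iff_support_of_nonneg h0 (integrable_sphere hF.continuousOn)]
  rw [sphereMeasure, Measure.map_apply measurable_direction
    (hF.isOpen_support.measurableSet)]
  have hopen : IsOpen ((direction ⁻¹' Function.support F) ∩ {0}ᶜ) := by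
    have hc : ContinuousOn direction ({0}ᶜ : Set Space) := by
      unfold direction
      exact (continuousOn_id.norm.inv₀ fun x hx => norm_ne_zero_iff.2 hx).smul continuousOn_id
    rw [inter_comm]
    exact hc.isOpen_inter_preimage isOpen_compl_singleton hF.isOpen_support
  -- The cone over the support of `F` is open away from the origin, and it meets the unit ball at `n
  -- / 2`.
  have hpos : 0 < volume (((direction ⁻¹' Function.support F) ∩ {0}ᶜ) ∩
      Metric.ball (0 : Space) 1) := by
    refine (hopen.inter Metric.isOpen_ball).measure_pos _ ⟨(1 / 2 : ℝ) • n, ⟨?_, ?_⟩, ?_⟩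
    · rw [mem_preimage, direction_smul (by norm_num) hn1]
      exact hp.ne'
    · simp only [mem_compl_iff, mem_singleton_iff, smul_eq_zero, not_or]
      exact ⟨by norm_num, fun h => by simp [h] at hn1⟩
    · simp [norm_smul, hn1]
      norm_num
  refine hpos.trans_le ?_
  rw [Measure.restrict_apply' Metric.isOpen_ball.measurableSet]
  exact measure_mono (inter_subset_inter_left _ inter_subset_left)

/-- Differentiation under the integral over the sphere. -/
lemma hasDerivAt_integral_sphere {H H' : ℝ → Space → ℂ} {s₀ ε C : ℝ} (hε : 0 < ε)
    (hH : ∀ s ∈ Metric.ball s₀ ε, ContinuousOn (H s) unitSphere)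
    (hH' : ContinuousOn (H' s₀) unitSphere)
    (hb : ∀ n ∈ unitSphere, ∀ s ∈ Metric.ball s₀ ε, ‖H' s n‖ ≤ C)
    (hd : ∀ n ∈ unitSphere, ∀ s ∈ Metric.ball s₀ ε, HasDerivAt (fun s => H s n) (H' s n) s) :
    HasDerivAt (fun s => ∫ n, H s n ∂sphereMeasure) (∫ n, H' s₀ n ∂sphereMeasure) s₀ := by
  have hnhd : Metric.ball s₀ ε ∈ 𝓝 s₀ := Metric.ball_mem_nhds _ hε
  refine (hasDerivAt_integral_of_dominated_loc_of_deriv_le (bound := fun _ => C) hnhd ?_ ?_ ?_ ?_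
    (integrable_const _) ?_).2
  · filter_upwards [hnhd] with s hs using aestronglyMeasurable_sphere (hH s hs)
  · exact integrable_sphere (hH _ (Metric.mem_ball_self hε))
  · exact aestronglyMeasurable_sphere hH'
  · exact ae_mem_unitSphere.mono hb
  · exact ae_mem_unitSphere.mono hd

/-! ## Rotations -/

/-- The generator of the rotations about the coordinate axis `i`. -/
def rotGen (i : Fin 3) : Space →L[ℝ] Space :=
  (EuclideanSpace.proj (i + 1) : Space →L[ℝ] ℝ).smulRight (EuclideanSpace.single (i + 2) (1 : ℝ))
    - (EuclideanSpace.proj (i + 2) : Space →L[ℝ] ℝ).smulRight (EuclideanSpace.single (i + 1) (1 : ℝ))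

lemma rotGen_apply (i : Fin 3) (x : Space) (j : Fin 3) :
    rotGen i x j = x (i + 1) * (if j = i + 2 then 1 else 0) -
      x (i + 2) * (if j = i + 1 then 1 else 0) := by
  simp [rotGen]

/-- The rotation by the angle `s` about the coordinate axis `i`. -/
def rotLin (i : Fin 3) (s : ℝ) : Space →L[ℝ] Space :=
  ContinuousLinearMap.id ℝ Space + Real.sin s • rotGen i
    + (1 - Real.cos s) • (rotGen i ∘L rotGen i)

lemma rotLin_apply (i : Fin 3) (s : ℝ) (x : Space) :
    rotLin i s x = x + Real.sin s • rotGen i x + (1 - Real.cos s) • rotGen i (rotGen i x) := by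
  simp [rotLin]

lemma norm_rotLin (i : Fin 3) (s : ℝ) (x : Space) : ‖rotLin i s x‖ = ‖x‖ := by
  rw [← sq_eq_sq₀ (norm_nonneg _) (norm_nonneg _), EuclideanSpace.norm_sq_eq,
    EuclideanSpace.norm_sq_eq]
  have h := Real.sin_sq_add_cos_sq s
  simp only [Fin.sum_univ_three, rotLin_apply, PiLp.add_apply, PiLp.smul_apply, rotGen_apply,
    Real.norm_eq_abs, sq_abs, smul_eq_mul]
  fin_cases i <;> simp
  · linear_combination (x 1 ^ 2 + x 2 ^ 2) * h
  · linear_combination (x 0 ^ 2 + x 2 ^ 2) * h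
  · linear_combination (x 1 ^ 2 + x 0 ^ 2) * h

/-- This relation collapses the exponential series of the generator to the three terms in `rotLin`
(Rodrigues' formula), and it is what `hasDerivAt_rotLin` rests on. -/
lemma rotGen_rotGen_rotGen (i : Fin 3) (x : Space) :
    rotGen i (rotGen i (rotGen i x)) = -rotGen i x := by
  ext j
  simp only [rotGen_apply, PiLp.neg_apply]
  fin_cases i <;> fin_cases j <;> simp

lemma hasDerivAt_rotLin (i : Fin 3) (s : ℝ) (x : Space) :
    HasDerivAt (fun s => rotLin i s x) (rotGen i (rotLin i s x)) s := by
  have h := (((Real.hasDerivAt_sin s).smul_const (rotGen i x)).const_add x).add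
    (((Real.hasDerivAt_cos s).const_sub 1).smul_const (rotGen i (rotGen i x)))
  refine (h.congr_deriv ?_).congr_of_eventuallyEq (Eventually.of_forall fun s => ?_)
  · simp only [rotLin_apply, map_add, map_smul, rotGen_rotGen_rotGen]
    module
  · simp [rotLin_apply]

/-- The rotation as an isometry. -/
def rotIso (i : Fin 3) (s : ℝ) : Space ≃ₗᵢ[ℝ] Space :=
  LinearIsometry.toLinearIsometryEquiv ⟨(rotLin i s).toLinearMap, norm_rotLin i s⟩ rfl

/-- Linear isometries preserve Lebesgue measure on the ball and commute with the radial projection.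
-/
lemma measurePreserving_sphere (R : Space ≃ₗᵢ[ℝ] Space) :
    MeasurePreserving R sphereMeasure sphereMeasure := by
  refine ⟨R.continuous.measurable, ?_⟩
  have h1 : MeasurePreserving R (volume.restrict (Metric.ball (0 : Space) 1))
      (volume.restrict (Metric.ball (0 : Space) 1)) := by
    have := (LinearIsometryEquiv.measurePreserving R).restrict_preimage
      (Metric.isOpen_ball (x := (0 : Space)) (ε := 1)).measurableSet
    rwa [show R ⁻¹' Metric.ball (0 : Space) 1 = Metric.ball 0 1 by ext; simp] at this
  have h2 : R ∘ direction = direction ∘ R := by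
    ext1 x
    simp [direction]
  unfold sphereMeasure
  rw [Measure.map_map R.continuous.measurable measurable_direction, h2,
    ← Measure.map_map measurable_direction R.continuous.measurable, h1.map_eq]

/-- The derivative of a function along the rotations about the axis `i`. -/
def rotDeriv (i : Fin 3) (F : Space → ℂ) (x : Space) : ℂ := fderiv ℝ F x (rotGen i x)

/-- The integral of `F` composed with the rotation by `s` does not depend on `s`; differentiate at
`s = 0`. -/
lemma integral_rotDeriv (i : Fin 3) {F : Space → ℂ} (hd : ∀ n ∈ unitSphere, DifferentiableAt ℝ F n)
    (hc : ContinuousOn (rotDeriv i F) unitSphere) : ∫ n, rotDeriv i F n ∂sphereMeasure = 0 := by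
  have hmem : ∀ s, ∀ n ∈ unitSphere, rotLin i s n ∈ unitSphere := fun s n hn => by
    simpa [norm_rotLin] using hn
  have hcF : ContinuousOn F unitSphere := fun n hn => (hd n hn).continuousAt.continuousWithinAt
  obtain ⟨C, hC⟩ := (isCompact_sphere (0 : Space) 1).exists_bound_of_continuousOn hc
  have h0 : HasDerivAt (fun s => ∫ n, F (rotLin i s n) ∂sphereMeasure)
      (∫ n, rotDeriv i F (rotLin i 0 n) ∂sphereMeasure) 0 := by
    refine hasDerivAt_integral_sphere (ε := 1) (C := C)
      (H' := fun s n => rotDeriv i F (rotLin i s n)) one_pos ?_ ?_ ?_ ?_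
    · exact fun s _ => hcF.comp (rotLin i s).continuous.continuousOn (hmem s)
    · exact hc.comp (rotLin i 0).continuous.continuousOn (hmem 0)
    · exact fun n hn s _ => hC _ (hmem s n hn)
    · exact fun n hn s _ => (hd _ (hmem s n hn)).hasFDerivAt.comp_hasDerivAt s
        (hasDerivAt_rotLin i s n)
  have h1 : (fun s => ∫ n, F (rotLin i s n) ∂sphereMeasure) = fun _ => ∫ n, F n ∂sphereMeasure := by
    ext1 s
    exact (measurePreserving_sphere (rotIso i s)).integral_comp
      (rotIso i s).toHomeomorph.measurableEmbedding F
  have h2 : ∀ n, rotLin i 0 n = n := fun n => by simp [rotLin_apply]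
  simp only [h2] at h0
  rw [h1] at h0
  exact h0.unique (hasDerivAt_const _ _)

/-- Integration by parts on the sphere. -/
lemma integral_rotDeriv_mul (i : Fin 3) {F G : Space → ℂ} {U : Set Space} (hU : IsOpen U)
    (hS : unitSphere ⊆ U) (hF : ContDiffOn ℝ 1 F U) (hG : ContDiffOn ℝ 1 G U) :
    ∫ n, rotDeriv i F n * G n ∂sphereMeasure = -∫ n, F n * rotDeriv i G n ∂sphereMeasure := by
  have hdF : ∀ n ∈ U, DifferentiableAt ℝ F n := fun n hn =>
    (hF.contDiffAt (hU.mem_nhds hn)).differentiableAt one_ne_zero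
  have hdG : ∀ n ∈ U, DifferentiableAt ℝ G n := fun n hn =>
    (hG.contDiffAt (hU.mem_nhds hn)).differentiableAt one_ne_zero
  have hcF : ContinuousOn (rotDeriv i F) unitSphere :=
    ((hF.continuousOn_fderiv_of_isOpen hU le_rfl).clm_apply (rotGen i).continuous.continuousOn).mono hS
  have hcG : ContinuousOn (rotDeriv i G) unitSphere :=
    ((hG.continuousOn_fderiv_of_isOpen hU le_rfl).clm_apply (rotGen i).continuous.continuousOn).mono hS
  have hprod : ∀ n ∈ unitSphere, rotDeriv i (fun x => F x * G x) n
      = rotDeriv i F n * G n + F n * rotDeriv i G n := fun n hn => by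
    unfold rotDeriv
    rw [fderiv_fun_mul (hdF n (hS hn)) (hdG n (hS hn))]
    simp
    ring
  have hc1 : ContinuousOn (fun n => rotDeriv i F n * G n) unitSphere :=
    hcF.mul (hG.continuousOn.mono hS)
  have hc2 : ContinuousOn (fun n => F n * rotDeriv i G n) unitSphere :=
    (hF.continuousOn.mono hS).mul hcG
  have h := integral_rotDeriv i (F := fun x => F x * G x)
    (fun n hn => (hdF n (hS hn)).mul (hdG n (hS hn))) ((hc1.add hc2).congr hprod)
  rw [integral_sphere_congr hprod, integral_add (integrable_sphere hc1) (integrable_sphere hc2)] at h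
  exact eq_neg_of_add_eq_zero_left h

lemma contDiffOn_rotDeriv (i : Fin 3) {F : Space → ℂ} {U : Set Space} (hU : IsOpen U)
    (hF : ContDiffOn ℝ 2 F U) : ContDiffOn ℝ 1 (rotDeriv i F) U :=
  (hF.fderiv_of_isOpen hU (by norm_num)).clm_apply (rotGen i).contDiff.contDiffOn

/-- The Laplacian of the unit sphere, as the sum of the squares of the rotations. -/
def sphereLaplacian (F : Space → ℂ) (x : Space) : ℂ := ∑ i, rotDeriv i (rotDeriv i F) x

/-- The Laplacian of the sphere is symmetric. -/
lemma integral_sphereLaplacian_mul {F G : Space → ℂ} {U : Set Space} (hU : IsOpen U)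
    (hS : unitSphere ⊆ U) (hF : ContDiffOn ℝ 2 F U) (hG : ContDiffOn ℝ 2 G U) :
    ∫ n, sphereLaplacian F n * G n ∂sphereMeasure
      = ∫ n, F n * sphereLaplacian G n ∂sphereMeasure := by
  have hF1 := hF.of_le (show (1 : WithTop ℕ∞) ≤ 2 by norm_num)
  have hG1 := hG.of_le (show (1 : WithTop ℕ∞) ≤ 2 by norm_num)
  have hcF : ∀ i, ContinuousOn (rotDeriv i (rotDeriv i F)) unitSphere := fun i =>
    (((contDiffOn_rotDeriv i hU hF).continuousOn_fderiv_of_isOpen hU le_rfl).clm_apply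
      (rotGen i).continuous.continuousOn).mono hS
  have hcG : ∀ i, ContinuousOn (rotDeriv i (rotDeriv i G)) unitSphere := fun i =>
    (((contDiffOn_rotDeriv i hU hG).continuousOn_fderiv_of_isOpen hU le_rfl).clm_apply
      (rotGen i).continuous.continuousOn).mono hS
  simp only [sphereLaplacian, Finset.sum_mul, Finset.mul_sum]
  have h1 : ∀ i ∈ Finset.univ, Integrable (fun n => rotDeriv i (rotDeriv i F) n * G n)
      sphereMeasure := fun i _ => integrable_sphere ((hcF i).mul (hG.continuousOn.mono hS))
  have h2 : ∀ i ∈ Finset.univ, Integrable (fun n => F n * rotDeriv i (rotDeriv i G) n)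
      sphereMeasure := fun i _ => integrable_sphere ((hF.continuousOn.mono hS).mul (hcG i))
  rw [integral_finsetSum _ h1, integral_finsetSum _ h2]
  refine Finset.sum_congr rfl fun i _ => ?_
  rw [integral_rotDeriv_mul i hU hS (contDiffOn_rotDeriv i hU hF) hG1,
    integral_rotDeriv_mul i hU hS hF1 (contDiffOn_rotDeriv i hU hG), neg_neg]

lemma fderiv_rotDeriv (i : Fin 3) {F : Space → ℂ} {x : Space} (hF : ContDiffAt ℝ 2 F x)
    (w : Space) :
    fderiv ℝ (rotDeriv i F) x w = fderiv ℝ (fderiv ℝ F) x w (rotGen i x)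
      + fderiv ℝ F x (rotGen i w) := by
  have h1 : DifferentiableAt ℝ (fderiv ℝ F) x :=
    (hF.fderiv_right (m := 1) (by norm_num)).differentiableAt one_ne_zero
  have h := (h1.hasFDerivAt.clm_apply (rotGen i).hasFDerivAt).fderiv
  unfold rotDeriv
  rw [h]
  simp [add_comm]

lemma rotGen_eq (i : Fin 3) (x : Space) : rotGen i x =
    x (i + 1) • EuclideanSpace.single (i + 2) (1 : ℝ)
      - x (i + 2) • EuclideanSpace.single (i + 1) (1 : ℝ) := by
  simp [rotGen]

/-- The Laplacian in terms of the radial derivatives and the Laplacian of the sphere. -/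
lemma sphereLaplacian_eq {F : Space → ℂ} {x : Space} (hF : ContDiffAt ℝ 2 F x) :
    sphereLaplacian F x = (‖x‖ ^ 2 : ℝ) * Laplacian.laplacian F x
      - fderiv ℝ (fderiv ℝ F) x x x - 2 * fderiv ℝ F x x := by
  have hx : x = x 0 • EuclideanSpace.single 0 (1 : ℝ) + x 1 • EuclideanSpace.single 1 (1 : ℝ)
      + x 2 • EuclideanSpace.single 2 (1 : ℝ) := by
    ext j
    fin_cases j <;> simp
  -- Expanding in the standard basis leaves an algebraic identity in the entries of the Hessian,
  -- which holds once the mixed entries are identified.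
  have hsym := hF.isSymmSndFDerivAt (by simp)
  rw [InnerProductSpace.laplacian_eq_iteratedFDeriv_orthonormalBasis F
    (EuclideanSpace.basisFun (Fin 3) ℝ), EuclideanSpace.norm_sq_eq]
  have h2 : ∀ i, rotDeriv i (rotDeriv i F) x = _ := fun i => fderiv_rotDeriv i hF _
  simp only [sphereLaplacian, h2, iteratedFDeriv_two_apply]
  have hs01 := hsym (EuclideanSpace.single 0 (1 : ℝ)) (EuclideanSpace.single 1 (1 : ℝ))
  have hs02 := hsym (EuclideanSpace.single 0 (1 : ℝ)) (EuclideanSpace.single 2 (1 : ℝ))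
  have hs12 := hsym (EuclideanSpace.single 1 (1 : ℝ)) (EuclideanSpace.single 2 (1 : ℝ))
  generalize fderiv ℝ (fderiv ℝ F) x = B at *
  generalize fderiv ℝ F x = D at *
  have hB : B x x = B (x 0 • EuclideanSpace.single 0 (1 : ℝ) + x 1 • EuclideanSpace.single 1 (1 : ℝ)
      + x 2 • EuclideanSpace.single 2 (1 : ℝ)) (x 0 • EuclideanSpace.single 0 (1 : ℝ)
      + x 1 • EuclideanSpace.single 1 (1 : ℝ) + x 2 • EuclideanSpace.single 2 (1 : ℝ)) := by
    rw [← hx]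
  have hD : D x = D (x 0 • EuclideanSpace.single 0 (1 : ℝ) + x 1 • EuclideanSpace.single 1 (1 : ℝ)
      + x 2 • EuclideanSpace.single 2 (1 : ℝ)) := by
    rw [← hx]
  rw [hB, hD]
  simp only [Fin.sum_univ_three, rotGen_eq, Fin.isValue, zero_add, Fin.reduceAdd,
    PiLp.single_apply, map_add, map_sub, map_smul,
    _root_.add_apply, _root_.sub_apply, _root_.smul_apply,
    EuclideanSpace.basisFun_apply, Complex.real_smul, Real.norm_eq_abs, sq_abs,
    Matrix.cons_val_zero, Matrix.cons_val_one]
  simp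
  rw [hs01, hs02, hs12]
  ring

/-! ## Legendre polynomials -/

/-- The powers `(X² - 1)^ℓ`. -/
def legendreBase (ℓ : ℕ) : Polynomial ℝ := (Polynomial.X ^ 2 - 1) ^ ℓ

/-- This is `(X² - 1) w' = 2ℓ X w` for `w = (X² - 1)^ℓ`, differentiated `k + 1` times. At `k = ℓ +
m` it becomes the associated Legendre equation. -/
lemma legendreBase_ode (ℓ k : ℕ) :
    (Polynomial.X ^ 2 - 1) * Polynomial.derivative^[k + 2] (legendreBase ℓ)
      + (2 * (k + 1) : Polynomial ℝ) * Polynomial.X * Polynomial.derivative^[k + 1] (legendreBase ℓ)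
      + ((k + 1) * k : Polynomial ℝ) * Polynomial.derivative^[k] (legendreBase ℓ)
    = (2 * ℓ : Polynomial ℝ) * Polynomial.X * Polynomial.derivative^[k + 1] (legendreBase ℓ)
      + (2 * ℓ * (k + 1) : Polynomial ℝ) * Polynomial.derivative^[k] (legendreBase ℓ) := by
  have hC : (Polynomial.C 2 : Polynomial ℝ) = 2 := map_ofNat Polynomial.C 2
  induction k with
  | zero =>
    have h : (Polynomial.X ^ 2 - 1) * Polynomial.derivative (legendreBase ℓ)
        = (2 * ℓ : Polynomial ℝ) * Polynomial.X * legendreBase ℓ := by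
      unfold legendreBase
      rcases ℓ with _ | ℓ
      · simp
      · simp [Polynomial.derivative_pow, hC]
        ring
    have h' := congrArg Polynomial.derivative h
    simp only [Polynomial.derivative_mul, Polynomial.derivative_sub, Polynomial.derivative_X_pow,
      Polynomial.derivative_one, Polynomial.derivative_X, Polynomial.derivative_natCast,
      Polynomial.derivative_ofNat] at h'
    simp [Function.iterate_succ_apply'] at h' ⊢
    linear_combination h' - Polynomial.X * Polynomial.derivative (legendreBase ℓ) * hC
  | succ k ih =>
    have h' := congrArg Polynomial.derivative ih
    simp only [Polynomial.derivative_mul, Polynomial.derivative_sub, Polynomial.derivative_X_pow,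
      Polynomial.derivative_one, Polynomial.derivative_X, Polynomial.derivative_natCast,
      Polynomial.derivative_ofNat, Polynomial.derivative_add,
      ← Function.iterate_succ_apply' Polynomial.derivative] at h'
    simp at h' ⊢
    linear_combination h' - Polynomial.X * Polynomial.derivative^[k]
      (Polynomial.derivative (Polynomial.derivative (legendreBase ℓ))) * hC

lemma iterate_derivative_legendrePoly (ℓ m : ℕ) :
    Polynomial.derivative^[m] (legendrePoly ℓ) =
      Polynomial.C (((2 : ℝ) ^ ℓ * (ℓ.factorial : ℝ))⁻¹) *
        Polynomial.derivative^[ℓ + m] (legendreBase ℓ) := by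
  rw [legendrePoly, Polynomial.iterate_derivative_C_mul, ← Function.iterate_add_apply, add_comm m]
  rfl

/-- The associated Legendre equation. -/
lemma legendrePoly_ode (ℓ m : ℕ) (z : ℝ) :
    (1 - z ^ 2) * (Polynomial.derivative^[m + 2] (legendrePoly ℓ)).eval z
      - 2 * (m + 1) * z * (Polynomial.derivative^[m + 1] (legendrePoly ℓ)).eval z
      - m * (m + 1) * (Polynomial.derivative^[m] (legendrePoly ℓ)).eval z
    = -(ℓ * (ℓ + 1)) * (Polynomial.derivative^[m] (legendrePoly ℓ)).eval z := by
  have h := congrArg (Polynomial.eval z) (legendreBase_ode ℓ (ℓ + m))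
  simp only [Polynomial.eval_add, Polynomial.eval_mul, Polynomial.eval_sub, Polynomial.eval_pow,
    Polynomial.eval_X, Polynomial.eval_one, Polynomial.eval_natCast, Polynomial.eval_ofNat,
    Nat.cast_add] at h
  simp only [iterate_derivative_legendrePoly, Polynomial.eval_mul, Polynomial.eval_C, ← add_assoc]
  linear_combination (-((2 : ℝ) ^ ℓ * (ℓ.factorial : ℝ))⁻¹) * h

/-- Expand `(X² - 1)^ℓ` binomially. On `[-1,1]` each differentiated monomial is at most the one of
top degree, and the binomial coefficients add up to `2^ℓ`, cancelling Rodrigues' factor. -/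
lemma abs_eval_iterate_derivative_legendrePoly_le {ℓ m : ℕ} (hm : m ≤ ℓ) {z : ℝ} (hz : |z| ≤ 1) :
    |(Polynomial.derivative^[m] (legendrePoly ℓ)).eval z|
      ≤ (2 * ℓ).factorial / ((ℓ - m).factorial * ℓ.factorial : ℝ) := by
  have hbase : |(Polynomial.derivative^[ℓ + m] (legendreBase ℓ)).eval z|
      ≤ 2 ^ ℓ * ((2 * ℓ).descFactorial (ℓ + m) : ℝ) := by
    have hb : legendreBase ℓ = ∑ j ∈ Finset.range (ℓ + 1),
        ((-1) ^ (ℓ - j) * (ℓ.choose j) : ℝ) • (Polynomial.X ^ (2 * j) : Polynomial ℝ) := by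
      rw [legendreBase, sub_eq_add_neg, add_pow]
      refine Finset.sum_congr rfl fun j _ => ?_
      rw [Polynomial.smul_eq_C_mul, ← pow_mul]
      simp
      ring
    rw [hb, Polynomial.iterate_derivative_sum, Polynomial.eval_finsetSum]
    have hsum : ∑ j ∈ Finset.range (ℓ + 1), ((ℓ.choose j : ℝ) * ((2 * ℓ).descFactorial (ℓ + m) : ℝ))
        = 2 ^ ℓ * ((2 * ℓ).descFactorial (ℓ + m) : ℝ) := by
      rw [← Finset.sum_mul]
      have := Nat.sum_range_choose ℓ
      congr 1
      exact_mod_cast this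
    rw [← hsum]
    refine (Finset.abs_sum_le_sum_abs _ _).trans (Finset.sum_le_sum fun j hj => ?_)
    have hj : j ≤ ℓ := Nat.lt_succ_iff.1 (Finset.mem_range.1 hj)
    rw [Polynomial.iterate_derivative_smul, Polynomial.iterate_derivative_X_pow_eq_smul]
    simp only [Polynomial.eval_smul, Polynomial.eval_pow, Polynomial.eval_X, smul_eq_mul, abs_mul,
      abs_pow, abs_neg, abs_one, one_pow, one_mul, Nat.abs_cast]
    refine mul_le_mul_of_nonneg_left ?_ (Nat.cast_nonneg _)
    have h1 : ((2 * j).descFactorial (ℓ + m) : ℝ) ≤ ((2 * ℓ).descFactorial (ℓ + m) : ℝ) := by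
      exact_mod_cast Nat.descFactorial_le (ℓ + m) (by omega)
    calc _ ≤ ((2 * j).descFactorial (ℓ + m) : ℝ) * 1 :=
          mul_le_mul_of_nonneg_left (pow_le_one₀ (abs_nonneg _) hz) (Nat.cast_nonneg _)
      _ ≤ _ := by rwa [mul_one]
  have hf : (((ℓ - m).factorial : ℕ) : ℝ) * ((2 * ℓ).descFactorial (ℓ + m) : ℝ)
      = (2 * ℓ).factorial := by
    have := Nat.factorial_mul_descFactorial (n := 2 * ℓ) (k := ℓ + m) (by omega)
    rw [show 2 * ℓ - (ℓ + m) = ℓ - m by omega] at this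
    exact_mod_cast this
  have h1 : (0 : ℝ) < (ℓ - m).factorial := by exact_mod_cast Nat.factorial_pos _
  have h2 : (0 : ℝ) < ℓ.factorial := by exact_mod_cast Nat.factorial_pos _
  rw [iterate_derivative_legendrePoly, Polynomial.eval_mul, Polynomial.eval_C, abs_mul,
    abs_of_nonneg (by positivity), ← hf]
  calc _ ≤ (2 ^ ℓ * (ℓ.factorial : ℝ))⁻¹ * (2 ^ ℓ * ((2 * ℓ).descFactorial (ℓ + m) : ℝ)) :=
        mul_le_mul_of_nonneg_left hbase (by positivity)
    _ = _ := by field_simp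

/-- The coefficient of degree `ℓ - m` comes from the leading coefficient of the monic polynomial
`(X² - 1)^ℓ`, of degree `2ℓ ≥ ℓ + m`. -/
lemma iterate_derivative_legendrePoly_ne_zero {ℓ m : ℕ} (hm : m ≤ ℓ) :
    Polynomial.derivative^[m] (legendrePoly ℓ) ≠ 0 := by
  rw [iterate_derivative_legendrePoly]
  refine mul_ne_zero (Polynomial.C_ne_zero.2 (by positivity)) fun h => ?_
  have hmonic : (legendreBase ℓ).Monic := by
    have : (Polynomial.X ^ 2 - 1 : Polynomial ℝ).Monic := Polynomial.monic_X_pow_sub_C 1 two_ne_zero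
    exact this.pow ℓ
  have hdeg : (legendreBase ℓ).natDegree = 2 * ℓ := by
    rw [legendreBase, Polynomial.natDegree_pow,
      show (Polynomial.X ^ 2 - 1 : Polynomial ℝ) = Polynomial.X ^ 2 - Polynomial.C 1 by simp,
      Polynomial.natDegree_X_pow_sub_C, mul_comm]
  have hc := congrArg (fun p => Polynomial.coeff p (ℓ - m)) h
  simp only [Polynomial.coeff_iterate_derivative, Polynomial.coeff_zero,
    show ℓ - m + (ℓ + m) = 2 * ℓ by omega] at hc
  rw [show (legendreBase ℓ).coeff (2 * ℓ) = 1 by rw [← hdeg]; exact hmonic] at hc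
  have : (2 * ℓ).descFactorial (ℓ + m) ≠ 0 := by
    rw [Ne, Nat.descFactorial_eq_zero_iff_lt]
    omega
  simp at hc
  omega

/-! ## Spherical harmonics in Cartesian coordinates -/

/-- The function `p(x₂) (x₀ ± i x₁)^k`, where `ε = ±1` is the sign. -/
def tesseral (p : Polynomial ℝ) (k : ℕ) (ε : ℝ) (x : Space) : ℂ :=
  ((p.eval (x 2) : ℝ) : ℂ) * ((x 0 : ℂ) + (ε : ℂ) * (x 1 : ℂ) * Complex.I) ^ k

lemma contDiff_coord (j : Fin 3) : ContDiff ℝ ⊤ (fun x : Space => ((x j : ℝ) : ℂ)) :=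
  Complex.ofRealCLM.contDiff.comp (EuclideanSpace.proj (𝕜 := ℝ) j).contDiff

lemma contDiff_evalCoord (p : Polynomial ℝ) :
    ContDiff ℝ ⊤ (fun x : Space => ((p.eval (x 2) : ℝ) : ℂ)) := by
  have h1 : ContDiff ℝ ⊤ (fun x : Space => x 2) := by fun_prop
  have h2 : ContDiff ℝ ⊤ (fun z : ℝ => p.eval z) := by
    simpa only [Polynomial.coe_aeval_eq_eval] using p.contDiff_aeval (𝕜 := ℝ) ⊤
  exact Complex.ofRealCLM.contDiff.comp (h2.comp h1)

lemma contDiff_tesseral (p : Polynomial ℝ) (k : ℕ) (ε : ℝ) : ContDiff ℝ ⊤ (tesseral p k ε) :=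
  (contDiff_evalCoord p).mul
    (((contDiff_coord 0).add ((contDiff_const.mul (contDiff_coord 1)).mul contDiff_const)).pow k)

/-- `f'` is the derivative of `f` along the rotations about the axis `i`. -/
def HasRotDeriv (i : Fin 3) (f f' : Space → ℂ) : Prop :=
  ∀ x, HasDerivAt (fun s : ℝ => f (x + s • rotGen i x)) (f' x) 0

namespace HasRotDeriv

variable {i : Fin 3} {f f' g g' : Space → ℂ}

lemma rotDeriv_eq (h : HasRotDeriv i f f') (hf : Differentiable ℝ f) : rotDeriv i f = f' := by
  ext1 x
  have h1 : HasDerivAt (fun s : ℝ => x + s • rotGen i x) (rotGen i x) 0 := by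
    simpa using ((hasDerivAt_id (0 : ℝ)).smul_const (rotGen i x)).const_add x
  have h2 : HasFDerivAt f (fderiv ℝ f x) (x + (0 : ℝ) • rotGen i x) := by
    simpa using (hf x).hasFDerivAt
  exact (h2.comp_hasDerivAt 0 h1).unique (h x)

lemma mul (hf : HasRotDeriv i f f') (hg : HasRotDeriv i g g') :
    HasRotDeriv i (fun x => f x * g x) (fun x => f' x * g x + f x * g' x) := fun x => by
  simpa using (hf x).fun_mul (hg x)

lemma add (hf : HasRotDeriv i f f') (hg : HasRotDeriv i g g') :
    HasRotDeriv i (fun x => f x + g x) (fun x => f' x + g' x) := fun x => (hf x).add (hg x)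

lemma const (c : ℂ) : HasRotDeriv i (fun _ => c) (fun _ => 0) := fun _ => hasDerivAt_const _ _

lemma pow (hf : HasRotDeriv i f f') (k : ℕ) :
    HasRotDeriv i (fun x => f x ^ k) (fun x => k * f x ^ (k - 1) * f' x) := fun x => by
  simpa using (hf x).fun_pow k

lemma coord (j : Fin 3) : HasRotDeriv i (fun x => (x j : ℂ)) (fun x => (rotGen i x j : ℂ)) :=
  fun x => by
    have h : HasDerivAt (fun s : ℝ => x j + s * rotGen i x j) (rotGen i x j) 0 := by
      simpa using ((hasDerivAt_id (0 : ℝ)).mul_const (rotGen i x j)).const_add (x j)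
    simpa using h.ofReal_comp

lemma evalCoord (p : Polynomial ℝ) :
    HasRotDeriv i (fun x => ((p.eval (x 2) : ℝ) : ℂ))
      (fun x => ((p.derivative.eval (x 2) : ℝ) : ℂ) * (rotGen i x 2 : ℂ)) :=
  fun x => by
    have h : HasDerivAt (fun s : ℝ => x 2 + s * rotGen i x 2) (rotGen i x 2) 0 := by
      simpa using ((hasDerivAt_id (0 : ℝ)).mul_const (rotGen i x 2)).const_add (x 2)
    have h2 := (p.hasDerivAt (x 2 + 0 * rotGen i x 2)).comp (0 : ℝ) h
    simpa using h2.ofReal_comp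

end HasRotDeriv

lemma hasRotDeriv_horizontal (i : Fin 3) (ε : ℝ) :
    HasRotDeriv i (fun x => (x 0 : ℂ) + (ε : ℂ) * (x 1 : ℂ) * Complex.I)
      (fun x => (rotGen i x 0 : ℂ) + (ε : ℂ) * (rotGen i x 1 : ℂ) * Complex.I) := by
  have h := (HasRotDeriv.coord (i := i) 0).add
    (((HasRotDeriv.const (ε : ℂ)).mul (HasRotDeriv.coord (i := i) 1)).mul
      (HasRotDeriv.const Complex.I))
  simpa using h

lemma rotDeriv_tesseral (i : Fin 3) (p : Polynomial ℝ) (k : ℕ) (ε : ℝ) :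
    rotDeriv i (tesseral p k ε) = fun x =>
      (rotGen i x 2 : ℂ) * tesseral p.derivative k ε x
      + ((rotGen i x 0 : ℂ) + (ε : ℂ) * (rotGen i x 1 : ℂ) * Complex.I)
        * (k * tesseral p (k - 1) ε x) := by
  have h : HasRotDeriv i (tesseral p k ε) _ :=
    (HasRotDeriv.evalCoord p).mul ((hasRotDeriv_horizontal i ε).pow k)
  rw [h.rotDeriv_eq ((contDiff_tesseral p k ε).differentiable (by simp))]
  ext1 x
  simp only [tesseral]
  ring

/-- A rotation about the last axis fixes `x₂` and multiplies `x₀ + iε x₁` by a phase. This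
eigenvalue later separates harmonics of different `m`. -/
lemma rotDeriv_two_tesseral (p : Polynomial ℝ) (k : ℕ) {ε : ℝ} (hε : ε ^ 2 = 1) :
    rotDeriv 2 (tesseral p k ε) = fun x => (ε * k * Complex.I) * tesseral p k ε x := by
  rw [rotDeriv_tesseral]
  ext1 x
  have hε' : (ε : ℂ) ^ 2 = 1 := by exact_mod_cast hε
  rcases k with _ | k
  · simp [rotGen_apply]
  · simp [rotGen_apply, tesseral, pow_succ]
    linear_combination (-((p.eval (x 2) : ℝ) : ℂ) * ((x 0 : ℂ) + (ε : ℂ) * (x 1 : ℂ) * Complex.I) ^ k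
      * ((k : ℂ) + 1) * (x 1 : ℂ)) * (Complex.I ^ 2 * hε' + Complex.I_sq)

lemma rotDeriv_rotDeriv_tesseral (i : Fin 3) (p : Polynomial ℝ) (k : ℕ) (ε : ℝ) (x : Space) :
    rotDeriv i (rotDeriv i (tesseral p k ε)) x =
      (rotGen i (rotGen i x) 2 : ℂ) * tesseral p.derivative k ε x
      + (rotGen i x 2 : ℂ) * ((rotGen i x 2 : ℂ) * tesseral p.derivative.derivative k ε x
        + ((rotGen i x 0 : ℂ) + (ε : ℂ) * (rotGen i x 1 : ℂ) * Complex.I)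
          * (k * tesseral p.derivative (k - 1) ε x))
      + ((rotGen i (rotGen i x) 0 : ℂ) + (ε : ℂ) * (rotGen i (rotGen i x) 1 : ℂ) * Complex.I)
        * (k * tesseral p (k - 1) ε x)
      + ((rotGen i x 0 : ℂ) + (ε : ℂ) * (rotGen i x 1 : ℂ) * Complex.I)
        * (k * ((rotGen i x 2 : ℂ) * tesseral p.derivative (k - 1) ε x
          + ((rotGen i x 0 : ℂ) + (ε : ℂ) * (rotGen i x 1 : ℂ) * Complex.I)
            * ((k - 1 : ℕ) * tesseral p (k - 1 - 1) ε x))) := by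
  have hd : ∀ (q : Polynomial ℝ) (j : ℕ),
      HasRotDeriv i (tesseral q j ε) (rotDeriv i (tesseral q j ε)) := fun q j x => by
    have h1 : HasDerivAt (fun s : ℝ => x + s • rotGen i x) (rotGen i x) 0 := by
      simpa using ((hasDerivAt_id (0 : ℝ)).smul_const (rotGen i x)).const_add x
    have h2 : HasFDerivAt (tesseral q j ε) (fderiv ℝ (tesseral q j ε) x)
        (x + (0 : ℝ) • rotGen i x) := by
      simpa using ((contDiff_tesseral q j ε).differentiable (by simp) x).hasFDerivAt
    exact h2.comp_hasDerivAt 0 h1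
  have hc : ∀ j : Fin 3, HasRotDeriv i (fun x => (rotGen i x j : ℂ))
      (fun x => (rotGen i (rotGen i x) j : ℂ)) := fun j x => by
    have h : HasDerivAt (fun s : ℝ => rotGen i x j + s * rotGen i (rotGen i x) j)
        (rotGen i (rotGen i x) j) 0 := by
      simpa using ((hasDerivAt_id (0 : ℝ)).mul_const (rotGen i (rotGen i x) j)).const_add (rotGen i x j)
    simpa using h.ofReal_comp
  have h := ((hc 2).mul (hd p.derivative k)).add
    (((hc 0).add (((HasRotDeriv.const (ε : ℂ)).mul (hc 1)).mul (HasRotDeriv.const Complex.I))).mul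
      ((HasRotDeriv.const (k : ℂ)).mul (hd p (k - 1))))
  have hdiff : Differentiable ℝ (rotDeriv i (tesseral p k ε)) := by
    have := (contDiff_tesseral p k ε)
    exact (((this.fderiv_right (m := 1) (by simp)).clm_apply (rotGen i).contDiff).differentiable
      one_ne_zero)
  rw [← rotDeriv_tesseral] at h
  rw [h.rotDeriv_eq hdiff]
  simp only [rotDeriv_tesseral]
  ring

/-- The functions `p(x₂) (x₀ ± i x₁)^k` on the sphere that solve the associated Legendre equation
are eigenfunctions of the Laplacian of the sphere. -/
lemma sphereLaplacian_tesseral {p : Polynomial ℝ} {k : ℕ} {ε c : ℝ} (hε : ε ^ 2 = 1)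
    (hp : ∀ z, (1 - z ^ 2) * p.derivative.derivative.eval z - 2 * (k + 1) * z * p.derivative.eval z
      - k * (k + 1) * p.eval z = c * p.eval z) {n : Space} (hn : n ∈ unitSphere) :
    sphereLaplacian (tesseral p k ε) n = c * tesseral p k ε n := by
  have hn2 : (n 0) ^ 2 + (n 1) ^ 2 + (n 2) ^ 2 = 1 := by
    have h : ‖n‖ ^ 2 = 1 := by
      rw [show ‖n‖ = 1 by simpa using hn, one_pow]
    rw [EuclideanSpace.norm_sq_eq] at h
    simpa [Fin.sum_univ_three] using h
  have hn2' : (n 0 : ℂ) ^ 2 + (n 1 : ℂ) ^ 2 + (n 2 : ℂ) ^ 2 = 1 := by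
    rw [← Complex.ofReal_one, ← hn2]
    push_cast
    rfl
  have hε' : (ε : ℂ) ^ 2 = 1 := by exact_mod_cast hε
  have hp' : (1 - (n 2 : ℂ) ^ 2) * (p.derivative.derivative.eval (n 2) : ℝ)
      - 2 * (k + 1) * (n 2) * (p.derivative.eval (n 2) : ℝ)
      - k * (k + 1) * (p.eval (n 2) : ℝ) = c * (p.eval (n 2) : ℝ) := by
    exact_mod_cast hp (n 2)
  simp only [sphereLaplacian, Fin.sum_univ_three, rotDeriv_rotDeriv_tesseral]
  simp only [rotGen_apply, tesseral]
  have hI : (ε : ℂ) ^ 2 * Complex.I ^ 2 = -1 := by rw [hε', Complex.I_sq, one_mul]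
  generalize hP : ((p.eval (n 2) : ℝ) : ℂ) = P at *
  generalize ((p.derivative.eval (n 2) : ℝ) : ℂ) = P1 at *
  generalize ((p.derivative.derivative.eval (n 2) : ℝ) : ℂ) = P2 at *
  simp only [Fin.isValue, zero_add, Fin.reduceAdd, Fin.reduceEq, ite_true, ite_false, mul_one,
    mul_zero, sub_zero, zero_sub, zero_mul, add_zero, Complex.ofReal_neg, Complex.ofReal_zero]
  -- The exponents `k - 1` and `k - 1 - 1` are truncated, so `k = 0` and `k = 1` need separate
  -- treatment.
  rcases k with _ | _ | k
  · simp only [Nat.cast_zero] at hp'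
    simp
    linear_combination hp' + P2 * hn2'
  · simp at hp' ⊢
    linear_combination ((n 0 : ℂ) + (ε : ℂ) * (n 1 : ℂ) * Complex.I) * (hp' + P2 * hn2')
  · simp only [Nat.cast_add, Nat.cast_one, Nat.add_sub_cancel] at hp' ⊢
    simp only [pow_succ _ (k + 1), pow_succ _ k]
    linear_combination ((n 0 : ℂ) + (ε : ℂ) * (n 1 : ℂ) * Complex.I) ^ k *
      (((n 0 : ℂ) + (ε : ℂ) * (n 1 : ℂ) * Complex.I) ^ 2 * (hp' + P2 * hn2')
        + P * (k + 2) * (k + 1) * ((n 0 : ℂ) ^ 2 + (n 1 : ℂ) ^ 2 + (n 2 : ℂ) ^ 2) * hI)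

/-! ## Spherical harmonics: eigenfunctions, orthogonality and bounds -/

/-- The normalization constant of `Y_{ℓ m}`. -/
def sphNorm (ℓ m : ℕ) : ℝ :=
  Real.sqrt ((2 * ℓ + 1) / (4 * Real.pi) * (((ℓ - m).factorial : ℝ) / ((ℓ + m).factorial : ℝ)))

/-- The sign of `m`, with value `1` at `0`. -/
def sphSign (m : ℤ) : ℝ := if 0 ≤ m then 1 else -1

/-- The constant factor of `Y_{ℓ m}`. -/
def sphConst (ℓ : ℕ) (m : ℤ) : ℝ := (if 0 ≤ m then (-1) ^ m.natAbs else 1) * sphNorm ℓ m.natAbs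

/-- The polynomial factor of `Y_{ℓ m}`. -/
def sphPoly (ℓ : ℕ) (m : ℤ) : Polynomial ℝ := Polynomial.derivative^[m.natAbs] (legendrePoly ℓ)

lemma sphSign_sq (m : ℤ) : sphSign m ^ 2 = 1 := by
  unfold sphSign
  split_ifs <;> norm_num

lemma sphSign_mul_natAbs (m : ℤ) : (sphSign m : ℂ) * (m.natAbs : ℂ) = m := by
  unfold sphSign
  rcases Int.natAbs_eq m with h | h
  · rw [if_pos (by omega)]
    nth_rw 2 [h]
    simp
  · by_cases h0 : 0 ≤ m
    · have : m = 0 := by omega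
      simp [this]
    · rw [if_neg h0]
      nth_rw 2 [h]
      simp

lemma conj_tesseral (p : Polynomial ℝ) (k : ℕ) (ε : ℝ) (n : Space) :
    (starRingEnd ℂ) (tesseral p k ε n) = tesseral p k (-ε) n := by
  simp [tesseral]

lemma sphHarm_eq (ℓ : ℕ) (m : ℤ) (n : Space) :
    sphHarm ℓ m n = sphConst ℓ m * tesseral (sphPoly ℓ m) m.natAbs (sphSign m) n := by
  have h : sphHarmNat ℓ m.natAbs n
      = ((-1) ^ m.natAbs * sphNorm ℓ m.natAbs : ℝ) * tesseral (sphPoly ℓ m) m.natAbs 1 n := by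
    simp only [sphHarmNat, sphNorm, tesseral, sphPoly]
    push_cast
    ring
  unfold sphHarm sphConst sphSign
  rw [h]
  split_ifs
  · rfl
  · rw [map_mul, conj_tesseral, Complex.conj_ofReal]
    push_cast
    rw [← mul_assoc, ← mul_assoc, ← mul_pow]
    simp

lemma conj_sphHarm_eq (ℓ : ℕ) (m : ℤ) (n : Space) :
    (starRingEnd ℂ) (sphHarm ℓ m n)
      = sphConst ℓ m * tesseral (sphPoly ℓ m) m.natAbs (-sphSign m) n := by
  rw [sphHarm_eq, map_mul, conj_tesseral, Complex.conj_ofReal]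

/-- The complex conjugate of `Y_{ℓ m}`. -/
def sphHarmConj (ℓ : ℕ) (m : ℤ) (n : Space) : ℂ := (starRingEnd ℂ) (sphHarm ℓ m n)

lemma contDiff_sphHarm (ℓ : ℕ) (m : ℤ) : ContDiff ℝ ⊤ (sphHarm ℓ m) := by
  rw [show sphHarm ℓ m = _ from funext (sphHarm_eq ℓ m)]
  exact contDiff_const.mul (contDiff_tesseral _ _ _)

lemma contDiff_sphHarmConj (ℓ : ℕ) (m : ℤ) : ContDiff ℝ ⊤ (sphHarmConj ℓ m) := by
  rw [show sphHarmConj ℓ m = _ from funext (conj_sphHarm_eq ℓ m)]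
  exact contDiff_const.mul (contDiff_tesseral _ _ _)

lemma rotDeriv_const_mul (i : Fin 3) (c : ℂ) {F : Space → ℂ} (hF : Differentiable ℝ F) :
    rotDeriv i (fun x => c * F x) = fun x => c * rotDeriv i F x := by
  ext1 x
  simp [rotDeriv, fderiv_const_mul (hF x)]

lemma sphereLaplacian_const_mul (c : ℂ) {F : Space → ℂ} (hF : ContDiff ℝ 2 F) :
    sphereLaplacian (fun x => c * F x) = fun x => c * sphereLaplacian F x := by
  ext1 x
  simp only [sphereLaplacian, Finset.mul_sum]
  refine Finset.sum_congr rfl fun i _ => ?_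
  rw [rotDeriv_const_mul i c (hF.differentiable two_ne_zero), rotDeriv_const_mul i c]
  exact (contDiffOn_univ.1 (contDiffOn_rotDeriv i isOpen_univ hF.contDiffOn)).differentiable
    one_ne_zero

lemma sphPoly_ode (ℓ : ℕ) (m : ℤ) (z : ℝ) :
    (1 - z ^ 2) * (sphPoly ℓ m).derivative.derivative.eval z
      - 2 * (m.natAbs + 1) * z * (sphPoly ℓ m).derivative.eval z
      - m.natAbs * (m.natAbs + 1) * (sphPoly ℓ m).eval z
    = -(ℓ * (ℓ + 1) : ℝ) * (sphPoly ℓ m).eval z := by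
  have h := legendrePoly_ode ℓ m.natAbs z
  simp only [Function.iterate_succ_apply'] at h
  exact h

lemma sphereLaplacian_sphHarm (ℓ : ℕ) (m : ℤ) {n : Space} (hn : n ∈ unitSphere) :
    sphereLaplacian (sphHarm ℓ m) n = -(ℓ * (ℓ + 1)) * sphHarm ℓ m n := by
  rw [show sphHarm ℓ m = _ from funext (sphHarm_eq ℓ m),
    sphereLaplacian_const_mul _ ((contDiff_tesseral _ _ _).of_le le_top)]
  simp only
  rw [sphereLaplacian_tesseral (sphSign_sq m) (sphPoly_ode ℓ m) hn]
  push_cast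
  ring

lemma sphereLaplacian_sphHarmConj (ℓ : ℕ) (m : ℤ) {n : Space} (hn : n ∈ unitSphere) :
    sphereLaplacian (sphHarmConj ℓ m) n = -(ℓ * (ℓ + 1)) * sphHarmConj ℓ m n := by
  rw [show sphHarmConj ℓ m = _ from funext (conj_sphHarm_eq ℓ m),
    sphereLaplacian_const_mul _ ((contDiff_tesseral _ _ _).of_le le_top)]
  simp only
  rw [sphereLaplacian_tesseral (by rw [neg_sq, sphSign_sq]) (sphPoly_ode ℓ m) hn]
  push_cast
  ring

lemma rotDeriv_two_sphHarm (ℓ : ℕ) (m : ℤ) :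
    rotDeriv 2 (sphHarm ℓ m) = fun n => (m * Complex.I) * sphHarm ℓ m n := by
  rw [show sphHarm ℓ m = _ from funext (sphHarm_eq ℓ m),
    rotDeriv_const_mul _ _ ((contDiff_tesseral _ _ _).differentiable (by simp)),
    rotDeriv_two_tesseral _ _ (sphSign_sq m)]
  ext1 n
  rw [← sphSign_mul_natAbs m]
  ring

lemma rotDeriv_two_sphHarmConj (ℓ : ℕ) (m : ℤ) :
    rotDeriv 2 (sphHarmConj ℓ m) = fun n => -(m * Complex.I) * sphHarmConj ℓ m n := by
  rw [show sphHarmConj ℓ m = _ from funext (conj_sphHarm_eq ℓ m),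
    rotDeriv_const_mul _ _ ((contDiff_tesseral _ _ _).differentiable (by simp)),
    rotDeriv_two_tesseral _ _ (show (-sphSign m) ^ 2 = 1 by rw [neg_sq, sphSign_sq])]
  ext1 n
  rw [← sphSign_mul_natAbs m]
  push_cast
  ring

/-- Spherical harmonics of different index are orthogonal. -/
lemma integral_sphHarm_mul_conj_eq_zero {ℓ ℓ' : ℕ} {m m' : ℤ} (h : (ℓ, m) ≠ (ℓ', m')) :
    ∫ n, sphHarm ℓ m n * sphHarmConj ℓ' m' n ∂sphereMeasure = 0 := by
  have h1 : ∀ ℓ m, ContDiffOn ℝ 1 (sphHarm ℓ m) univ := fun ℓ m =>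
    ((contDiff_sphHarm ℓ m).of_le le_top).contDiffOn
  have h1' : ∀ ℓ m, ContDiffOn ℝ 1 (sphHarmConj ℓ m) univ := fun ℓ m =>
    ((contDiff_sphHarmConj ℓ m).of_le le_top).contDiffOn
  have h2 : ∀ ℓ m, ContDiffOn ℝ 2 (sphHarm ℓ m) univ := fun ℓ m =>
    ((contDiff_sphHarm ℓ m).of_le le_top).contDiffOn
  have h2' : ∀ ℓ m, ContDiffOn ℝ 2 (sphHarmConj ℓ m) univ := fun ℓ m =>
    ((contDiff_sphHarmConj ℓ m).of_le le_top).contDiffOn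
  -- For equal `m` the degrees differ, and symmetry of the sphere Laplacian applies because `ℓ(ℓ+1)
  -- - ℓ'(ℓ'+1) = (ℓ-ℓ')(ℓ+ℓ'+1)` is nonzero. For different `m` the rotation about the last axis
  -- decides.
  by_cases hm : m = m'
  · have hℓ : ℓ ≠ ℓ' := fun hℓ => h (by rw [hm, hℓ])
    have hI := integral_sphereLaplacian_mul isOpen_univ (subset_univ _) (h2 ℓ m) (h2' ℓ' m')
    rw [integral_sphere_congr (G := fun n => (-(ℓ * (ℓ + 1)) : ℂ) *
        (sphHarm ℓ m n * sphHarmConj ℓ' m' n)) fun n hn => by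
          rw [sphereLaplacian_sphHarm ℓ m hn]; ring,
      integral_sphere_congr (F := fun n => sphHarm ℓ m n * sphereLaplacian (sphHarmConj ℓ' m') n)
        (G := fun n => (-(ℓ' * (ℓ' + 1)) : ℂ) *
        (sphHarm ℓ m n * sphHarmConj ℓ' m' n)) fun n hn => by
          rw [sphereLaplacian_sphHarmConj ℓ' m' hn]; ring,
      integral_const_mul, integral_const_mul] at hI
    have hne : ((ℓ : ℂ) - ℓ') * (ℓ + ℓ' + 1) ≠ 0 := by
      refine mul_ne_zero (sub_ne_zero.2 (by exact_mod_cast hℓ)) ?_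
      exact_mod_cast Nat.succ_ne_zero (ℓ + ℓ')
    refine (mul_eq_zero.1 ?_).resolve_left hne
    linear_combination -hI
  · have hI := integral_rotDeriv_mul 2 isOpen_univ (subset_univ _) (h1 ℓ m) (h1' ℓ' m')
    rw [rotDeriv_two_sphHarm, rotDeriv_two_sphHarmConj] at hI
    have e1 : ∀ n, m * Complex.I * sphHarm ℓ m n * sphHarmConj ℓ' m' n
        = (m * Complex.I) * (sphHarm ℓ m n * sphHarmConj ℓ' m' n) := fun n => by ring
    have e2 : ∀ n, sphHarm ℓ m n * (-(m' * Complex.I) * sphHarmConj ℓ' m' n)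
        = -(m' * Complex.I) * (sphHarm ℓ m n * sphHarmConj ℓ' m' n) := fun n => by ring
    simp only [e1, e2] at hI
    rw [integral_const_mul, integral_const_mul] at hI
    have hne : ((m : ℂ) - m') * Complex.I ≠ 0 :=
      mul_ne_zero (sub_ne_zero.2 (by exact_mod_cast hm)) Complex.I_ne_zero
    refine (mul_eq_zero.1 ?_).resolve_left hne
    linear_combination hI

lemma sphNorm_pos (ℓ m : ℕ) : 0 < sphNorm ℓ m :=
  Real.sqrt_pos.2 (mul_pos (by positivity) (div_pos (by exact_mod_cast Nat.factorial_pos _)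
    (by exact_mod_cast Nat.factorial_pos _)))

lemma abs_sphConst (ℓ : ℕ) (m : ℤ) : |sphConst ℓ m| = sphNorm ℓ m.natAbs := by
  unfold sphConst
  rw [abs_mul, abs_of_pos (sphNorm_pos _ _)]
  split_ifs <;> simp

lemma natAbs_le_of_abs_le {ℓ : ℕ} {m : ℤ} (hm : |m| ≤ (ℓ : ℤ)) : m.natAbs ≤ ℓ := by
  rw [Int.abs_eq_natAbs] at hm
  exact_mod_cast hm

/-- On the meridian `x₁ = 0` away from the poles the horizontal factor is nonzero, and the
polynomial factor has finitely many roots. -/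
lemma exists_sphHarm_ne_zero {ℓ : ℕ} {m : ℤ} (hm : |m| ≤ (ℓ : ℤ)) :
    ∃ n ∈ unitSphere, sphHarm ℓ m n ≠ 0 := by
  have hp : sphPoly ℓ m ≠ 0 := iterate_derivative_legendrePoly_ne_zero (natAbs_le_of_abs_le hm)
  have hinf : (Ioo (-1 : ℝ) 1 \ {z | (sphPoly ℓ m).IsRoot z}).Nonempty :=
    ((Ioo_infinite (by norm_num : (-1 : ℝ) < 1)).sdiff
      (Polynomial.finite_setOfPred_isRoot hp)).nonempty
  obtain ⟨z, hz, hroot⟩ := hinf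
  have hz2 : 0 < 1 - z ^ 2 := by nlinarith [hz.1, hz.2]
  refine ⟨!₂[Real.sqrt (1 - z ^ 2), 0, z], ?_, ?_⟩
  · have : ‖(!₂[Real.sqrt (1 - z ^ 2), 0, z] : Space)‖ ^ 2 = 1 := by
      rw [EuclideanSpace.norm_sq_eq]
      simp [Fin.sum_univ_three, Real.sq_sqrt hz2.le]
    have h1 : ‖(!₂[Real.sqrt (1 - z ^ 2), 0, z] : Space)‖ = 1 := by
      exact (pow_eq_one_iff_of_nonneg (norm_nonneg _) two_ne_zero).1 this
    simpa using h1
  · have hc : sphConst ℓ m ≠ 0 := by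
      rw [← abs_pos, abs_sphConst]
      exact sphNorm_pos _ _
    have hsq : Real.sqrt (1 - z ^ 2) ≠ 0 := (Real.sqrt_pos.2 hz2).ne'
    rw [sphHarm_eq]
    refine mul_ne_zero (by exact_mod_cast hc) ?_
    simp only [tesseral]
    refine mul_ne_zero ?_ (pow_ne_zero _ ?_)
    · simpa using hroot
    · simpa using hsq

/-- The square of the norm of `Y_{ℓ m}` in `L²` of the sphere. -/
def sphNormSq (ℓ : ℕ) (m : ℤ) : ℂ := ∫ n, sphHarm ℓ m n * sphHarmConj ℓ m n ∂sphereMeasure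

lemma sphNormSq_ne_zero {ℓ : ℕ} {m : ℤ} (hm : |m| ≤ (ℓ : ℤ)) : sphNormSq ℓ m ≠ 0 := by
  obtain ⟨n, hn, h0⟩ := exists_sphHarm_ne_zero hm
  have h := integral_sphere_pos (F := fun n => Complex.normSq (sphHarm ℓ m n))
    (Complex.continuous_normSq.comp (contDiff_sphHarm ℓ m).continuous)
    (fun n => Complex.normSq_nonneg _) hn (Complex.normSq_pos.2 h0)
  have h2 : sphNormSq ℓ m = ((∫ n, Complex.normSq (sphHarm ℓ m n) ∂sphereMeasure : ℝ) : ℂ) := by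
    refine Eq.trans ?_ integral_ofReal
    exact integral_congr_ae (Eventually.of_forall fun n => Complex.mul_conj _)
  rw [h2]
  exact_mod_cast h.ne'

/-- A crude exponential bound is enough, since it only costs a fixed factor in the range of `ρ`. The
squared bound is `(2ℓ+1)/(4π)` times two binomial coefficients of `2ℓ`, each of the three factors
being at most `4^ℓ`. -/
lemma norm_sphHarm_le {ℓ : ℕ} {m : ℤ} (hm : |m| ≤ (ℓ : ℤ)) {n : Space} (hn : n ∈ unitSphere) :
    ‖sphHarm ℓ m n‖ ≤ 8 ^ ℓ := by
  have hn1 : ‖n‖ = 1 := by simpa using hn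
  have hn2 : (n 0) ^ 2 + (n 1) ^ 2 + (n 2) ^ 2 = 1 := by
    have h : ‖n‖ ^ 2 = 1 := by rw [hn1, one_pow]
    rw [EuclideanSpace.norm_sq_eq] at h
    simpa [Fin.sum_univ_three] using h
  set k := m.natAbs with hk
  have hkℓ : k ≤ ℓ := natAbs_le_of_abs_le hm
  have hw : ‖((n 0 : ℂ) + (sphSign m : ℂ) * (n 1 : ℂ) * Complex.I) ^ k‖ ≤ 1 := by
    rw [norm_pow]
    refine pow_le_one₀ (norm_nonneg _) ?_
    have : ‖(n 0 : ℂ) + (sphSign m : ℂ) * (n 1 : ℂ) * Complex.I‖ ^ 2 ≤ 1 := by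
      rw [← Complex.ofReal_mul, ← Complex.normSq_eq_norm_sq, Complex.normSq_add_mul_I, mul_pow,
        sphSign_sq, one_mul]
      nlinarith [sq_nonneg (n 2)]
    nlinarith [norm_nonneg ((n 0 : ℂ) + (sphSign m : ℂ) * (n 1 : ℂ) * Complex.I)]
  have hP := abs_eval_iterate_derivative_legendrePoly_le hkℓ (z := n 2)
    (abs_le_one_iff_mul_self_le_one.2 (by nlinarith [sq_nonneg (n 0), sq_nonneg (n 1)]))
  have hN : sphNorm ℓ k * ((2 * ℓ).factorial / ((ℓ - k).factorial * ℓ.factorial : ℝ)) ≤ 8 ^ ℓ := by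
    refine abs_le_of_sq_le_sq' ?_ (by positivity) |>.2
    have f1 : (0 : ℝ) < (ℓ - k).factorial := by exact_mod_cast Nat.factorial_pos _
    have f2 : (0 : ℝ) < ℓ.factorial := by exact_mod_cast Nat.factorial_pos _
    have f3 : (0 : ℝ) < (ℓ + k).factorial := by exact_mod_cast Nat.factorial_pos _
    have c1 : ((2 * ℓ).choose (ℓ - k) : ℝ) * ((ℓ - k).factorial * (ℓ + k).factorial)
        = (2 * ℓ).factorial := by
      have := Nat.choose_mul_factorial_mul_factorial (n := 2 * ℓ) (k := ℓ - k) (by omega)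
      rw [show 2 * ℓ - (ℓ - k) = ℓ + k by omega] at this
      rw [← mul_assoc]
      exact_mod_cast this
    have c2 : ((2 * ℓ).choose ℓ : ℝ) * (ℓ.factorial * ℓ.factorial) = (2 * ℓ).factorial := by
      have := Nat.choose_mul_factorial_mul_factorial (n := 2 * ℓ) (k := ℓ) (by omega)
      rw [show 2 * ℓ - ℓ = ℓ by omega] at this
      rw [← mul_assoc]
      exact_mod_cast this
    have b1 : ∀ j, ((2 * ℓ).choose j : ℝ) ≤ 4 ^ ℓ := fun j => by
      have := Nat.choose_le_two_pow (2 * ℓ) j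
      rw [pow_mul] at this
      exact_mod_cast this
    have b2 : (2 * ℓ + 1 : ℝ) / (4 * Real.pi) ≤ 4 ^ ℓ := by
      have h1 : (2 * ℓ + 1 : ℝ) ≤ 4 ^ ℓ := by
        have := one_add_mul_le_pow (a := (3 : ℝ)) (by norm_num) ℓ
        norm_num at this
        linarith [(Nat.cast_nonneg ℓ : (0 : ℝ) ≤ ℓ)]
      have h2 : (2 * ℓ + 1 : ℝ) / (4 * Real.pi) ≤ 2 * ℓ + 1 :=
        div_le_self (by positivity) (by linarith [Real.pi_gt_three])
      linarith
    rw [mul_pow, sphNorm, Real.sq_sqrt (by positivity)]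
    calc _ = (2 * ℓ + 1 : ℝ) / (4 * Real.pi) * (((2 * ℓ).choose (ℓ - k) : ℝ)
          * ((2 * ℓ).choose ℓ : ℝ)) := by
          have e1 : ((2 * ℓ).choose (ℓ - k) : ℝ)
              = (2 * ℓ).factorial / ((ℓ - k).factorial * (ℓ + k).factorial) := by
            rw [← c1]; field_simp
          have e2 : ((2 * ℓ).choose ℓ : ℝ) = (2 * ℓ).factorial / (ℓ.factorial * ℓ.factorial) := by
            rw [← c2]; field_simp
          rw [e1, e2]
          field_simp
      _ ≤ 4 ^ ℓ * (4 ^ ℓ * 4 ^ ℓ) := by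
          gcongr
          · exact b1 _
          · exact b1 _
      _ = (8 ^ ℓ) ^ 2 := by
          rw [← mul_pow, ← mul_pow, ← pow_mul, mul_comm ℓ 2, pow_mul]
          norm_num
  rw [sphHarm_eq, norm_mul, tesseral, norm_mul, Complex.norm_real, Complex.norm_real,
    Real.norm_eq_abs, Real.norm_eq_abs, abs_sphConst, ← mul_assoc]
  calc _ ≤ sphNorm ℓ k * ((2 * ℓ).factorial / ((ℓ - k).factorial * ℓ.factorial : ℝ)) * 1 := by
        refine mul_le_mul (mul_le_mul_of_nonneg_left hP (sphNorm_pos _ _).le) hw (norm_nonneg _) ?_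
        exact mul_nonneg (sphNorm_pos _ _).le (by positivity)
    _ ≤ _ := by rwa [mul_one]

/-! ## Projection of spacetime fields to spherical harmonics -/

/-- The range of the coordinates `(t, r)` on the neighbourhood of the cylinder. -/
def coneRegion (ρ₀ : ℝ) : Set (ℝ × ℝ) := {p | |p.1| < p.2 ∧ p.2 / (p.2 ^ 2 - p.1 ^ 2) < ρ₀}

lemma isOpen_coneRegion (ρ₀ : ℝ) : IsOpen (coneRegion ρ₀) := by
  have h1 : IsOpen {p : ℝ × ℝ | |p.1| < p.2} := isOpen_lt (by fun_prop) (by fun_prop)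
  have h2 : ContinuousOn (fun p : ℝ × ℝ => p.2 / (p.2 ^ 2 - p.1 ^ 2)) {p : ℝ × ℝ | |p.1| < p.2} := by
    refine ContinuousOn.div (by fun_prop) (by fun_prop) fun p hp => ?_
    have hp : |p.1| < p.2 := hp
    have := sq_lt_sq' (by linarith [abs_nonneg p.1]) hp
    rw [sq_abs] at this
    linarith
  exact h2.isOpen_inter_preimage h1 isOpen_Iio

lemma nearCylinder_eq (ρ₀ : ℝ) :
    nearCylinder ρ₀ = (fun q : Spacetime => (q.1, ‖q.2‖)) ⁻¹' coneRegion ρ₀ := rfl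

lemma isOpen_nearCylinder (ρ₀ : ℝ) : IsOpen (nearCylinder ρ₀) := by
  rw [nearCylinder_eq]
  exact (isOpen_coneRegion ρ₀).preimage (by fun_prop)

lemma coneRegion_pos {ρ₀ t r : ℝ} (h : (t, r) ∈ coneRegion ρ₀) : 0 < r :=
  (abs_nonneg t).trans_lt h.1

lemma norm_smul_unit {r : ℝ} (hr : 0 < r) {n : Space} (hn : n ∈ unitSphere) : ‖r • n‖ = r := by
  have hn1 : ‖n‖ = 1 := by simpa using hn
  rw [norm_smul, hn1, mul_one, Real.norm_of_nonneg hr.le]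

lemma mem_nearCylinder {ρ₀ t r : ℝ} (h : (t, r) ∈ coneRegion ρ₀) {n : Space}
    (hn : n ∈ unitSphere) : (t, r • n) ∈ nearCylinder ρ₀ := by
  rw [nearCylinder_eq, mem_preimage]
  simpa only [norm_smul_unit (coneRegion_pos h) hn] using h

/-- The projection of a field to `Y_{ℓ m}`. -/
def sphProj (ℓ : ℕ) (m : ℤ) (G : Spacetime → ℂ) (t r : ℝ) : ℂ :=
  ∫ n, G (t, r • n) * sphHarmConj ℓ m n ∂sphereMeasure

lemma continuousOn_sphHarmConj (ℓ : ℕ) (m : ℤ) : ContinuousOn (sphHarmConj ℓ m) unitSphere :=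
  (contDiff_sphHarmConj ℓ m).continuous.continuousOn

/-- Differentiation of spherical integrals along straight lines in the `(t, r)` plane. -/
lemma hasDerivAt_integral_ray {E : Type*} [NormedAddCommGroup E] [NormedSpace ℝ E] {ρ₀ : ℝ}
    {V : Spacetime → E} (hV : ContDiffOn ℝ 1 V (nearCylinder ρ₀)) {c : Space → E →L[ℝ] ℂ}
    (hc : ContinuousOn c unitSphere) {t r α β s₀ : ℝ}
    (h : (t + α * s₀, r + β * s₀) ∈ coneRegion ρ₀) :
    HasDerivAt (fun s => ∫ n, c n (V (t + α * s, (r + β * s) • n)) ∂sphereMeasure)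
      (∫ n, c n (fderiv ℝ V (t + α * s₀, (r + β * s₀) • n) (α, β • n)) ∂sphereMeasure) s₀ := by
  have hopen := isOpen_nearCylinder ρ₀
  have hpre : IsOpen ((fun s : ℝ => (t + α * s, r + β * s)) ⁻¹' coneRegion ρ₀) :=
    (isOpen_coneRegion ρ₀).preimage (by fun_prop)
  obtain ⟨ε, hε, hball⟩ := Metric.nhds_basis_closedBall.mem_iff.1 (hpre.mem_nhds h)
  have hmaps : MapsTo (fun p : ℝ × Space => ((t + α * p.1, (r + β * p.1) • p.2) : Spacetime))
      (Metric.closedBall s₀ ε ×ˢ unitSphere) (nearCylinder ρ₀) :=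
    fun p hp => mem_nearCylinder (hball hp.1) hp.2
  have hcont : ContinuousOn (fun p : ℝ × Space =>
      ((t + α * p.1, (r + β * p.1) • p.2) : Spacetime)) (Metric.closedBall s₀ ε ×ˢ unitSphere) :=
    Continuous.continuousOn (by fun_prop)
  have hcc : ContinuousOn (fun p : ℝ × Space => c p.2) (Metric.closedBall s₀ ε ×ˢ unitSphere) :=
    hc.comp continuous_snd.continuousOn fun p hp => hp.2
  have hH : ContinuousOn (fun p : ℝ × Space => c p.2 (V (t + α * p.1, (r + β * p.1) • p.2)))
      (Metric.closedBall s₀ ε ×ˢ unitSphere) :=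
    hcc.clm_apply (hV.continuousOn.comp hcont hmaps)
  have hH' : ContinuousOn (fun p : ℝ × Space =>
      c p.2 (fderiv ℝ V (t + α * p.1, (r + β * p.1) • p.2) (α, β • p.2)))
      (Metric.closedBall s₀ ε ×ˢ unitSphere) :=
    hcc.clm_apply (((hV.continuousOn_fderiv_of_isOpen hopen le_rfl).comp hcont hmaps).clm_apply
      (Continuous.continuousOn (by fun_prop)))
  have hslice : ∀ s ∈ Metric.closedBall s₀ ε, ContinuousOn (fun n : Space => (s, n)) unitSphere ∧
      MapsTo (fun n : Space => (s, n)) unitSphere (Metric.closedBall s₀ ε ×ˢ unitSphere) :=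
    fun s hs => ⟨Continuous.continuousOn (by fun_prop), fun n hn => ⟨hs, hn⟩⟩
  -- Compactness of interval times sphere supplies the constant dominating function for
  -- differentiation under the integral.
  obtain ⟨C, hC⟩ := ((isCompact_closedBall s₀ ε).prod
    (isCompact_sphere (0 : Space) 1)).exists_bound_of_continuousOn hH'
  refine hasDerivAt_integral_sphere (C := C) hε
    (H := fun s n => c n (V (t + α * s, (r + β * s) • n)))
    (H' := fun s n => c n (fderiv ℝ V (t + α * s, (r + β * s) • n) (α, β • n))) ?_ ?_ ?_ ?_
  · intro s hs
    exact hH.comp (hslice s (Metric.ball_subset_closedBall hs)).1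
      (hslice s (Metric.ball_subset_closedBall hs)).2
  · exact hH'.comp (hslice s₀ (Metric.mem_closedBall_self hε.le)).1
      (hslice s₀ (Metric.mem_closedBall_self hε.le)).2
  · exact fun n hn s hs => hC (s, n) ⟨Metric.ball_subset_closedBall hs, hn⟩
  · intro n hn s hs
    have hd : DifferentiableAt ℝ V (t + α * s, (r + β * s) • n) :=
      (hV.contDiffAt (hopen.mem_nhds
        (hmaps (x := (s, n)) ⟨Metric.ball_subset_closedBall hs, hn⟩))).differentiableAt one_ne_zero
    have hline : HasDerivAt (fun s : ℝ => ((t + α * s, (r + β * s) • n) : Spacetime))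
        (α, β • n) s := by
      have h1 : HasDerivAt (fun s : ℝ => t + α * s) α s := by
        simpa using ((hasDerivAt_id s).const_mul α).const_add t
      have h2 : HasDerivAt (fun s : ℝ => r + β * s) β s := by
        simpa using ((hasDerivAt_id s).const_mul β).const_add r
      exact h1.prodMk (h2.smul_const n)
    exact (c n).hasFDerivAt.comp_hasDerivAt s (hd.hasFDerivAt.comp_hasDerivAt s hline)

/-- Evaluation of covectors at `(α, β n)`, weighted by the conjugate of `Y_{ℓ m}`. -/
def evalWeight (ℓ : ℕ) (m : ℤ) (α β : ℝ) (n : Space) : (Spacetime →L[ℝ] ℂ) →L[ℝ] ℂ :=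
  ((ContinuousLinearMap.mul ℝ ℂ).flip (sphHarmConj ℓ m n)) ∘L
    (ContinuousLinearMap.apply ℝ ℂ ((α, β • n) : Spacetime))

lemma evalWeight_apply (ℓ : ℕ) (m : ℤ) (α β : ℝ) (n : Space) (D : Spacetime →L[ℝ] ℂ) :
    evalWeight ℓ m α β n D = D (α, β • n) * sphHarmConj ℓ m n := by
  simp [evalWeight, mul_comm]

lemma continuousOn_evalWeight (ℓ : ℕ) (m : ℤ) (α β : ℝ) :
    ContinuousOn (evalWeight ℓ m α β) unitSphere := by
  unfold evalWeight
  refine ContinuousOn.clm_comp ?_ ?_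
  · exact (ContinuousLinearMap.continuous _).comp_continuousOn (continuousOn_sphHarmConj ℓ m)
  · exact (ContinuousLinearMap.continuous _).comp_continuousOn
      (Continuous.continuousOn (by fun_prop))

lemma hasDerivAt_sphProj {ρ₀ : ℝ} {G : Spacetime → ℂ} (hG : ContDiffOn ℝ 2 G (nearCylinder ρ₀))
    (ℓ : ℕ) (m : ℤ) {t r α β s₀ : ℝ} (h : (t + α * s₀, r + β * s₀) ∈ coneRegion ρ₀) :
    HasDerivAt (fun s => sphProj ℓ m G (t + α * s) (r + β * s))
      (∫ n, fderiv ℝ G (t + α * s₀, (r + β * s₀) • n) (α, β • n) * sphHarmConj ℓ m n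
        ∂sphereMeasure) s₀ :=
  hasDerivAt_integral_ray (hG.of_le (show (1 : WithTop ℕ∞) ≤ 2 by norm_num))
    (c := fun n => (ContinuousLinearMap.mul ℝ ℂ).flip (sphHarmConj ℓ m n))
    ((ContinuousLinearMap.continuous _).comp_continuousOn (continuousOn_sphHarmConj ℓ m)) h

lemma hasDerivAt_integral_fderiv {ρ₀ : ℝ} {G : Spacetime → ℂ}
    (hG : ContDiffOn ℝ 2 G (nearCylinder ρ₀)) (ℓ : ℕ) (m : ℤ) (α' β' : ℝ) {t r α β s₀ : ℝ}
    (h : (t + α * s₀, r + β * s₀) ∈ coneRegion ρ₀) :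
    HasDerivAt (fun s => ∫ n, fderiv ℝ G (t + α * s, (r + β * s) • n) (α', β' • n)
        * sphHarmConj ℓ m n ∂sphereMeasure)
      (∫ n, fderiv ℝ (fderiv ℝ G) (t + α * s₀, (r + β * s₀) • n) (α, β • n) (α', β' • n)
        * sphHarmConj ℓ m n ∂sphereMeasure) s₀ := by
  have := hasDerivAt_integral_ray (hG.fderiv_of_isOpen (isOpen_nearCylinder ρ₀)
    (show (1 : WithTop ℕ∞) + 1 ≤ 2 by norm_num)) (continuousOn_evalWeight ℓ m α' β') h
  simpa only [evalWeight_apply] using this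

lemma integrable_fderiv_ray {ρ₀ : ℝ} {G : Spacetime → ℂ}
    (hG : ContDiffOn ℝ 2 G (nearCylinder ρ₀)) (ℓ : ℕ) (m : ℤ) (α β : ℝ) {t r : ℝ}
    (h : (t, r) ∈ coneRegion ρ₀) :
    Integrable (fun n => fderiv ℝ G (t, r • n) (α, β • n) * sphHarmConj ℓ m n) sphereMeasure := by
  refine integrable_sphere (ContinuousOn.mul (ContinuousOn.clm_apply ?_ (Continuous.continuousOn
    (by fun_prop))) (continuousOn_sphHarmConj ℓ m))
  exact (hG.continuousOn_fderiv_of_isOpen (isOpen_nearCylinder ρ₀) (by norm_num)).comp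
    (Continuous.continuousOn (by fun_prop)) fun n hn => mem_nearCylinder h hn

lemma integrable_fderiv_fderiv_ray {ρ₀ : ℝ} {G : Spacetime → ℂ}
    (hG : ContDiffOn ℝ 2 G (nearCylinder ρ₀)) (ℓ : ℕ) (m : ℤ) (α β α' β' : ℝ) {t r : ℝ}
    (h : (t, r) ∈ coneRegion ρ₀) :
    Integrable (fun n => fderiv ℝ (fderiv ℝ G) (t, r • n) (α, β • n) (α', β' • n)
      * sphHarmConj ℓ m n) sphereMeasure := by
  refine integrable_sphere (ContinuousOn.mul (ContinuousOn.clm_apply (ContinuousOn.clm_apply ?_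
    (Continuous.continuousOn (by fun_prop))) (Continuous.continuousOn (by fun_prop)))
    (continuousOn_sphHarmConj ℓ m))
  exact ((hG.fderiv_of_isOpen (isOpen_nearCylinder ρ₀)
    (show (1 : WithTop ℕ∞) + 1 ≤ 2 by norm_num)).continuousOn_fderiv_of_isOpen
    (isOpen_nearCylinder ρ₀) le_rfl).comp
    (Continuous.continuousOn (by fun_prop)) fun n hn => mem_nearCylinder h hn

lemma fderiv_slice {G : Spacetime → ℂ} {t : ℝ} {y : Space} (hG : ContDiffAt ℝ 2 G (t, y)) :
    fderiv ℝ (fun y => G (t, y)) y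
      = (fderiv ℝ G (t, y)) ∘L (ContinuousLinearMap.inr ℝ ℝ Space) := by
  have h1 : HasFDerivAt (fun y : Space => ((t, y) : Spacetime))
      (ContinuousLinearMap.inr ℝ ℝ Space) y := hasFDerivAt_prodMk_right t y
  exact ((hG.differentiableAt two_ne_zero).hasFDerivAt.comp y h1).fderiv

lemma fderiv_fderiv_slice {G : Spacetime → ℂ} {t : ℝ} {y : Space} (hG : ContDiffAt ℝ 2 G (t, y))
    (w w' : Space) :
    fderiv ℝ (fderiv ℝ (fun y => G (t, y))) y w w'
      = fderiv ℝ (fderiv ℝ G) (t, y) (0, w) (0, w') := by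
  have h1 : HasFDerivAt (fun y : Space => ((t, y) : Spacetime))
      (ContinuousLinearMap.inr ℝ ℝ Space) y := hasFDerivAt_prodMk_right t y
  have hev : ∀ᶠ z in 𝓝 y, ContDiffAt ℝ 2 G (t, z) :=
    (Continuous.continuousAt (by fun_prop : Continuous fun z : Space => (t, z))).eventually
      (hG.eventually (by simp))
  have h2 : fderiv ℝ (fun y => G (t, y)) =ᶠ[𝓝 y]
      fun z => (fderiv ℝ G (t, z)) ∘L (ContinuousLinearMap.inr ℝ ℝ Space) :=
    hev.mono fun z hz => fderiv_slice hz
  have h3 : DifferentiableAt ℝ (fderiv ℝ G) (t, y) :=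
    (hG.fderiv_right (m := 1) (by norm_num)).differentiableAt one_ne_zero
  have h4 := ((h3.hasFDerivAt.comp y h1).clm_comp
    (hasFDerivAt_const (ContinuousLinearMap.inr ℝ ℝ Space) y)).fderiv
  rw [h2.fderiv_eq]
  simp only [Function.comp_def] at h4
  rw [h4]
  simp

lemma iteratedDeriv_two_time {G : Spacetime → ℂ} {t : ℝ} {y : Space}
    (hG : ContDiffAt ℝ 2 G (t, y)) :
    iteratedDeriv 2 (fun s => G (s, y)) t = fderiv ℝ (fderiv ℝ G) (t, y) (1, 0) (1, 0) := by
  have hline : ∀ s : ℝ, HasDerivAt (fun s : ℝ => ((s, y) : Spacetime)) (1, 0) s := fun s =>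
    (hasDerivAt_id s).prodMk (hasDerivAt_const s y)
  have hev : ∀ᶠ s in 𝓝 t, ContDiffAt ℝ 2 G (s, y) :=
    (Continuous.continuousAt (by fun_prop : Continuous fun s : ℝ => (s, y))).eventually
      (hG.eventually (by simp))
  have h2 : deriv (fun s => G (s, y)) =ᶠ[𝓝 t] fun s => fderiv ℝ G (s, y) (1, 0) :=
    hev.mono fun s hs => HasDerivAt.deriv
      ((hs.differentiableAt two_ne_zero).hasFDerivAt.comp_hasDerivAt s (hline s))
  have h3 : DifferentiableAt ℝ (fderiv ℝ G) (t, y) :=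
    (hG.fderiv_right (m := 1) (by norm_num)).differentiableAt one_ne_zero
  have h4 : HasDerivAt (fun s => fderiv ℝ G (s, y)) (fderiv ℝ (fderiv ℝ G) (t, y) (1, 0)) t :=
    h3.hasFDerivAt.comp_hasDerivAt t (hline t)
  have h5 : HasDerivAt (fun s => fderiv ℝ G (s, y) (1, 0))
      (fderiv ℝ (fderiv ℝ G) (t, y) (1, 0) (1, 0)) t :=
    (ContinuousLinearMap.apply ℝ ℂ ((1, 0) : Spacetime)).hasFDerivAt.comp_hasDerivAt t h4
  rw [iteratedDeriv_succ, iteratedDeriv_one, h2.deriv_eq, h5.deriv]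

lemma rotDeriv_comp_smul (i : Fin 3) (g : Space → ℂ) (r : ℝ) :
    rotDeriv i (fun x => g (r • x)) = fun x => rotDeriv i g (r • x) := by
  ext1 x
  simp [rotDeriv, fderiv_comp_smul]

lemma sphereLaplacian_comp_smul (g : Space → ℂ) (r : ℝ) (x : Space) :
    sphereLaplacian (fun x => g (r • x)) x = sphereLaplacian g (r • x) := by
  simp only [sphereLaplacian, rotDeriv_comp_smul]

/-- The Laplacian of the sphere of radius `r` through the wave operator. -/
lemma sphereLaplacian_slice {G : Spacetime → ℂ} {t r : ℝ} (hr : 0 < r) {n : Space}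
    (hn : n ∈ unitSphere) (hG : ContDiffAt ℝ 2 G (t, r • n)) :
    sphereLaplacian (fun x => G (t, r • x)) n
      = r ^ 2 * (waveOp G (t, r • n) + fderiv ℝ (fderiv ℝ G) (t, r • n) (1, 0) (1, 0)
        - fderiv ℝ (fderiv ℝ G) (t, r • n) (0, n) (0, n))
        - 2 * r * fderiv ℝ G (t, r • n) (0, n) := by
  have hs : ContDiffAt ℝ 2 (fun y => G (t, y)) (r • n) :=
    hG.comp (r • n) (contDiffAt_const.prodMk contDiffAt_id)
  have h0 : ∀ w : Space, ((0, r • w) : Spacetime) = r • ((0, w) : Spacetime) := fun w => by simp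
  rw [sphereLaplacian_comp_smul (fun y => G (t, y)), sphereLaplacian_eq hs, norm_smul_unit hr hn,
    fderiv_fderiv_slice hG, fderiv_slice hG]
  simp only [ContinuousLinearMap.comp_apply, ContinuousLinearMap.inr_apply, h0, map_smul,
    _root_.smul_apply, Complex.real_smul, waveOp]
  rw [iteratedDeriv_two_time hG]
  push_cast
  ring

lemma integral_sphereLaplacian_slice {ρ₀ : ℝ} {G : Spacetime → ℂ}
    (hG : ContDiffOn ℝ 2 G (nearCylinder ρ₀)) (ℓ : ℕ) (m : ℤ) {t r : ℝ}
    (h : (t, r) ∈ coneRegion ρ₀) :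
    ∫ n, sphereLaplacian (fun x => G (t, r • x)) n * sphHarmConj ℓ m n ∂sphereMeasure
      = -(ℓ * (ℓ + 1)) * sphProj ℓ m G t r := by
  have hc : Continuous (fun x : Space => ((t, r • x) : Spacetime)) := by fun_prop
  have hU : IsOpen ((fun x : Space => ((t, r • x) : Spacetime)) ⁻¹' nearCylinder ρ₀) :=
    (isOpen_nearCylinder ρ₀).preimage hc
  have hF : ContDiffOn ℝ 2 (fun x : Space => G (t, r • x))
      ((fun x : Space => ((t, r • x) : Spacetime)) ⁻¹' nearCylinder ρ₀) :=
    hG.comp (contDiff_const.prodMk (contDiff_id.const_smul r)).contDiffOn fun x hx => hx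
  rw [integral_sphereLaplacian_mul hU (fun n hn => mem_nearCylinder h hn) hF
    ((contDiff_sphHarmConj ℓ m).of_le le_top).contDiffOn, sphProj, ← integral_const_mul]
  refine integral_sphere_congr fun n hn => ?_
  rw [sphereLaplacian_sphHarmConj ℓ m hn]
  ring

/-- The projections of a solution of the wave equation solve the radial wave equation. -/
lemma sphProj_wave {ρ₀ : ℝ} {G : Spacetime → ℂ} (hG : ContDiffOn ℝ 2 G (nearCylinder ρ₀))
    (hw : ∀ q ∈ nearCylinder ρ₀, waveOp G q = 0) (ℓ : ℕ) (m : ℤ) :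
    ∃ ft fr ftt frr : ℝ → ℝ → ℂ, ∀ t r, (t, r) ∈ coneRegion ρ₀ →
      HasDerivAt (fun s => sphProj ℓ m G s r) (ft t r) t ∧
      HasDerivAt (fun s => ft s r) (ftt t r) t ∧
      HasDerivAt (fun s => sphProj ℓ m G t s) (fr t r) r ∧
      HasDerivAt (fun s => fr t s) (frr t r) r ∧
      r ^ 2 * (ftt t r - frr t r) - 2 * r * fr t r = -(ℓ * (ℓ + 1)) * sphProj ℓ m G t r := by
  -- The factors `(0 : ℝ) • n` and `(1 : ℝ) • n` keep these integrals in the form `(α, β • n)` of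
  -- the general ray lemmas.
  refine ⟨fun t r => ∫ n, fderiv ℝ G (t, r • n) (1, (0 : ℝ) • n) * sphHarmConj ℓ m n ∂sphereMeasure,
    fun t r => ∫ n, fderiv ℝ G (t, r • n) (0, (1 : ℝ) • n) * sphHarmConj ℓ m n ∂sphereMeasure,
    fun t r => ∫ n, fderiv ℝ (fderiv ℝ G) (t, r • n) (1, (0 : ℝ) • n) (1, (0 : ℝ) • n)
      * sphHarmConj ℓ m n ∂sphereMeasure,
    fun t r => ∫ n, fderiv ℝ (fderiv ℝ G) (t, r • n) (0, (1 : ℝ) • n) (0, (1 : ℝ) • n)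
      * sphHarmConj ℓ m n ∂sphereMeasure, fun t r h => ⟨?_, ?_, ?_, ?_, ?_⟩⟩
  · simpa using hasDerivAt_sphProj hG ℓ m (t := 0) (r := r) (α := 1) (β := 0) (s₀ := t)
      (by simpa using h)
  · simpa using hasDerivAt_integral_fderiv hG ℓ m 1 0 (t := 0) (r := r) (α := 1) (β := 0) (s₀ := t)
      (by simpa using h)
  · simpa using hasDerivAt_sphProj hG ℓ m (t := t) (r := 0) (α := 0) (β := 1) (s₀ := r)
      (by simpa using h)
  · simpa using hasDerivAt_integral_fderiv hG ℓ m 0 1 (t := t) (r := 0) (α := 0) (β := 1) (s₀ := r)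
      (by simpa using h)
  · have i1 := integrable_fderiv_fderiv_ray hG ℓ m 1 0 1 0 h
    have i2 := integrable_fderiv_fderiv_ray hG ℓ m 0 1 0 1 h
    have i3 := integrable_fderiv_ray hG ℓ m 0 1 h
    rw [← integral_sphereLaplacian_slice hG ℓ m h, ← integral_sub i1 i2, ← integral_const_mul,
      ← integral_const_mul]
    refine (integral_sub ((i1.sub i2).const_mul _) (i3.const_mul _)).symm.trans ?_
    refine integral_sphere_congr fun n hn => ?_
    have hmem := mem_nearCylinder h hn
    rw [sphereLaplacian_slice (coneRegion_pos h) hn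
      (hG.contDiffAt ((isOpen_nearCylinder ρ₀).mem_nhds hmem)), hw _ hmem]
    simp
    ring

/-- The projected ugly equation: the derivative of the good field along outgoing null rays is an
angular derivative of the ugly field. -/
lemma hasDerivAt_sphProj_good {ρ₀ : ℝ} {Φ φ : Spacetime → ℂ} (hφ : IsUglyBuiltFrom ρ₀ Φ φ)
    (ℓ : ℕ) (m : ℤ) {t r s₀ : ℝ} (h : (t + s₀, r + s₀) ∈ coneRegion ρ₀) :
    HasDerivAt (fun s : ℝ => ((r + s : ℝ) : ℂ) * sphProj ℓ m Φ (t + s) (r + s))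
      (-(ℓ * (ℓ + 1)) * sphProj ℓ m φ (t + s₀) (r + s₀)) s₀ := by
  have hG := hφ.contDiffOn_ugly
  have h' : (t + 1 * s₀, r + 1 * s₀) ∈ coneRegion ρ₀ := by simpa using h
  have hd := hasDerivAt_integral_fderiv hG ℓ m 1 (-1) h'
  simp only [one_mul] at hd
  have hr : HasDerivAt (fun s : ℝ => (((r + s) ^ 2 : ℝ) : ℂ)) ((2 * (r + s₀) : ℝ) : ℂ) s₀ := by
    have : HasDerivAt (fun s : ℝ => (r + s) ^ 2) (2 * (r + s₀)) s₀ := by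
      simpa using (((hasDerivAt_id s₀).const_add r).fun_pow 2)
    exact this.ofReal_comp
  -- Use `rΦ = r² (∂_t - ∂_r) φ`, so that one differentiation of `φ` is already explicit.
  have hev : (fun s : ℝ => ((r + s : ℝ) : ℂ) * sphProj ℓ m Φ (t + s) (r + s)) =ᶠ[𝓝 s₀]
      fun s => (((r + s) ^ 2 : ℝ) : ℂ) * ∫ n, fderiv ℝ φ (t + s, (r + s) • n) (1, (-1 : ℝ) • n)
        * sphHarmConj ℓ m n ∂sphereMeasure := by
    have hpre : IsOpen ((fun s : ℝ => (t + s, r + s)) ⁻¹' coneRegion ρ₀) :=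
      (isOpen_coneRegion ρ₀).preimage (by fun_prop)
    filter_upwards [hpre.mem_nhds h] with s hs
    rw [sphProj, ← integral_const_mul, ← integral_const_mul]
    refine integral_sphere_congr fun n hn => ?_
    have hpos := coneRegion_pos hs
    rw [hφ.auxiliary _ (mem_nearCylinder hs hn)]
    simp only [incomingDeriv, timeDeriv, radialDeriv, norm_smul_unit hpos hn,
      direction_smul hpos (show ‖n‖ = 1 by simpa using hn)]
    rw [← map_sub]
    simp only [Prod.mk_sub_mk, sub_zero, zero_sub, neg_smul, one_smul]
    push_cast
    ring
  refine ((hr.mul hd).congr_of_eventuallyEq hev).congr_deriv ?_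
  have i1 := integrable_fderiv_ray hG ℓ m 1 (-1) h
  have i2 := integrable_fderiv_fderiv_ray hG ℓ m 1 1 1 (-1) h
  rw [← integral_sphereLaplacian_slice hG ℓ m h, ← integral_const_mul,
    ← integral_const_mul, ← integral_add (i1.const_mul _) (i2.const_mul _)]
  refine integral_sphere_congr fun n hn => ?_
  have hmem := mem_nearCylinder h hn
  have hat := hG.contDiffAt ((isOpen_nearCylinder ρ₀).mem_nhds hmem)
  have hpos := coneRegion_pos h
  -- The mixed derivatives cancel in `(∂_t + ∂_r)(∂_t - ∂_r) φ`. The `2r (∂_t - ∂_r) φ` from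
  -- differentiating `r²` combines with the ugly equation and leaves exactly `Δ_S φ`.
  have hsym := hat.isSymmSndFDerivAt (by simp) (1, 0) (0, n)
  rw [sphereLaplacian_slice hpos hn hat, hφ.ugly _ hmem]
  have e1 : ∀ β : ℝ, ((1, β • n) : Spacetime) = (1, 0) + β • (0, n) := fun β => by simp
  have hrC : ((r + s₀ : ℝ) : ℂ) ≠ 0 := by exact_mod_cast hpos.ne'
  simp only [e1, map_add, map_smul, _root_.add_apply, _root_.smul_apply, timeDeriv,
    norm_smul_unit hpos hn, hsym, Complex.real_smul]
  push_cast at hrC ⊢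
  field_simp
  ring

/-! ## Series -/

/-- The remainder of a series that is dominated by a geometric series. -/
lemma norm_sub_sum_range_le {f : ℕ → ℂ} {s : ℂ} (hs : HasSum f s) {M y : ℝ} (hM : 0 ≤ M)
    (hy : 0 ≤ y) (hy2 : y ≤ 1 / 2) (hf : ∀ q, ‖f q‖ ≤ M * y ^ q) (N : ℕ) :
    ‖s - ∑ q ∈ Finset.range N, f q‖ ≤ 2 * M * y ^ N := by
  have h1 := (hasSum_nat_add_iff' N).2 hs
  have h2 : HasSum (fun q => M * y ^ N * y ^ q) (M * y ^ N * (1 - y)⁻¹) :=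
    (hasSum_geometric_of_lt_one hy (by linarith)).mul_left _
  have h3 := h1.norm_le_of_bounded h2 fun q => by
    refine (hf _).trans_eq ?_
    rw [pow_add]
    ring
  have h4 : (1 - y)⁻¹ ≤ 2 := by
    rw [inv_le_comm₀ (by linarith) (by norm_num)]
    linarith
  calc _ ≤ M * y ^ N * (1 - y)⁻¹ := h3
    _ ≤ M * y ^ N * 2 := mul_le_mul_of_nonneg_left h4 (by positivity)
    _ = _ := by ring

/-- A power series that vanishes on an interval `(0, δ)` has vanishing coefficients. -/
lemma eq_zero_of_hasSum_pow {w : ℕ → ℂ} {δ : ℝ} (hδ : 0 < δ)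
    (h : ∀ x : ℝ, 0 < x → x < δ → HasSum (fun p => w p * (x : ℂ) ^ p) 0) (p : ℕ) : w p = 0 := by
  induction p using Nat.strong_induction_on with
  | _ p ih =>
  obtain ⟨x₀, hx₀⟩ : ∃ x, x = δ / 2 := ⟨_, rfl⟩
  have hx₀pos : 0 < x₀ := by rw [hx₀]; positivity
  have hsum := (h x₀ hx₀pos (by linarith)).summable.norm
  set B := ∑' q, ‖w q * (x₀ : ℂ) ^ q‖ with hB
  have hB0 : 0 ≤ B := tsum_nonneg fun q => norm_nonneg _
  have hbound : ∀ q, ‖w q‖ * x₀ ^ q ≤ B := fun q => by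
    have := hsum.le_tsum q fun j _ => norm_nonneg _
    rwa [norm_mul, norm_pow, Complex.norm_real, Real.norm_of_nonneg hx₀pos.le] at this
  -- The lower coefficients vanish by induction. After division by `x^p`, `w p` is minus the
  -- remaining series, which is `O(x)`.
  have key : ∀ x : ℝ, 0 < x → x ≤ x₀ / 2 → ‖w p‖ ≤ (2 * (B / x₀ ^ p) / x₀) * x := by
    intro x hx hx2
    have hs := (hasSum_nat_add_iff' p).2 (h x hx (by linarith))
    rw [Finset.sum_eq_zero fun q hq => by rw [ih q (Finset.mem_range.1 hq), zero_mul],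
      sub_zero] at hs
    have hxC : (x : ℂ) ^ p ≠ 0 := pow_ne_zero _ (by exact_mod_cast hx.ne')
    have hs2 : HasSum (fun q => w (q + p) * (x : ℂ) ^ q) 0 := by
      have := hs.mul_right ((x : ℂ) ^ p)⁻¹
      rw [zero_mul] at this
      refine this.congr_fun ?_
      intro q
      field_simp
      ring
    have hr := norm_sub_sum_range_le hs2 (M := B / x₀ ^ p) (y := x / x₀) (by positivity)
      (by positivity) (by rw [div_le_iff₀ hx₀pos]; linarith) (fun q => by
        rw [norm_mul, norm_pow, Complex.norm_real, Real.norm_of_nonneg hx.le, div_pow,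
          div_mul_div_comm, le_div_iff₀ (by positivity), ← pow_add]
        calc _ = ‖w (q + p)‖ * x₀ ^ (q + p) * x ^ q := by rw [add_comm p q]; ring
          _ ≤ _ := mul_le_mul_of_nonneg_right (hbound _) (by positivity)) 1
    simp only [Finset.range_one, Finset.sum_singleton, zero_add, pow_zero, mul_one, zero_sub,
      norm_neg, pow_one] at hr
    calc _ ≤ _ := hr
      _ = _ := by ring
  by_contra hne
  have hpos : 0 < ‖w p‖ := norm_pos_iff.2 hne
  set C := 2 * (B / x₀ ^ p) / x₀ with hC
  have hC0 : 0 ≤ C := by positivity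
  have h1 := key (min (x₀ / 2) (‖w p‖ / (2 * (C + 1)))) (by positivity) (min_le_left _ _)
  have h2 : C * min (x₀ / 2) (‖w p‖ / (2 * (C + 1))) ≤ C * (‖w p‖ / (2 * (C + 1))) :=
    mul_le_mul_of_nonneg_left (min_le_right _ _) hC0
  have h3 : C * (‖w p‖ / (2 * (C + 1))) < ‖w p‖ := by
    rw [mul_div_assoc', div_lt_iff₀ (by positivity)]
    nlinarith
  linarith

/-- Termwise differentiation, when the derivative of the sum is known. -/
lemma hasSum_deriv_of_hasSum {F F' : ℕ → ℝ → ℂ} {f f' : ℝ → ℂ} {u : ℕ → ℝ} {T : Set ℝ}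
    (hu : Summable u) (hT : IsOpen T) (hT' : IsPreconnected T)
    (hf : ∀ y ∈ T, HasSum (fun p => F p y) (f y))
    (hF : ∀ p, ∀ y ∈ T, HasDerivAt (F p) (F' p y) y) (hb : ∀ p, ∀ y ∈ T, ‖F' p y‖ ≤ u p)
    (hd : ∀ y ∈ T, HasDerivAt f (f' y) y) {y : ℝ} (hy : y ∈ T) :
    HasSum (fun p => F' p y) (f' y) := by
  have h1 := hasDerivAt_tsum_of_isPreconnected hu hT hT' hF hb hy (hf y hy).summable hy
  have h2 : (fun z => ∑' p, F p z) =ᶠ[𝓝 y] f := by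
    filter_upwards [hT.mem_nhds hy] with z hz using (hf z hz).tsum_eq
  have h3 := (h2.symm.hasDerivAt_iff.2 h1 : HasDerivAt f _ y).unique (hd y hy)
  rw [← h3]
  exact (Summable.of_norm_bounded hu fun p => hb p y hy).hasSum

/-! ## Bounds for the modes -/

/-- Normal convergence at `ρ₁ = ρ₀/2` is weakened to a geometric bound: the total sum of the
nonnegative majorants dominates each of them. -/
lemma modes_bound {ρ₀ : ℝ} (hρ₀ : 0 < ρ₀) {a : ℕ → ℕ → ℤ → ℝ → ℂ} (ha : ModesConverge ρ₀ a)
    {τ₁ : ℝ} (hτ₁ : τ₁ ∈ Ioo (0 : ℝ) 1) :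
    ∃ M : ℝ, 0 ≤ M ∧ ∀ (p ℓ : ℕ) (m : ℤ), ℓ ≤ p → |m| ≤ (ℓ : ℤ) → ∀ k ≤ 2, ∀ τ : ℝ, |τ| ≤ τ₁ →
      ‖iteratedDeriv k (a p ℓ m) τ‖ ≤ M * p.factorial * (2 / ρ₀) ^ p := by
  obtain ⟨M, hM, hb⟩ := ha.2 τ₁ hτ₁ (ρ₀ / 2) ⟨by positivity, by linarith⟩
  have hM0 : ∀ p, 0 ≤ M p := fun p =>
    le_trans (by positivity) (hb p 0 0 (Nat.zero_le p) (by simp) 0 (by norm_num) 0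
      (by simpa using hτ₁.1.le))
  refine ⟨∑' p, M p, tsum_nonneg hM0, fun p ℓ m hℓ hm k hk τ hτ => ?_⟩
  have h1 := (hb p ℓ m hℓ hm k hk τ hτ).trans (hM.le_tsum p fun j _ => hM0 j)
  have hp : (0 : ℝ) < p.factorial := by exact_mod_cast Nat.factorial_pos p
  have h2 : ((ρ₀ / 2) ^ p)⁻¹ = (2 / ρ₀) ^ p := by rw [← inv_pow, inv_div]
  rw [← h2, ← div_eq_mul_inv, le_div_iff₀ (by positivity)]
  rw [div_mul_eq_mul_div, div_le_iff₀ hp] at h1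
  linarith

/-- Here `48 = 6 · 8`: the harmonics are at most `8^p`, and the number of pairs `(ℓ, m)` is at most
`(p+1)(2p+1) ≤ 6^p`. -/
lemma norm_modeSum_le {a : ℕ → ℕ → ℤ → ℝ → ℂ} {p : ℕ} {τ A : ℝ} (hA : 0 ≤ A)
    (h : ∀ (ℓ : ℕ) (m : ℤ), ℓ ≤ p → |m| ≤ (ℓ : ℤ) → ‖a p ℓ m τ‖ ≤ A) {n : Space}
    (hn : n ∈ unitSphere) : ‖modeSum a p τ n‖ ≤ A * 48 ^ p := by
  have h1 : ∀ ℓ ∈ Finset.range (p + 1),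
      ‖∑ m ∈ Finset.Icc (-(ℓ : ℤ)) (ℓ : ℤ), a p ℓ m τ * sphHarm ℓ m n‖
        ≤ (2 * p + 1) * (A * 8 ^ p) := by
    intro ℓ hℓ
    have hℓp : ℓ ≤ p := Nat.lt_succ_iff.1 (Finset.mem_range.1 hℓ)
    refine (norm_sum_le_of_le (n := fun _ => A * 8 ^ p) _ (fun m hm => ?_)).trans ?_
    · have hm' : |m| ≤ (ℓ : ℤ) := abs_le.2 (Finset.mem_Icc.1 hm)
      rw [norm_mul]
      refine mul_le_mul (h ℓ m hℓp hm') ((norm_sphHarm_le hm' hn).trans ?_) (norm_nonneg _) hA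
      exact pow_le_pow_right₀ (by norm_num) hℓp
    · rw [Finset.sum_const, Int.card_Icc, nsmul_eq_mul]
      refine mul_le_mul_of_nonneg_right ?_ (by positivity)
      have : ((ℓ : ℤ) + 1 - -(ℓ : ℤ)).toNat = 2 * ℓ + 1 := by omega
      rw [this]
      push_cast
      have : (ℓ : ℝ) ≤ p := by exact_mod_cast hℓp
      linarith
  refine (norm_sum_le_of_le _ h1).trans ?_
  rw [Finset.sum_const, Finset.card_range, nsmul_eq_mul]
  have h2 : ((p + 1 : ℕ) : ℝ) * (2 * p + 1) ≤ 6 ^ p := by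
    clear h h1
    induction p with
    | zero => norm_num
    | succ p ih =>
      rw [pow_succ]
      push_cast at ih ⊢
      nlinarith [sq_nonneg (p : ℝ), (Nat.cast_nonneg p : (0 : ℝ) ≤ p)]
  calc _ = (((p + 1 : ℕ) : ℝ) * (2 * p + 1)) * (A * 8 ^ p) := by ring
    _ ≤ 6 ^ p * (A * 8 ^ p) := mul_le_mul_of_nonneg_right h2 (by positivity)
    _ = _ := by
      rw [show (48 : ℝ) = 6 * 8 by norm_num, mul_pow]
      ring

/-- The energy estimate for the equation of the modes, to the future of `τ = 0`. -/
lemma norm_sq_mode_le {p : ℕ} (hp : 1 ≤ p) {lam : ℝ} (hlam : |lam| ≤ 2 * (p : ℝ) ^ 2)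
    {f f' f'' : ℝ → ℂ} (h1 : ∀ τ ∈ Ioo (-1 : ℝ) 1, HasDerivAt f (f' τ) τ)
    (h2 : ∀ τ ∈ Ioo (-1 : ℝ) 1, HasDerivAt f' (f'' τ) τ)
    (hode : ∀ τ ∈ Ioo (-1 : ℝ) 1,
      ((1 - τ ^ 2 : ℝ) : ℂ) * f'' τ + ((2 * (p - 1) * τ : ℝ) : ℂ) * f' τ + (lam : ℂ) * f τ = 0)
    {τ : ℝ} (hτ : τ ∈ Ico (0 : ℝ) 1) :
    ‖f τ‖ ≤ Real.exp 9 ^ p * (‖f 0‖ + ‖f' 0‖) := by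
  have hp1 : (1 : ℝ) ≤ p := by exact_mod_cast hp
  -- The weight `1 - τ²` absorbs the degeneracy of the leading coefficient. For `τ ≥ 0` and `p ≥ 1`
  -- the first-order term contributes the damping `-2τ(2p-1) ‖f'‖²`.
  set E : ℝ → ℝ := fun τ => (1 - τ ^ 2) * ‖f' τ‖ ^ 2 + (p : ℝ) ^ 2 * ‖f τ‖ ^ 2 with hE
  set E' : ℝ → ℝ := fun τ => -2 * τ * (2 * p - 1) * ‖f' τ‖ ^ 2
    + 2 * ((p : ℝ) ^ 2 - lam) * inner ℝ (f' τ) (f τ) with hE'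
  have hEd : ∀ τ ∈ Ioo (-1 : ℝ) 1, HasDerivAt E (E' τ) τ := by
    intro τ hτ
    have hq : HasDerivAt (fun τ : ℝ => 1 - τ ^ 2) (-(2 * τ)) τ := by
      simpa using ((hasDerivAt_id τ).fun_pow 2).const_sub 1
    have hd := (hq.mul (h2 τ hτ).norm_sq).add ((h1 τ hτ).norm_sq.const_mul ((p : ℝ) ^ 2))
    refine hd.congr_deriv ?_
    have hin : (1 - τ ^ 2) * inner ℝ (f' τ) (f'' τ)
        = -(2 * (p - 1) * τ) * ‖f' τ‖ ^ 2 - lam * inner ℝ (f' τ) (f τ) := by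
      have h := hode τ hτ
      have h' : ((1 - τ ^ 2 : ℝ)) • f'' τ = -((2 * (p - 1) * τ : ℝ) • f' τ) - lam • f τ := by
        simp only [Complex.real_smul]
        linear_combination h
      have h'' := congrArg (fun z => inner ℝ (f' τ) z) h'
      simp only [inner_smul_right, inner_sub_right, inner_neg_right,
        real_inner_self_eq_norm_sq] at h''
      linarith
    simp only [hE']
    rw [real_inner_comm (f' τ) (f τ)]
    linear_combination 2 * hin
  have hEle : ∀ τ ∈ Ico (0 : ℝ) 1, E' τ ≤ 9 * p * E τ := by
    intro τ hτ
    have hin := abs_le.1 (abs_real_inner_le_norm (f' τ) (f τ))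
    set x := ‖f' τ‖
    set y := ‖f τ‖
    have hx : 0 ≤ x := norm_nonneg _
    have hy : 0 ≤ y := norm_nonneg _
    have hl := abs_le.1 hlam
    have hc : ((p : ℝ) ^ 2 - lam) * inner ℝ (f' τ) (f τ) ≤ 3 * (p : ℝ) ^ 2 * (x * y) := by
      have : |((p : ℝ) ^ 2 - lam) * inner ℝ (f' τ) (f τ)| ≤ 3 * (p : ℝ) ^ 2 * (x * y) := by
        rw [abs_mul]
        refine mul_le_mul ?_ (abs_real_inner_le_norm _ _) (abs_nonneg _) (by positivity)
        rw [abs_le]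
        constructor <;> nlinarith
      exact (le_abs_self _).trans this
    simp only [hE, hE']
    -- For `τ ≤ 1/2` the weight is at least `3/4`, so `E` controls `‖f'‖²`. For `τ ≥ 1/2` the weight
    -- may degenerate, but the damping is at least `p ‖f'‖²` and absorbs the cross term, at the cost
    -- of the constant `9`.
    rcases le_total τ (1 / 2) with h | h
    · have e1 : 0 ≤ τ * (2 * p - 1) * x ^ 2 :=
        mul_nonneg (mul_nonneg hτ.1 (by linarith)) (sq_nonneg x)
      have e2 : 3 / 4 * x ^ 2 ≤ (1 - τ ^ 2) * x ^ 2 :=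
        mul_le_mul_of_nonneg_right (by nlinarith [hτ.1]) (sq_nonneg x)
      have e3 : 2 * (p : ℝ) * (x * y) ≤ x ^ 2 + (p : ℝ) ^ 2 * y ^ 2 := by
        nlinarith [sq_nonneg (x - p * y)]
      have e4 : p * (3 / 4 * x ^ 2) ≤ p * ((1 - τ ^ 2) * x ^ 2) :=
        mul_le_mul_of_nonneg_left e2 (by linarith)
      have e5 : p * (2 * (p : ℝ) * (x * y)) ≤ p * (x ^ 2 + (p : ℝ) ^ 2 * y ^ 2) :=
        mul_le_mul_of_nonneg_left e3 (by linarith)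
      have e6 : 0 ≤ (p : ℝ) * x ^ 2 := by positivity
      have e7 : 0 ≤ (p : ℝ) * ((p : ℝ) ^ 2 * y ^ 2) := by positivity
      linarith
    · have e1 : (p : ℝ) * x ^ 2 ≤ 2 * τ * (2 * p - 1) * x ^ 2 := by
        refine mul_le_mul_of_nonneg_right ?_ (sq_nonneg x)
        nlinarith
      have e2 : 6 * (p : ℝ) * (x * y) ≤ x ^ 2 + 9 * (p : ℝ) ^ 2 * y ^ 2 := by
        nlinarith [sq_nonneg (x - 3 * p * y)]
      have e3 : p * (6 * (p : ℝ) * (x * y)) ≤ p * (x ^ 2 + 9 * (p : ℝ) ^ 2 * y ^ 2) :=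
        mul_le_mul_of_nonneg_left e2 (by linarith)
      have e4 : 0 ≤ p * ((1 - τ ^ 2) * x ^ 2) :=
        mul_nonneg (by linarith) (mul_nonneg (by nlinarith [hτ.1, hτ.2]) (sq_nonneg x))
      linarith
  have hsub : Ico (0 : ℝ) 1 ⊆ Ioo (-1) 1 := fun x hx => ⟨by linarith [hx.1], hx.2⟩
  -- Grönwall's inequality, by way of an integrating factor.
  have hanti : AntitoneOn (fun τ => E τ * Real.exp (-(9 * p * τ))) (Ico (0 : ℝ) 1) := by
    have hGd : ∀ τ ∈ Ioo (-1 : ℝ) 1, HasDerivAt (fun τ => E τ * Real.exp (-(9 * p * τ)))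
        (E' τ * Real.exp (-(9 * p * τ)) + E τ * (Real.exp (-(9 * p * τ)) * -(9 * p))) τ := by
      intro τ hτ
      have he : HasDerivAt (fun τ : ℝ => -(9 * p * τ)) (-(9 * p)) τ := by
        simpa using ((hasDerivAt_id τ).const_mul (9 * (p : ℝ))).fun_neg
      exact (hEd τ hτ).mul he.exp
    refine antitoneOn_of_deriv_nonpos (convex_Ico 0 1)
      (fun τ hτ => (hGd τ (hsub hτ)).continuousAt.continuousWithinAt) ?_ ?_
    · intro τ hτ
      rw [interior_Ico] at hτ
      exact (hGd τ (hsub (Ioo_subset_Ico_self hτ))).differentiableAt.differentiableWithinAt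
    · intro τ hτ
      rw [interior_Ico] at hτ
      rw [(hGd τ (hsub (Ioo_subset_Ico_self hτ))).deriv]
      nlinarith [hEle τ (Ioo_subset_Ico_self hτ), Real.exp_pos (-(9 * p * τ))]
  have h0 := hanti (left_mem_Ico.2 one_pos) hτ hτ.1
  have hE0 : E τ ≤ E 0 * Real.exp 9 ^ p := by
    simp only [mul_zero, neg_zero, Real.exp_zero, mul_one] at h0
    have h3 : E τ = E τ * Real.exp (-(9 * p * τ)) * Real.exp (9 * p * τ) := by
      rw [mul_assoc, ← Real.exp_add]
      simp
    have h4 : Real.exp (9 * p * τ) ≤ Real.exp 9 ^ p := by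
      rw [← Real.exp_nat_mul]
      exact Real.exp_le_exp.2 (by nlinarith [hτ.2])
    have h5 : 0 ≤ E 0 := by simp only [hE]; positivity
    rw [h3]
    exact mul_le_mul h0 h4 (Real.exp_pos _).le h5
  have hexp : 1 ≤ Real.exp 9 ^ p := one_le_pow₀ (Real.one_le_exp (by norm_num))
  refine abs_le_of_sq_le_sq' ?_ (by positivity) |>.2
  have h6 : (p : ℝ) ^ 2 * ‖f τ‖ ^ 2 ≤ E τ := by
    simp only [hE]
    have : 0 ≤ (1 - τ ^ 2) * ‖f' τ‖ ^ 2 :=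
      mul_nonneg (by nlinarith [hτ.1, hτ.2]) (sq_nonneg _)
    linarith
  have h7 : E 0 ≤ (p : ℝ) ^ 2 * (‖f 0‖ + ‖f' 0‖) ^ 2 := by
    simp only [hE]
    have : (1 : ℝ) ≤ (p : ℝ) ^ 2 := one_le_pow₀ hp1
    have e1 : ‖f' 0‖ ^ 2 ≤ (p : ℝ) ^ 2 * ‖f' 0‖ ^ 2 := le_mul_of_one_le_left (sq_nonneg _) this
    have e2 : 0 ≤ (p : ℝ) ^ 2 * (2 * ‖f 0‖ * ‖f' 0‖) := by positivity
    nlinarith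
  have h8 : (p : ℝ) ^ 2 * ‖f τ‖ ^ 2
      ≤ (p : ℝ) ^ 2 * ((‖f 0‖ + ‖f' 0‖) ^ 2 * Real.exp 9 ^ p) := by
    calc _ ≤ _ := h6.trans hE0
      _ ≤ (p : ℝ) ^ 2 * (‖f 0‖ + ‖f' 0‖) ^ 2 * Real.exp 9 ^ p :=
        mul_le_mul_of_nonneg_right h7 (by positivity)
      _ = _ := by ring
  have h9 := le_of_mul_le_mul_left h8 (by positivity)
  calc _ ≤ _ := h9
    _ ≤ (‖f 0‖ + ‖f' 0‖) ^ 2 * (Real.exp 9 ^ p) ^ 2 := by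
      refine mul_le_mul_of_nonneg_left ?_ (sq_nonneg _)
      nlinarith
    _ = _ := by ring

/-- The energy estimate for the equation of the modes. -/
lemma norm_mode_le {p : ℕ} (hp : 1 ≤ p) {lam : ℝ} (hlam : |lam| ≤ 2 * (p : ℝ) ^ 2)
    {f f' f'' : ℝ → ℂ} (h1 : ∀ τ ∈ Ioo (-1 : ℝ) 1, HasDerivAt f (f' τ) τ)
    (h2 : ∀ τ ∈ Ioo (-1 : ℝ) 1, HasDerivAt f' (f'' τ) τ)
    (hode : ∀ τ ∈ Ioo (-1 : ℝ) 1,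
      ((1 - τ ^ 2 : ℝ) : ℂ) * f'' τ + ((2 * (p - 1) * τ : ℝ) : ℂ) * f' τ + (lam : ℂ) * f τ = 0)
    {τ : ℝ} (hτ : τ ∈ Ioo (-1 : ℝ) 1) :
    ‖f τ‖ ≤ Real.exp 9 ^ p * (‖f 0‖ + ‖f' 0‖) := by
  rcases le_total 0 τ with h | h
  · exact norm_sq_mode_le hp hlam h1 h2 hode ⟨h, hτ.2⟩
  -- The equation is invariant under `τ ↦ -τ`.
  · have hneg : ∀ s ∈ Ioo (-1 : ℝ) 1, -s ∈ Ioo (-1 : ℝ) 1 := fun s hs =>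
      ⟨by linarith [hs.2], by linarith [hs.1]⟩
    have := norm_sq_mode_le hp hlam (f := fun s => f (-s)) (f' := fun s => -f' (-s))
      (f'' := fun s => f'' (-s))
      (fun s hs => by
        simpa [Function.comp_def] using (h1 (-s) (hneg s hs)).scomp s (hasDerivAt_neg s))
      (fun s hs => by
        simpa [Function.comp_def] using ((h2 (-s) (hneg s hs)).scomp s (hasDerivAt_neg s)).fun_neg)
      (fun s hs => by
        have := hode (-s) (hneg s hs)
        push_cast at this ⊢
        linear_combination this) (τ := -τ) ⟨by linarith, by linarith [hτ.1]⟩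
    simpa using this

/-! ## The equation of the modes -/

/-- The bound for the derivatives of order at most two of the terms of the expansion. -/
lemma norm_mode_terms_le {p : ℕ} {M X S τ s : ℝ} {b b' b'' : ℂ} (hM : 0 ≤ M) (hX : 0 ≤ X)
    (hS : 1 ≤ S) (hs : 0 ≤ s) (hsS : s ≤ S) (hτ : |τ| ≤ 1) (h0 : ‖b‖ ≤ M * X ^ p)
    (h1 : ‖b'‖ ≤ M * X ^ p) (h2 : ‖b''‖ ≤ M * X ^ p) :
    ‖(s : ℂ) ^ p * (b'' + 4 * p * τ * s * b' + (2 * p * s + 4 * p * (p + 1) * τ ^ 2 * s ^ 2) * b)‖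
      + (2 * p + 4) * ‖(s : ℂ) ^ p * (b' + 2 * p * τ * s * b)‖
      + (p + 1) * (p + 2) * ‖(s : ℂ) ^ p * b‖ ≤ 16 * M * S ^ 2 * (4 * X * S) ^ p := by
  set Q := M * X ^ p with hQ
  have hQ0 : 0 ≤ Q := by positivity
  have hS0 : 0 ≤ S := by linarith
  have hp0 : (0 : ℝ) ≤ p := Nat.cast_nonneg p
  have hns : ‖(s : ℂ)‖ ≤ S := by rwa [Complex.norm_real, Real.norm_of_nonneg hs]
  have hnτ : ‖(τ : ℂ)‖ ≤ 1 := by rwa [Complex.norm_real]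
  have hsp : ‖(s : ℂ) ^ p‖ ≤ S ^ p := by
    rw [norm_pow]
    exact pow_le_pow_left₀ (norm_nonneg _) hns p
  have hnp : ‖(p : ℂ)‖ = p := by simp
  have hnp1 : ‖(p : ℂ) + 1‖ = p + 1 := by
    rw [← Nat.cast_one, ← Nat.cast_add, Complex.norm_natCast]
    push_cast
    rfl
  have e0 : ‖(s : ℂ) ^ p * b‖ ≤ S ^ p * Q := by
    rw [norm_mul]
    exact mul_le_mul hsp h0 (norm_nonneg _) (by positivity)
  have e1 : ‖(s : ℂ) ^ p * (b' + 2 * p * τ * s * b)‖ ≤ S ^ p * (Q + 2 * p * 1 * S * Q) := by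
    rw [norm_mul]
    refine mul_le_mul hsp ((norm_add_le _ _).trans (add_le_add h1 ?_)) (norm_nonneg _)
      (by positivity)
    simp only [norm_mul, hnp, Complex.norm_ofNat]
    gcongr
  have e2 : ‖(s : ℂ) ^ p * (b'' + 4 * p * τ * s * b'
      + (2 * p * s + 4 * p * (p + 1) * τ ^ 2 * s ^ 2) * b)‖
      ≤ S ^ p * (Q + 4 * p * 1 * S * Q + (2 * p * S + 4 * p * (p + 1) * 1 ^ 2 * S ^ 2) * Q) := by
    rw [norm_mul]
    refine mul_le_mul hsp ((norm_add_le _ _).trans (add_le_add ((norm_add_le _ _).trans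
      (add_le_add h2 ?_)) ?_)) (norm_nonneg _) (by positivity)
    · simp only [norm_mul, hnp, Complex.norm_ofNat]
      gcongr
    · rw [norm_mul]
      refine mul_le_mul ((norm_add_le _ _).trans (add_le_add ?_ ?_)) h0 (norm_nonneg _)
        (by positivity)
      · simp only [norm_mul, hnp, Complex.norm_ofNat]
        gcongr
      · simp only [norm_mul, norm_pow, hnp, hnp1, Complex.norm_ofNat]
        gcongr
  -- The quadratic factors in `p` produced by two differentiations are absorbed by the `4^p` in the
  -- conclusion.
  have hpow : ((p : ℝ) + 1) ^ 2 ≤ 4 ^ p := by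
    have h : (p : ℝ) + 1 ≤ 2 ^ p := by exact_mod_cast Nat.lt_two_pow_self
    calc ((p : ℝ) + 1) ^ 2 ≤ (2 ^ p) ^ 2 := pow_le_pow_left₀ (by positivity) h 2
      _ = 4 ^ p := by rw [← pow_mul, mul_comm, pow_mul]; norm_num
  have hSQ : 0 ≤ S ^ p * Q := by positivity
  have hS2 : S ≤ S ^ 2 := by nlinarith
  calc _ ≤ S ^ p * (Q + 4 * p * 1 * S * Q + (2 * p * S + 4 * p * (p + 1) * 1 ^ 2 * S ^ 2) * Q)
        + (2 * p + 4) * (S ^ p * (Q + 2 * p * 1 * S * Q)) + (p + 1) * (p + 2) * (S ^ p * Q) := by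
        gcongr
    _ = (S ^ p * Q) * ((1 + 6 * p * S + 4 * p * (p + 1) * S ^ 2)
        + (2 * p + 4) * (1 + 2 * p * S) + (p + 1) * (p + 2)) := by ring
    _ ≤ (S ^ p * Q) * (16 * S ^ 2 * 4 ^ p) := by
        refine mul_le_mul_of_nonneg_left ?_ hSQ
        have h1S : 1 ≤ S ^ 2 := one_le_pow₀ hS
        calc _ ≤ (S ^ 2 + 6 * p * S ^ 2 + 4 * p * (p + 1) * S ^ 2)
              + (2 * p + 4) * (S ^ 2 + 2 * p * S ^ 2) + (p + 1) * (p + 2) * S ^ 2 := by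
              have t1 : 6 * (p : ℝ) * S ≤ 6 * p * S ^ 2 := by gcongr
              have t2 : (2 * (p : ℝ) + 4) * (1 + 2 * p * S)
                  ≤ (2 * p + 4) * (S ^ 2 + 2 * p * S ^ 2) := by gcongr
              have t3 : ((p : ℝ) + 1) * (p + 2) ≤ (p + 1) * (p + 2) * S ^ 2 :=
                le_mul_of_one_le_right (by positivity) h1S
              linarith
          _ = S ^ 2 * (9 * p ^ 2 + 23 * p + 7) := by ring
          _ ≤ S ^ 2 * (16 * 4 ^ p) := by
              refine mul_le_mul_of_nonneg_left ?_ (by positivity)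
              nlinarith
          _ = _ := by ring
    _ = _ := by
        rw [hQ, mul_pow, mul_pow]
        ring

/-- The coefficients of a normally convergent expansion in powers of `ρ` at constant `τ` of a
solution of the radial wave equation solve an ordinary differential equation. -/
lemma mode_ode {δ X Λ : ℝ} (hδ : 0 < δ) (hX : 0 ≤ X) {b b' b'' : ℕ → ℝ → ℂ}
    {F ft fr ftt frr : ℝ → ℝ → ℂ}
    (hb : ∀ p, ∀ τ ∈ Ioo (-1 : ℝ) 1, HasDerivAt (b p) (b' p τ) τ)
    (hb' : ∀ p, ∀ τ ∈ Ioo (-1 : ℝ) 1, HasDerivAt (b' p) (b'' p τ) τ)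
    (hbd : ∀ τ₁ ∈ Ioo (0 : ℝ) 1, ∃ M : ℝ, 0 ≤ M ∧ ∀ p τ, |τ| ≤ τ₁ →
      ‖b p τ‖ ≤ M * X ^ p ∧ ‖b' p τ‖ ≤ M * X ^ p ∧ ‖b'' p τ‖ ≤ M * X ^ p)
    (hsum : ∀ t r : ℝ, |t| < r → r / (r ^ 2 - t ^ 2) < δ →
      HasSum (fun p => b p (t / r) * ((r / (r ^ 2 - t ^ 2) : ℝ) : ℂ) ^ p) (r * F t r))
    (hw : ∀ t r : ℝ, |t| < r → r / (r ^ 2 - t ^ 2) < δ →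
      HasDerivAt (fun s => F s r) (ft t r) t ∧ HasDerivAt (fun s => ft s r) (ftt t r) t ∧
      HasDerivAt (fun s => F t s) (fr t r) r ∧ HasDerivAt (fun s => fr t s) (frr t r) r ∧
      r ^ 2 * (ftt t r - frr t r) - 2 * r * fr t r = -Λ * F t r)
    (p : ℕ) {τ : ℝ} (hτ : τ ∈ Ioo (-1 : ℝ) 1) :
    ((1 - τ ^ 2 : ℝ) : ℂ) * b'' p τ + ((2 * (p - 1) * τ : ℝ) : ℂ) * b' p τ
      + ((Λ - p * (p - 1) : ℝ) : ℂ) * b p τ = 0 := by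
  obtain ⟨τ₁, hτ₁⟩ : ∃ x, x = (1 + |τ|) / 2 := ⟨_, rfl⟩
  have hτabs : |τ| < 1 := abs_lt.2 hτ
  have hτ₁' : τ₁ ∈ Ioo (0 : ℝ) 1 := by
    constructor <;> rw [hτ₁] <;> linarith [abs_nonneg τ]
  obtain ⟨M, hM, hbd⟩ := hbd τ₁ hτ₁'
  obtain ⟨S, hSdef⟩ : ∃ x, x = (1 - τ₁ ^ 2)⁻¹ := ⟨_, rfl⟩
  have h1τ₁ : 0 < 1 - τ₁ ^ 2 := by nlinarith [hτ₁'.1, hτ₁'.2]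
  have hS : 1 ≤ S := by
    rw [hSdef]
    exact (one_le_inv₀ h1τ₁).2 (by nlinarith [sq_nonneg τ₁])
  -- For `r > R`: powers of `1/r` are at most `1`, the differentiated series have ratio at most
  -- `1/2`, and `ρ ≤ S/r < δ`.
  obtain ⟨R, hRdef⟩ : ∃ x, x = max 1 (max (8 * X * S) (2 * S / δ)) := ⟨_, rfl⟩
  have hR1 : 1 ≤ R := hRdef ▸ le_max_left _ _
  have hR2 : 8 * X * S ≤ R := hRdef ▸ (le_max_left _ _).trans (le_max_right _ _)
  have hR3 : 2 * S / δ ≤ R := hRdef ▸ (le_max_right _ _).trans (le_max_right _ _)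
  have hs : ∀ σ : ℝ, |σ| ≤ τ₁ → 0 < 1 - σ ^ 2 ∧ (1 - σ ^ 2)⁻¹ ≤ S := fun σ hσ => by
    have : σ ^ 2 ≤ τ₁ ^ 2 := by
      rw [← sq_abs σ]
      exact pow_le_pow_left₀ (abs_nonneg _) hσ 2
    refine ⟨by linarith, ?_⟩
    rw [hSdef]
    exact inv_anti₀ h1τ₁ (by linarith)
  have hIoo : ∀ σ : ℝ, |σ| ≤ τ₁ → σ ∈ Ioo (-1 : ℝ) 1 := fun σ hσ =>
    abs_lt.1 (hσ.trans_lt hτ₁'.2)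
  -- the coefficients of the expansion in powers of `1 / r`
  set s : ℝ → ℝ := fun σ => (1 - σ ^ 2)⁻¹ with hsdef
  set c : ℕ → ℝ → ℂ := fun p σ => (s σ : ℂ) ^ p * b p σ with hc
  set c' : ℕ → ℝ → ℂ := fun p σ => (s σ : ℂ) ^ p * (b' p σ + 2 * p * σ * s σ * b p σ) with hc'
  set c'' : ℕ → ℝ → ℂ := fun p σ => (s σ : ℂ) ^ p * (b'' p σ + 4 * p * σ * s σ * b' p σ
    + (2 * p * s σ + 4 * p * (p + 1) * σ ^ 2 * s σ ^ 2) * b p σ) with hc''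
  have hsd : ∀ σ ∈ Ioo (-1 : ℝ) 1, HasDerivAt (fun σ => (s σ : ℂ)) (2 * σ * s σ ^ 2 : ℂ) σ := by
    intro σ hσ
    have hne : 1 - σ ^ 2 ≠ 0 := by nlinarith [hσ.1, hσ.2]
    have h1 : HasDerivAt (fun σ : ℝ => 1 - σ ^ 2) (-(2 * σ)) σ := by
      simpa using ((hasDerivAt_id σ).fun_pow 2).const_sub 1
    have h2 := (h1.inv hne).ofReal_comp
    refine h2.congr_deriv ?_
    simp only [hsdef]
    push_cast
    field_simp
  have hspd : ∀ (p : ℕ), ∀ σ ∈ Ioo (-1 : ℝ) 1, HasDerivAt (fun σ => (s σ : ℂ) ^ p)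
      (2 * p * σ * s σ ^ (p + 1) : ℂ) σ := by
    intro p σ hσ
    refine ((hsd σ hσ).fun_pow p).congr_deriv ?_
    rcases p with _ | p
    · simp
    · simp only [Nat.add_sub_cancel]
      push_cast
      ring
  have hcd : ∀ p, ∀ σ ∈ Ioo (-1 : ℝ) 1, HasDerivAt (c p) (c' p σ) σ := by
    intro p σ hσ
    refine ((hspd p σ hσ).mul (hb p σ hσ)).congr_deriv ?_
    simp only [hc']
    ring
  have hcd' : ∀ p, ∀ σ ∈ Ioo (-1 : ℝ) 1, HasDerivAt (c' p) (c'' p σ) σ := by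
    intro p σ hσ
    have h1 : HasDerivAt (fun σ : ℝ => (σ : ℂ)) 1 σ := (hasDerivAt_id σ).ofReal_comp
    have h2 := (hspd p σ hσ).mul ((hb' p σ hσ).add
      ((((h1.const_mul (2 * (p : ℂ))).mul (hsd σ hσ)).mul (hb p σ hσ))))
    refine h2.congr_deriv ?_
    simp only [hc'']
    simp only [Pi.add_apply, Pi.mul_apply]
    ring
  -- The weights are the coefficients in the second `r`-derivative of `c p (t/r) r^{-(p+1)}`, so
  -- this one bound majorizes all four differentiated series.
  have hcb : ∀ p σ, |σ| ≤ τ₁ → ‖c'' p σ‖ + (2 * p + 4) * ‖c' p σ‖ + (p + 1) * (p + 2) * ‖c p σ‖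
      ≤ 16 * M * S ^ 2 * (4 * X * S) ^ p := fun p σ hσ =>
    norm_mode_terms_le hM hX hS (inv_nonneg.2 (hs σ hσ).1.le) (hs σ hσ).2 (hσ.trans hτ₁'.2.le)
      (hbd p σ hσ).1 (hbd p σ hσ).2.1 (hbd p σ hσ).2.2
  set u : ℕ → ℝ := fun p => 16 * M * S ^ 2 * (1 / 2) ^ p with hu
  have hus : Summable u := summable_geometric_two.mul_left _
  have hxb : ∀ p k (r : ℝ), R < r → 16 * M * S ^ 2 * (4 * X * S) ^ p * (r⁻¹) ^ (p + k) ≤ u p := by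
    intro p k r hr
    have hr0 : 0 < r := by linarith
    have h1 : r⁻¹ ≤ 1 := inv_le_one_of_one_le₀ (by linarith)
    have h2 : 4 * X * S * r⁻¹ ≤ 1 / 2 := by
      rw [← div_eq_mul_inv, div_le_iff₀ hr0]
      linarith
    have h3 : (4 * X * S * r⁻¹) ^ p ≤ (1 / 2) ^ p :=
      pow_le_pow_left₀ (by positivity) h2 p
    calc _ = 16 * M * S ^ 2 * ((4 * X * S * r⁻¹) ^ p * (r⁻¹) ^ k) := by
          rw [mul_pow _ r⁻¹, pow_add]
          ring
      _ ≤ 16 * M * S ^ 2 * ((1 / 2) ^ p * 1) := by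
          gcongr
          exact pow_le_one₀ (by positivity) h1
      _ = _ := by rw [mul_one]
  -- the domain
  have hdom : ∀ t r : ℝ, R < r → |t| < τ₁ * r → |t * r⁻¹| ≤ τ₁ ∧ |t| < r ∧
      r / (r ^ 2 - t ^ 2) = r⁻¹ * s (t * r⁻¹) ∧ r / (r ^ 2 - t ^ 2) < δ := by
    intro t r hr ht
    have hr0 : 0 < r := by linarith
    have h1 : |t * r⁻¹| ≤ τ₁ := by
      rw [abs_mul, abs_inv, abs_of_pos hr0, ← div_eq_mul_inv, div_le_iff₀ hr0]
      exact ht.le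
    have h2 : |t| < r := ht.trans (by nlinarith [hτ₁'.2])
    have h3 : r / (r ^ 2 - t ^ 2) = r⁻¹ * s (t * r⁻¹) := by
      have h4 := (hs _ h1).1
      have h5 : r ^ 2 - t ^ 2 = r ^ 2 * (1 - (t * r⁻¹) ^ 2) := by
        field_simp
      simp only [hsdef]
      rw [h5]
      field_simp
    refine ⟨h1, h2, h3, ?_⟩
    rw [h3]
    have h6 : r⁻¹ * s (t * r⁻¹) ≤ r⁻¹ * S :=
      mul_le_mul_of_nonneg_left (hs _ h1).2 (by positivity)
    have h7 : r⁻¹ * S < δ := by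
      rw [inv_mul_eq_div, div_lt_iff₀ hr0]
      rw [div_le_iff₀ hδ] at hR3
      nlinarith
    linarith
  have hF : ∀ t r : ℝ, R < r → |t| < τ₁ * r →
      HasSum (fun p => c p (t * r⁻¹) * ((r⁻¹ : ℝ) : ℂ) ^ (p + 1)) (F t r) := by
    intro t r hr ht
    obtain ⟨h1, h2, h3, h4⟩ := hdom t r hr ht
    have hrC : (r : ℂ) ≠ 0 := by
      have : 0 < r := by linarith
      exact_mod_cast this.ne'
    have h := (hsum t r h2 h4).mul_left (r : ℂ)⁻¹
    rw [inv_mul_cancel_left₀ hrC] at h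
    refine h.congr_fun ?_
    intro p
    rw [h3, div_eq_mul_inv t r]
    simp only [hc]
    push_cast
    ring
  have hline : ∀ t r : ℝ, HasDerivAt (fun t : ℝ => t * r⁻¹) r⁻¹ t := fun t r => by
    simpa using (hasDerivAt_id t).mul_const r⁻¹
  have hTt : ∀ {f f' : ℕ → ℝ → ℂ} (k : ℕ), (∀ p, ∀ σ ∈ Ioo (-1 : ℝ) 1, HasDerivAt (f p) (f' p σ) σ) →
      ∀ p t r, R < r → |t| < τ₁ * r →
      HasDerivAt (fun t => f p (t * r⁻¹) * ((r⁻¹ : ℝ) : ℂ) ^ (p + k))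
        (f' p (t * r⁻¹) * ((r⁻¹ : ℝ) : ℂ) ^ (p + k + 1)) t := by
    intro f f' k hf p t r hr ht
    have h := ((hf p _ (hIoo _ (hdom t r hr ht).1)).scomp t (hline t r)).mul_const
      (((r⁻¹ : ℝ) : ℂ) ^ (p + k))
    refine h.congr_deriv ?_
    rw [Complex.real_smul]
    ring
  have hnorm : ∀ (z : ℂ) (r : ℝ) (k : ℕ), R < r →
      ‖z * ((r⁻¹ : ℝ) : ℂ) ^ k‖ = ‖z‖ * (r⁻¹) ^ k := by
    intro z r k hr
    rw [norm_mul, norm_pow, Complex.norm_real, Real.norm_of_nonneg (inv_nonneg.2 (by linarith))]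
  have hIt : ∀ t r : ℝ, |t| < τ₁ * r → t ∈ Ioo (-(τ₁ * r)) (τ₁ * r) := fun t r h => abs_lt.1 h
  have hft : ∀ t r : ℝ, R < r → |t| < τ₁ * r →
      HasSum (fun p => c' p (t * r⁻¹) * ((r⁻¹ : ℝ) : ℂ) ^ (p + 2)) (ft t r) := by
    intro t r hr ht
    refine hasSum_deriv_of_hasSum hus isOpen_Ioo isPreconnected_Ioo
      (F := fun p t => c p (t * r⁻¹) * ((r⁻¹ : ℝ) : ℂ) ^ (p + 1))
      (F' := fun p t => c' p (t * r⁻¹) * ((r⁻¹ : ℝ) : ℂ) ^ (p + 2)) (f' := fun t => ft t r)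
      (fun y hy => hF y r hr (abs_lt.2 hy)) (fun p y hy => hTt 1 hcd p y r hr (abs_lt.2 hy)) ?_
      (fun y hy => (hw y r (hdom y r hr (abs_lt.2 hy)).2.1 (hdom y r hr (abs_lt.2 hy)).2.2.2).1)
      (hIt t r ht)
    intro p y hy
    rw [hnorm _ _ _ hr]
    refine le_trans ?_ (hxb p 2 r hr)
    refine mul_le_mul_of_nonneg_right ?_ (pow_nonneg (inv_nonneg.2 (by linarith)) _)
    refine le_trans ?_ (hcb p (y * r⁻¹) (hdom y r hr (abs_lt.2 hy)).1)
    have e1 : ‖c' p (y * r⁻¹)‖ ≤ (2 * p + 4) * ‖c' p (y * r⁻¹)‖ :=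
      le_mul_of_one_le_left (norm_nonneg _) (by linarith [(Nat.cast_nonneg p : (0 : ℝ) ≤ p)])
    have e2 : 0 ≤ ((p : ℝ) + 1) * (p + 2) * ‖c p (y * r⁻¹)‖ := by positivity
    linarith [norm_nonneg (c'' p (y * r⁻¹))]
  have hftt : ∀ t r : ℝ, R < r → |t| < τ₁ * r →
      HasSum (fun p => c'' p (t * r⁻¹) * ((r⁻¹ : ℝ) : ℂ) ^ (p + 3)) (ftt t r) := by
    intro t r hr ht
    refine hasSum_deriv_of_hasSum hus isOpen_Ioo isPreconnected_Ioo
      (F := fun p t => c' p (t * r⁻¹) * ((r⁻¹ : ℝ) : ℂ) ^ (p + 2))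
      (F' := fun p t => c'' p (t * r⁻¹) * ((r⁻¹ : ℝ) : ℂ) ^ (p + 3)) (f' := fun t => ftt t r)
      (fun y hy => hft y r hr (abs_lt.2 hy)) (fun p y hy => hTt 2 hcd' p y r hr (abs_lt.2 hy)) ?_
      (fun y hy => (hw y r (hdom y r hr (abs_lt.2 hy)).2.1 (hdom y r hr (abs_lt.2 hy)).2.2.2).2.1)
      (hIt t r ht)
    intro p y hy
    rw [hnorm _ _ _ hr]
    refine le_trans ?_ (hxb p 3 r hr)
    refine mul_le_mul_of_nonneg_right ?_ (pow_nonneg (inv_nonneg.2 (by linarith)) _)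
    refine le_trans ?_ (hcb p (y * r⁻¹) (hdom y r hr (abs_lt.2 hy)).1)
    have e1 : 0 ≤ (2 * (p : ℝ) + 4) * ‖c' p (y * r⁻¹)‖ := by positivity
    have e2 : 0 ≤ ((p : ℝ) + 1) * (p + 2) * ‖c p (y * r⁻¹)‖ := by positivity
    linarith
  have hinv : ∀ (r : ℝ), R < r → HasDerivAt (fun r : ℝ => r⁻¹) (-(r⁻¹) ^ 2) r := fun r hr => by
    have : r ≠ 0 := by linarith
    simpa [inv_pow] using hasDerivAt_inv this
  have hpowd : ∀ (k : ℕ) (r : ℝ), R < r → HasDerivAt (fun r : ℝ => ((r⁻¹ : ℝ) : ℂ) ^ k)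
      (-(k : ℂ) * ((r⁻¹ : ℝ) : ℂ) ^ (k + 1)) r := by
    intro k r hr
    refine ((hinv r hr).ofReal_comp.fun_pow k).congr_deriv ?_
    rcases k with _ | k
    · simp
    · simp only [Nat.add_sub_cancel]
      push_cast
      ring
  have hlinr : ∀ t r : ℝ, R < r → HasDerivAt (fun r : ℝ => t * r⁻¹) (-(t * r⁻¹) * r⁻¹) r :=
    fun t r hr => ((hinv r hr).const_mul t).congr_deriv (by ring)
  have hTr : ∀ {f f' : ℕ → ℝ → ℂ} (k : ℕ), (∀ p, ∀ σ ∈ Ioo (-1 : ℝ) 1, HasDerivAt (f p) (f' p σ) σ) →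
      ∀ p t r, R < r → |t| < τ₁ * r →
      HasDerivAt (fun r : ℝ => f p (t * r⁻¹) * ((r⁻¹ : ℝ) : ℂ) ^ (p + k))
        (-((t * r⁻¹ : ℝ) * f' p (t * r⁻¹) + (p + k) * f p (t * r⁻¹))
          * ((r⁻¹ : ℝ) : ℂ) ^ (p + k + 1)) r := by
    intro f f' k hf p t r hr ht
    have h := ((hf p _ (hIoo _ (hdom t r hr ht).1)).scomp r (hlinr t r hr)).mul
      (hpowd (p + k) r hr)
    refine h.congr_deriv ?_
    rw [Complex.real_smul]
    simp only [Function.comp_apply]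
    push_cast
    ring
  have hIr : ∀ t r : ℝ, R < r → |t| < τ₁ * r → r ∈ Ioi (max R (|t| / τ₁)) := fun t r hr h =>
    max_lt hr ((div_lt_iff₀ hτ₁'.1).2 (by linarith))
  have hIr' : ∀ t r : ℝ, r ∈ Ioi (max R (|t| / τ₁)) → R < r ∧ |t| < τ₁ * r := fun t r h =>
    ⟨(le_max_left _ _).trans_lt h, by
      have := (div_lt_iff₀ hτ₁'.1).1 ((le_max_right _ _).trans_lt h)
      linarith⟩
  have habs : ∀ t r : ℝ, R < r → |t| < τ₁ * r → ‖((t * r⁻¹ : ℝ) : ℂ)‖ ≤ 1 := fun t r hr ht => by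
    rw [Complex.norm_real]
    exact (hdom t r hr ht).1.trans hτ₁'.2.le
  have hnp : ∀ p k : ℕ, ‖(p : ℂ) + k‖ = p + k := fun p k => by
    rw [← Nat.cast_add, Complex.norm_natCast]
    push_cast
    rfl
  have hfr : ∀ t r : ℝ, R < r → |t| < τ₁ * r →
      HasSum (fun p : ℕ => -((t * r⁻¹ : ℝ) * c' p (t * r⁻¹) + (p + (1 : ℕ)) * c p (t * r⁻¹))
          * ((r⁻¹ : ℝ) : ℂ) ^ (p + 2)) (fr t r) := by
    intro t r hr ht
    refine hasSum_deriv_of_hasSum hus isOpen_Ioi isPreconnected_Ioi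
      (F := fun p r => c p (t * r⁻¹) * ((r⁻¹ : ℝ) : ℂ) ^ (p + 1))
      (F' := fun p r => -((t * r⁻¹ : ℝ) * c' p (t * r⁻¹) + (p + (1 : ℕ)) * c p (t * r⁻¹))
          * ((r⁻¹ : ℝ) : ℂ) ^ (p + 2)) (f' := fun r => fr t r)
      (fun y hy => hF t y (hIr' t y hy).1 (hIr' t y hy).2)
      (fun p y hy => hTr 1 hcd p t y (hIr' t y hy).1 (hIr' t y hy).2) ?_
      (fun y hy => (hw t y (hdom t y (hIr' t y hy).1 (hIr' t y hy).2).2.1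
        (hdom t y (hIr' t y hy).1 (hIr' t y hy).2).2.2.2).2.2.1)
      (hIr t r hr ht)
    intro p y hy
    obtain ⟨hy1, hy2⟩ := hIr' t y hy
    rw [hnorm _ _ _ hy1]
    refine le_trans ?_ (hxb p 2 y hy1)
    refine mul_le_mul_of_nonneg_right ?_ (pow_nonneg (inv_nonneg.2 (by linarith)) _)
    refine le_trans ?_ (hcb p (t * y⁻¹) (hdom t y hy1 hy2).1)
    rw [norm_neg]
    refine (norm_add_le _ _).trans ?_
    rw [norm_mul ((t * y⁻¹ : ℝ) : ℂ), norm_mul ((p : ℂ) + (1 : ℕ)), hnp]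
    have e0 : ‖((t * y⁻¹ : ℝ) : ℂ)‖ * ‖c' p (t * y⁻¹)‖ ≤ 1 * ‖c' p (t * y⁻¹)‖ :=
      mul_le_mul_of_nonneg_right (habs t y hy1 hy2) (norm_nonneg _)
    have e1 : ‖c' p (t * y⁻¹)‖ ≤ (2 * p + 4) * ‖c' p (t * y⁻¹)‖ :=
      le_mul_of_one_le_left (norm_nonneg _) (by linarith [(Nat.cast_nonneg p : (0 : ℝ) ≤ p)])
    have e2 : ((p : ℝ) + (1 : ℕ)) * ‖c p (t * y⁻¹)‖ ≤ (p + 1) * (p + 2) * ‖c p (t * y⁻¹)‖ := by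
      refine mul_le_mul_of_nonneg_right ?_ (norm_nonneg _)
      push_cast
      nlinarith [(Nat.cast_nonneg p : (0 : ℝ) ≤ p)]
    linarith [norm_nonneg (c'' p (t * y⁻¹))]
  have hfrr : ∀ t r : ℝ, R < r → |t| < τ₁ * r →
      HasSum (fun p : ℕ => ((t * r⁻¹ : ℝ) ^ 2 * c'' p (t * r⁻¹)
          + (2 * p + 4) * (t * r⁻¹ : ℝ) * c' p (t * r⁻¹)
          + (p + 1) * (p + 2) * c p (t * r⁻¹)) * ((r⁻¹ : ℝ) : ℂ) ^ (p + 3)) (frr t r) := by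
    intro t r hr ht
    refine hasSum_deriv_of_hasSum hus isOpen_Ioi isPreconnected_Ioi
      (F := fun p r => -((t * r⁻¹ : ℝ) * c' p (t * r⁻¹) + (p + (1 : ℕ)) * c p (t * r⁻¹))
          * ((r⁻¹ : ℝ) : ℂ) ^ (p + 2))
      (F' := fun p r => ((t * r⁻¹ : ℝ) ^ 2 * c'' p (t * r⁻¹)
          + (2 * p + 4) * (t * r⁻¹ : ℝ) * c' p (t * r⁻¹)
          + (p + 1) * (p + 2) * c p (t * r⁻¹)) * ((r⁻¹ : ℝ) : ℂ) ^ (p + 3))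
      (f' := fun r => frr t r)
      (fun y hy => hfr t y (hIr' t y hy).1 (hIr' t y hy).2) ?_ ?_
      (fun y hy => (hw t y (hdom t y (hIr' t y hy).1 (hIr' t y hy).2).2.1
        (hdom t y (hIr' t y hy).1 (hIr' t y hy).2).2.2.2).2.2.2.1)
      (hIr t r hr ht)
    · intro p y hy
      obtain ⟨hy1, hy2⟩ := hIr' t y hy
      have hg : ∀ p, ∀ σ ∈ Ioo (-1 : ℝ) 1, HasDerivAt
          (fun σ : ℝ => -((σ : ℂ) * c' p σ + (p + (1 : ℕ)) * c p σ))
          (-((σ : ℂ) * c'' p σ + (p + 2) * c' p σ)) σ := by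
        intro p σ hσ
        have h1 : HasDerivAt (fun σ : ℝ => (σ : ℂ)) 1 σ := (hasDerivAt_id σ).ofReal_comp
        refine (((h1.mul (hcd' p σ hσ)).add ((hcd p σ hσ).const_mul
          ((p : ℂ) + (1 : ℕ)))).fun_neg).congr_deriv ?_
        push_cast
        ring
      refine (hTr (f := fun p σ => -((σ : ℂ) * c' p σ + (p + (1 : ℕ)) * c p σ)) 2 hg p t y hy1
        hy2).congr_deriv ?_
      push_cast
      ring
    · intro p y hy
      obtain ⟨hy1, hy2⟩ := hIr' t y hy
      rw [hnorm _ _ _ hy1]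
      refine le_trans ?_ (hxb p 3 y hy1)
      refine mul_le_mul_of_nonneg_right ?_ (pow_nonneg (inv_nonneg.2 (by linarith)) _)
      refine le_trans ?_ (hcb p (t * y⁻¹) (hdom t y hy1 hy2).1)
      have hn1 : ‖(2 * p + 4 : ℂ)‖ = 2 * p + 4 := by
        have := Complex.norm_natCast (2 * p + 4)
        push_cast at this
        exact this
      have hn2 : ‖((p : ℂ) + 1) * (p + 2)‖ = (p + 1) * (p + 2) := by
        have := Complex.norm_natCast ((p + 1) * (p + 2))
        push_cast at this
        exact this
      have ha := habs t y hy1 hy2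
      refine (norm_add_le _ _).trans (add_le_add ((norm_add_le _ _).trans (add_le_add ?_ ?_)) ?_)
      · rw [norm_mul, norm_pow]
        exact mul_le_of_le_one_left (norm_nonneg _) (pow_le_one₀ (norm_nonneg _) ha)
      · rw [norm_mul, norm_mul, hn1]
        refine mul_le_mul_of_nonneg_right ?_ (norm_nonneg _)
        exact mul_le_of_le_one_right (by positivity) ha
      · rw [norm_mul, hn2]
  -- comparison of the coefficients
  set Box : ℕ → ℂ := fun p => ((1 - τ ^ 2 : ℝ) : ℂ) * c'' p τ - (2 * (p + 1) * τ : ℂ) * c' p τ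
    + (Λ - p * (p + 1) : ℂ) * c p τ with hBox
  have hzero : ∀ p, Box p = 0 := by
    refine eq_zero_of_hasSum_pow (δ := R⁻¹) (by positivity) fun x hx hxR => ?_
    obtain ⟨r, hrdef⟩ : ∃ r, r = x⁻¹ := ⟨_, rfl⟩
    have hr : R < r := by
      rw [hrdef]
      exact (lt_inv_comm₀ hx (by linarith)).1 hxR
    have hrx : r⁻¹ = x := by rw [hrdef, inv_inv]
    have hr0 : 0 < r := by linarith
    have ht : |τ * r| < τ₁ * r := by
      rw [abs_mul, abs_of_pos hr0]
      exact mul_lt_mul_of_pos_right (by rw [hτ₁]; linarith) hr0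
    have htr : τ * r * r⁻¹ = τ := by field_simp
    obtain ⟨_, h2, _, h4⟩ := hdom _ r hr ht
    have heq := (hw _ r h2 h4).2.2.2.2
    have hs1 := hF _ r hr ht
    have hs2 := hftt _ r hr ht
    have hs3 := hfr _ r hr ht
    have hs4 := hfrr _ r hr ht
    simp only [htr] at hs1 hs2 hs3 hs4
    -- The radial wave equation, multiplied by one more `r` so that the term of index `p` carries
    -- exactly `x^p` with `x = 1/r`.
    have hs5 := ((((hs2.sub hs4).mul_left ((r : ℂ) ^ 2)).sub (hs3.mul_left (2 * (r : ℂ)))).add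
      (hs1.mul_left (Λ : ℂ))).mul_left (r : ℂ)
    rw [heq, neg_mul, neg_add_cancel, mul_zero] at hs5
    refine hs5.congr_fun ?_
    intro p
    have hrC : (r : ℂ) * ((r⁻¹ : ℝ) : ℂ) = 1 := by
      rw [← Complex.ofReal_mul, mul_inv_cancel₀ hr0.ne', Complex.ofReal_one]
    rw [← hrx]
    generalize ((r⁻¹ : ℝ) : ℂ) = y at hrC ⊢
    have hy1 : y ^ (p + 1) = y ^ p * y := pow_succ _ _
    have hy2 : y ^ (p + 2) = y ^ p * y ^ 2 := pow_add _ _ _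
    have hy3 : y ^ (p + 3) = y ^ p * y ^ 3 := pow_add _ _ _
    have hm2 : (r : ℂ) ^ 2 * y ^ 2 = 1 := by rw [← mul_pow, hrC, one_pow]
    have hm3 : (r : ℂ) ^ 3 * y ^ 3 = 1 := by rw [← mul_pow, hrC, one_pow]
    simp only [hBox]
    rw [hy1, hy2, hy3]
    push_cast
    linear_combination (-(c'' p τ - ((τ : ℂ) ^ 2 * c'' p τ + (2 * p + 4) * τ * c' p τ
      + (p + 1) * (p + 2) * c p τ)) * y ^ p) * hm3
      - 2 * (τ * c' p τ + (p + 1) * c p τ) * y ^ p * hm2 - Λ * c p τ * y ^ p * hrC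
  have hb0 := hzero p
  have hsτ := (hs τ (by rw [hτ₁]; linarith)).1
  have hsne : (s τ : ℂ) ≠ 0 := by
    simp only [hsdef]
    exact_mod_cast (inv_pos.2 hsτ).ne'
  have hs1 : ((1 - τ ^ 2 : ℝ) : ℂ) * (s τ : ℂ) = 1 := by
    simp only [hsdef]
    rw [← Complex.ofReal_mul, mul_inv_cancel₀ hsτ.ne', Complex.ofReal_one]
  -- Going back from `c = s^p b` to `b` by means of `(1 - τ²) s = 1` removes the nonzero factor
  -- `s^p`.
  have hfac : Box p = (s τ : ℂ) ^ p * (((1 - τ ^ 2 : ℝ) : ℂ) * b'' p τ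
      + ((2 * (p - 1) * τ : ℝ) : ℂ) * b' p τ + ((Λ - p * (p - 1) : ℝ) : ℂ) * b p τ) := by
    simp only [hBox, hc, hc', hc'']
    push_cast at hs1 ⊢
    linear_combination (s τ : ℂ) ^ p * (4 * p * τ * b' p τ + 2 * p * b p τ
      + 4 * p * (p + 1) * τ ^ 2 * s τ * b p τ) * hs1
  rw [hfac] at hb0
  exact (mul_eq_zero.1 hb0).resolve_left (pow_ne_zero _ hsne)

/-! ## The modes of the good field -/

/-- The derivative of order `k` of the coefficient of `ρ^p` in the mode `Y_{ℓ m}`. -/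
def modeCoeff (a : ℕ → ℕ → ℤ → ℝ → ℂ) (ℓ : ℕ) (m : ℤ) (k p : ℕ) (τ : ℝ) : ℂ :=
  if ℓ ≤ p then iteratedDeriv k (a p ℓ m) τ / p.factorial else 0

/-- The normalized projection of a field to `Y_{ℓ m}`. -/
def sphMode (ℓ : ℕ) (m : ℤ) (G : Spacetime → ℂ) (t r : ℝ) : ℂ := sphProj ℓ m G t r / sphNormSq ℓ m

lemma continuous_modeSum (a : ℕ → ℕ → ℤ → ℝ → ℂ) (p : ℕ) (τ : ℝ) : Continuous (modeSum a p τ) := by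
  unfold modeSum
  exact continuous_finsetSum _ fun ℓ _ => continuous_finsetSum _ fun m _ =>
    continuous_const.mul (contDiff_sphHarm ℓ m).continuous

lemma integral_modeSum (a : ℕ → ℕ → ℤ → ℝ → ℂ) (p : ℕ) (τ : ℝ) {ℓ : ℕ} {m : ℤ}
    (hm : |m| ≤ (ℓ : ℤ)) :
    ∫ n, modeSum a p τ n * sphHarmConj ℓ m n ∂sphereMeasure
      = if ℓ ≤ p then a p ℓ m τ * sphNormSq ℓ m else 0 := by
  have hint : ∀ (ℓ' : ℕ) (m' : ℤ), Integrable
      (fun n => a p ℓ' m' τ * (sphHarm ℓ' m' n * sphHarmConj ℓ m n)) sphereMeasure := fun ℓ' m' =>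
    (integrable_sphere ((contDiff_sphHarm ℓ' m').continuous.mul
      (contDiff_sphHarmConj ℓ m).continuous).continuousOn).const_mul _
  simp only [modeSum, Finset.sum_mul, mul_assoc]
  rw [integral_finsetSum _ fun ℓ' _ => integrable_finsetSum _ fun m' _ => hint ℓ' m']
  simp only [integral_finsetSum _ fun m' _ => hint _ m', integral_const_mul]
  have hz : ∀ (ℓ' : ℕ) (m' : ℤ), (ℓ', m') ≠ (ℓ, m) →
      a p ℓ' m' τ * ∫ n, sphHarm ℓ' m' n * sphHarmConj ℓ m n ∂sphereMeasure = 0 :=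
    fun ℓ' m' h => by rw [integral_sphHarm_mul_conj_eq_zero h, mul_zero]
  split_ifs with hℓ
  · rw [Finset.sum_eq_single_of_mem ℓ (Finset.mem_range.2 (Nat.lt_succ_of_le hℓ)),
      Finset.sum_eq_single_of_mem m (Finset.mem_Icc.2 (abs_le.1 hm))]
    · rfl
    · exact fun m' _ h => hz ℓ m' fun h' => h (Prod.ext_iff.1 h').2
    · exact fun ℓ' _ h => Finset.sum_eq_zero fun m' _ => hz ℓ' m' fun h' => h (Prod.ext_iff.1 h').1
  · refine Finset.sum_eq_zero fun ℓ' hℓ' => Finset.sum_eq_zero fun m' _ => hz ℓ' m' fun h' => hℓ ?_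
    have h1 : ℓ' = ℓ := (Prod.ext_iff.1 h').1
    rw [← h1]
    exact Nat.lt_succ_iff.1 (Finset.mem_range.1 hℓ')

lemma norm_expansion_term_le {a : ℕ → ℕ → ℤ → ℝ → ℂ} {p : ℕ} {τ M X ρ : ℝ} (hM : 0 ≤ M)
    (hX : 0 ≤ X) (hρ : 0 ≤ ρ)
    (h : ∀ (ℓ : ℕ) (m : ℤ), ℓ ≤ p → |m| ≤ (ℓ : ℤ) → ‖a p ℓ m τ‖ ≤ M * p.factorial * X ^ p)
    {n : Space} (hn : n ∈ unitSphere) :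
    ‖((ρ ^ p / (p.factorial : ℝ) : ℝ) : ℂ) * modeSum a p τ n‖ ≤ M * (48 * X * ρ) ^ p := by
  have hp : (0 : ℝ) < p.factorial := by exact_mod_cast Nat.factorial_pos p
  rw [norm_mul, Complex.norm_real, Real.norm_of_nonneg (by positivity)]
  calc _ ≤ ρ ^ p / (p.factorial : ℝ) * (M * p.factorial * X ^ p * 48 ^ p) :=
        mul_le_mul_of_nonneg_left (norm_modeSum_le (by positivity) h hn) (by positivity)
    _ = _ := by
        rw [mul_pow, mul_pow]
        field_simp

/-- The expansion of the field at a point of polar coordinates `(t, r, n)`. -/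
lemma hasSum_expansion {ρ₀ : ℝ} {a : ℕ → ℕ → ℤ → ℝ → ℂ} {Φ : Spacetime → ℂ}
    (hΦ : HasCylinderExpansion ρ₀ a Φ) {t r : ℝ} (h : (t, r) ∈ coneRegion ρ₀) {n : Space}
    (hn : n ∈ unitSphere) :
    HasSum (fun p : ℕ => (((r / (r ^ 2 - t ^ 2)) ^ p / (p.factorial : ℝ) : ℝ) : ℂ)
      * modeSum a p (t / r) n) ((r : ℂ) * Φ (t, r • n)) := by
  have h1 := hΦ.2 _ (mem_nearCylinder h hn)
  have hr := coneRegion_pos h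
  simpa only [cylRho, cylTau, norm_smul_unit hr hn,
    direction_smul hr (show ‖n‖ = 1 by simpa using hn)] using h1

lemma div_sq_sub_sq_pos {t r : ℝ} (h : |t| < r) : 0 < r / (r ^ 2 - t ^ 2) := by
  have h1 := abs_lt.1 h
  have hr : 0 < r := (abs_nonneg t).trans_lt h
  exact div_pos hr (by nlinarith)

lemma abs_div_lt_one {t r : ℝ} (h : |t| < r) : |t / r| < 1 := by
  have hr : 0 < r := (abs_nonneg t).trans_lt h
  rw [abs_div, abs_of_pos hr, div_lt_one hr]
  exact h

lemma exists_bound_at {ρ₀ : ℝ} (hρ₀ : 0 < ρ₀) {a : ℕ → ℕ → ℤ → ℝ → ℂ} (ha : ModesConverge ρ₀ a)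
    {τ : ℝ} (hτ : |τ| < 1) :
    ∃ M : ℝ, 0 ≤ M ∧ ∀ (p ℓ : ℕ) (m : ℤ), ℓ ≤ p → |m| ≤ (ℓ : ℤ) →
      ‖a p ℓ m τ‖ ≤ M * p.factorial * (2 / ρ₀) ^ p := by
  obtain ⟨M, hM, hb⟩ := modes_bound hρ₀ ha (τ₁ := (1 + |τ|) / 2)
    ⟨by linarith [abs_nonneg τ], by linarith⟩
  refine ⟨M, hM, fun p ℓ m hℓ hm => ?_⟩
  simpa using hb p ℓ m hℓ hm 0 (by norm_num) τ (by linarith)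

/-- The expansion of the modes of the field. -/
lemma hasSum_sphMode {ρ₀ : ℝ} (hρ₀ : 0 < ρ₀) {a : ℕ → ℕ → ℤ → ℝ → ℂ} {Φ : Spacetime → ℂ}
    (hΦ : HasCylinderExpansion ρ₀ a Φ) {ℓ : ℕ} {m : ℤ} (hm : |m| ≤ (ℓ : ℤ)) {t r : ℝ}
    (ht : |t| < r) (hρ : r / (r ^ 2 - t ^ 2) ≤ ρ₀ / 192) :
    HasSum (fun p => modeCoeff a ℓ m 0 p (t / r) * ((r / (r ^ 2 - t ^ 2) : ℝ) : ℂ) ^ p)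
      (r * sphMode ℓ m Φ t r) := by
  have h : (t, r) ∈ coneRegion ρ₀ := ⟨ht, lt_of_le_of_lt hρ (by linarith)⟩
  obtain ⟨M, hM, hb⟩ := exists_bound_at hρ₀ hΦ.1 (abs_div_lt_one ht)
  have hpos := div_sq_sub_sq_pos ht
  set ρ := r / (r ^ 2 - t ^ 2) with hρdef
  -- This is where `192 = 2 · 48 · 2` comes from: it makes the ratio of the majorizing geometric
  -- series `1/2`, so that sum and integral may be interchanged.
  have hy : 48 * (2 / ρ₀) * ρ ≤ 1 / 2 := by
    calc 48 * (2 / ρ₀) * ρ ≤ 48 * (2 / ρ₀) * (ρ₀ / 192) :=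
          mul_le_mul_of_nonneg_left hρ (by positivity)
      _ = 1 / 2 := by
          field_simp
          norm_num
  have hterm : ∀ p, ∀ n ∈ unitSphere,
      ‖((ρ ^ p / (p.factorial : ℝ) : ℝ) : ℂ) * modeSum a p (t / r) n‖ ≤ M * (1 / 2) ^ p :=
    fun p n hn => (norm_expansion_term_le hM (by positivity) hpos.le (hb p) hn).trans
      (mul_le_mul_of_nonneg_left (pow_le_pow_left₀ (by positivity) hy p) hM)
  have hint : HasSum (fun p => ∫ n, ((ρ ^ p / (p.factorial : ℝ) : ℝ) : ℂ) * modeSum a p (t / r) n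
      * sphHarmConj ℓ m n ∂sphereMeasure)
      (∫ n, (r : ℂ) * Φ (t, r • n) * sphHarmConj ℓ m n ∂sphereMeasure) := by
    refine hasSum_integral_of_dominated_convergence (fun p _ => M * (1 / 2) ^ p * 8 ^ ℓ) ?_ ?_ ?_ ?_ ?_
    · exact fun p => aestronglyMeasurable_sphere (((continuous_const.mul
        (continuous_modeSum a p (t / r))).mul (contDiff_sphHarmConj ℓ m).continuous).continuousOn)
    · intro p
      filter_upwards [ae_mem_unitSphere] with n hn
      rw [norm_mul]
      refine mul_le_mul (hterm p n hn) ?_ (norm_nonneg _) (by positivity)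
      rw [sphHarmConj, Complex.norm_conj]
      exact norm_sphHarm_le hm hn
    · exact Eventually.of_forall fun _ => (summable_geometric_two.mul_left M).mul_right _
    · exact integrable_const _
    · filter_upwards [ae_mem_unitSphere] with n hn
      exact (hasSum_expansion hΦ h hn).mul_right _
  have hne := sphNormSq_ne_zero hm
  have hlim : (∫ n, (r : ℂ) * Φ (t, r • n) * sphHarmConj ℓ m n ∂sphereMeasure) / sphNormSq ℓ m
      = r * sphMode ℓ m Φ t r := by
    simp only [mul_assoc]
    rw [integral_const_mul, sphMode, sphProj, mul_div_assoc]
  rw [← hlim]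
  refine (hint.div_const (sphNormSq ℓ m)).congr_fun ?_
  intro p
  simp only [mul_assoc]
  rw [integral_const_mul, integral_modeSum a p (t / r) hm, modeCoeff, iteratedDeriv_zero]
  split_ifs
  · push_cast
    field_simp
  · simp

lemma hasDerivAt_mode {ρ₀ : ℝ} {a : ℕ → ℕ → ℤ → ℝ → ℂ} (ha : ModesConverge ρ₀ a) {p ℓ : ℕ} {m : ℤ}
    (hℓ : ℓ ≤ p) (hm : |m| ≤ (ℓ : ℤ)) {k : ℕ} (hk : k ≤ 1) {τ : ℝ} (hτ : τ ∈ Ioo (-1 : ℝ) 1) :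
    HasDerivAt (iteratedDeriv k (a p ℓ m)) (iteratedDeriv (k + 1) (a p ℓ m) τ) τ := by
  have hc := (ha.1 p ℓ m hℓ hm).contDiffAt (isOpen_Ioo.mem_nhds hτ)
  rw [iteratedDeriv_succ]
  refine DifferentiableAt.hasDerivAt ?_
  interval_cases k
  · exact hc.differentiableAt two_ne_zero
  · rw [iteratedDeriv_one]
    have h1 : ContDiffOn ℝ 1 (deriv (a p ℓ m)) (Ioo (-1) 1) :=
      (ha.1 p ℓ m hℓ hm).deriv_of_isOpen isOpen_Ioo (by norm_num)
    exact (h1.contDiffAt (isOpen_Ioo.mem_nhds hτ)).differentiableAt one_ne_zero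

lemma hasDerivAt_modeCoeff {ρ₀ : ℝ} {a : ℕ → ℕ → ℤ → ℝ → ℂ} (ha : ModesConverge ρ₀ a) {ℓ : ℕ}
    {m : ℤ} (hm : |m| ≤ (ℓ : ℤ)) {k : ℕ} (hk : k ≤ 1) (p : ℕ) {τ : ℝ} (hτ : τ ∈ Ioo (-1 : ℝ) 1) :
    HasDerivAt (modeCoeff a ℓ m k p) (modeCoeff a ℓ m (k + 1) p τ) τ := by
  unfold modeCoeff
  split_ifs with hℓ
  · exact (hasDerivAt_mode ha hℓ hm hk hτ).div_const _
  · exact hasDerivAt_const _ _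

/-- The ordinary differential equation of the modes `a_{p;ℓ,m}`. -/
lemma mode_equation {ρ₀ : ℝ} (hρ₀ : 0 < ρ₀) {a : ℕ → ℕ → ℤ → ℝ → ℂ} {Φ : Spacetime → ℂ}
    (hΦ : HasCylinderExpansion ρ₀ a Φ) (hC : ContDiffOn ℝ 2 Φ (nearCylinder ρ₀))
    (hw : ∀ q ∈ nearCylinder ρ₀, waveOp Φ q = 0) {p ℓ : ℕ} {m : ℤ} (hℓ : ℓ ≤ p)
    (hm : |m| ≤ (ℓ : ℤ)) {τ : ℝ} (hτ : τ ∈ Ioo (-1 : ℝ) 1) :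
    ((1 - τ ^ 2 : ℝ) : ℂ) * iteratedDeriv 2 (a p ℓ m) τ
      + ((2 * (p - 1) * τ : ℝ) : ℂ) * iteratedDeriv 1 (a p ℓ m) τ
      + ((ℓ * (ℓ + 1) - p * (p - 1) : ℝ) : ℂ) * a p ℓ m τ = 0 := by
  obtain ⟨ft, fr, ftt, frr, hf⟩ := sphProj_wave hC hw ℓ m
  have hX : (0 : ℝ) ≤ 2 / ρ₀ := by positivity
  have h := mode_ode (δ := ρ₀ / 192) (X := 2 / ρ₀) (Λ := ℓ * (ℓ + 1)) (by positivity) hX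
    (b := modeCoeff a ℓ m 0) (b' := modeCoeff a ℓ m 1) (b'' := modeCoeff a ℓ m 2)
    (F := sphMode ℓ m Φ) (ft := fun t r => ft t r / sphNormSq ℓ m)
    (fr := fun t r => fr t r / sphNormSq ℓ m) (ftt := fun t r => ftt t r / sphNormSq ℓ m)
    (frr := fun t r => frr t r / sphNormSq ℓ m)
    (fun p τ hτ => hasDerivAt_modeCoeff hΦ.1 hm (by norm_num) p hτ)
    (fun p τ hτ => hasDerivAt_modeCoeff hΦ.1 hm (by norm_num) p hτ) ?_
    (fun t r ht hρ => hasSum_sphMode hρ₀ hΦ hm ht hρ.le) ?_ p hτ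
  · simp only [modeCoeff, if_pos hℓ, iteratedDeriv_zero] at h
    have hp : (p.factorial : ℂ) ≠ 0 := by exact_mod_cast Nat.factorial_ne_zero p
    field_simp at h
    push_cast at h ⊢
    linear_combination h
  · intro τ₁ hτ₁
    obtain ⟨M, hM, hb⟩ := modes_bound hρ₀ hΦ.1 hτ₁
    have key : ∀ k ≤ 2, ∀ p τ, |τ| ≤ τ₁ → ‖modeCoeff a ℓ m k p τ‖ ≤ M * (2 / ρ₀) ^ p := by
      intro k hk p τ hτ
      unfold modeCoeff
      split_ifs with hℓ
      · have hp : (0 : ℝ) < p.factorial := by exact_mod_cast Nat.factorial_pos p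
        rw [norm_div, Complex.norm_natCast, div_le_iff₀ hp]
        calc _ ≤ _ := hb p ℓ m hℓ hm k hk τ hτ
          _ = _ := by ring
      · rw [norm_zero]
        positivity
    exact ⟨M, hM, fun p τ hτ => ⟨key 0 (by norm_num) p τ hτ, key 1 (by norm_num) p τ hτ,
      key 2 le_rfl p τ hτ⟩⟩
  · intro t r ht hρ
    obtain ⟨h1, h2, h3, h4, h5⟩ := hf t r ⟨ht, lt_trans hρ (by linarith)⟩
    refine ⟨h1.div_const _, h2.div_const _, h3.div_const _, h4.div_const _, ?_⟩
    have hne := sphNormSq_ne_zero hm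
    simp only [sphMode]
    field_simp
    push_cast
    linear_combination h5

/-- The modes of positive order are bounded uniformly on `(-1, 1)`. -/
lemma exists_uniform_bound {ρ₀ : ℝ} (hρ₀ : 0 < ρ₀) {a : ℕ → ℕ → ℤ → ℝ → ℂ} {Φ : Spacetime → ℂ}
    (hΦ : HasCylinderExpansion ρ₀ a Φ) (hC : ContDiffOn ℝ 2 Φ (nearCylinder ρ₀))
    (hw : ∀ q ∈ nearCylinder ρ₀, waveOp Φ q = 0) :
    ∃ M X : ℝ, 0 ≤ M ∧ 2 / ρ₀ ≤ X ∧ ∀ (p ℓ : ℕ) (m : ℤ), 1 ≤ p → ℓ ≤ p → |m| ≤ (ℓ : ℤ) →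
      ∀ τ ∈ Ioo (-1 : ℝ) 1, ‖a p ℓ m τ‖ ≤ M * p.factorial * X ^ p := by
  -- Only the data at `τ = 0` enter, so the value `1/2` is immaterial.
  obtain ⟨M, hM, hb⟩ := modes_bound hρ₀ hΦ.1 (τ₁ := 1 / 2) (by norm_num)
  have hX0 : 0 ≤ 2 / ρ₀ := by positivity
  refine ⟨2 * M, Real.exp 9 * (2 / ρ₀), by positivity,
    le_mul_of_one_le_left hX0 (Real.one_le_exp (by norm_num)), fun p ℓ m hp hℓ hm τ hτ => ?_⟩
  have hlam : |((ℓ : ℝ) * (ℓ + 1) - p * (p - 1))| ≤ 2 * (p : ℝ) ^ 2 := by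
    have h1 : (1 : ℝ) ≤ p := by exact_mod_cast hp
    have h2 : (ℓ : ℝ) ≤ p := by exact_mod_cast hℓ
    have h3 : (0 : ℝ) ≤ ℓ := Nat.cast_nonneg ℓ
    rw [abs_le]
    constructor <;> nlinarith
  have h := norm_mode_le hp hlam (f := a p ℓ m) (f' := iteratedDeriv 1 (a p ℓ m))
    (f'' := iteratedDeriv 2 (a p ℓ m))
    (fun τ hτ => by simpa using hasDerivAt_mode hΦ.1 hℓ hm (k := 0) (by norm_num) hτ)
    (fun τ hτ => hasDerivAt_mode hΦ.1 hℓ hm (k := 1) le_rfl hτ)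
    (fun τ hτ => mode_equation hρ₀ hΦ hC hw hℓ hm hτ) hτ
  have h0 := hb p ℓ m hℓ hm 0 (by norm_num) 0 (by norm_num)
  have h1 := hb p ℓ m hℓ hm 1 (by norm_num) 0 (by norm_num)
  rw [iteratedDeriv_zero] at h0
  calc _ ≤ _ := h
    _ ≤ Real.exp 9 ^ p * (M * p.factorial * (2 / ρ₀) ^ p + M * p.factorial * (2 / ρ₀) ^ p) := by
        gcongr
    _ = _ := by
        rw [mul_pow]
        ring

/-! ## The monopole -/

/-- With the denominator cleared, all conditions are affine along an outgoing ray, where `r - t` is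
constant; hence the convexity below. -/
lemma mem_coneRegion_iff {ρ₀ t r : ℝ} : (t, r) ∈ coneRegion ρ₀ ↔
    0 < r - t ∧ 0 < r + t ∧ r < ρ₀ * ((r - t) * (r + t)) := by
  constructor
  · rintro ⟨h1, h2⟩
    simp only at h1 h2
    have h3 := abs_lt.1 h1
    have h4 : 0 < r - t := by linarith
    have h5 : 0 < r + t := by linarith
    rw [show r ^ 2 - t ^ 2 = (r - t) * (r + t) by ring, div_lt_iff₀ (mul_pos h4 h5)] at h2
    exact ⟨h4, h5, h2⟩
  · rintro ⟨h1, h2, h3⟩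
    refine ⟨abs_lt.2 ⟨by linarith, by linarith⟩, ?_⟩
    simp only
    rwa [show r ^ 2 - t ^ 2 = (r - t) * (r + t) by ring, div_lt_iff₀ (mul_pos h1 h2)]

/-- The part of an outgoing null ray near the cylinder is connected. -/
lemma convex_coneRegion_outgoing (ρ₀ t r : ℝ) :
    Convex ℝ {s : ℝ | (t + s, r + s) ∈ coneRegion ρ₀} := by
  intro x hx y hy α β hα hβ hαβ
  simp only [mem_ofPred_eq, mem_coneRegion_iff, smul_eq_mul] at hx hy ⊢
  obtain ⟨h1, h2, h3⟩ := hx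
  obtain ⟨_, h5, h6⟩ := hy
  have hβ' : β = 1 - α := by linarith
  subst hβ'
  rcases hα.eq_or_lt with h0 | h0
  · rw [← h0]
    simp only [zero_mul, sub_zero, one_mul, zero_add]
    exact ⟨by linarith, h5, h6⟩
  · have e1 := mul_pos h0 h2
    have e2 := mul_nonneg hβ h5.le
    have e3 := mul_pos h0 (sub_pos.2 h3)
    have e4 := mul_nonneg hβ (sub_pos.2 h6).le
    exact ⟨by linarith, by linarith, by linarith⟩

/-- The monopole of the good field is constant along outgoing null rays. -/
lemma sphMode_zero_outgoing {ρ₀ : ℝ} {Φ φ : Spacetime → ℂ} (hφ : IsUglyBuiltFrom ρ₀ Φ φ)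
    {t r s : ℝ} (h0 : (t, r) ∈ coneRegion ρ₀) (hs : (t + s, r + s) ∈ coneRegion ρ₀) :
    ((r + s : ℝ) : ℂ) * sphMode 0 0 Φ (t + s) (r + s) = r * sphMode 0 0 Φ t r := by
  have hopen : IsOpen {s : ℝ | (t + s, r + s) ∈ coneRegion ρ₀} :=
    (isOpen_coneRegion ρ₀).preimage (by fun_prop : Continuous fun s : ℝ => (t + s, r + s))
  have hd : ∀ s ∈ {s : ℝ | (t + s, r + s) ∈ coneRegion ρ₀},
      HasDerivAt (fun s : ℝ => ((r + s : ℝ) : ℂ) * sphProj 0 0 Φ (t + s) (r + s)) 0 s := by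
    intro s hs
    -- The factor `ℓ(ℓ+1)` vanishes for `ℓ = 0`.
    have := hasDerivAt_sphProj_good hφ 0 0 hs
    simpa using this
  have hconst := hopen.is_const_of_deriv_eq_zero (convex_coneRegion_outgoing ρ₀ t r).isPreconnected
    (fun s hs => (hd s hs).differentiableAt.differentiableWithinAt) (fun s hs => (hd s hs).deriv)
    hs (show (0 : ℝ) ∈ {s : ℝ | (t + s, r + s) ∈ coneRegion ρ₀} by simpa using h0)
  simp only [add_zero] at hconst
  simp only [sphMode]
  rw [← mul_div_assoc, ← mul_div_assoc, hconst]

/-- The monopole modes of the good field. -/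
lemma monopole_modes {ρ₀ : ℝ} (hρ₀ : 0 < ρ₀) {a : ℕ → ℕ → ℤ → ℝ → ℂ} {Φ φ : Spacetime → ℂ}
    (hΦ : HasCylinderExpansion ρ₀ a Φ) (hφ : IsUglyBuiltFrom ρ₀ Φ φ) (p : ℕ) {τ : ℝ}
    (hτ : τ ∈ Ioo (-1 : ℝ) 1) : a p 0 0 τ = a p 0 0 0 * (1 + τ) ^ p := by
  have h1τ : 0 < 1 + τ := by linarith [hτ.1]
  have h1τ' : 0 < 1 - τ := by linarith [hτ.2]
  -- The variable is `x = 1/(-u)`. On the ray one has `ρ = x` at `τ = 0` and `ρ = x/(1+τ)` at the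
  -- given `τ`; this `δ` keeps both in the range of the mode expansion.
  have hz := eq_zero_of_hasSum_pow (δ := ρ₀ / 192 * (1 + τ) / 2)
    (w := fun p => modeCoeff a 0 0 0 p τ / ((1 + τ : ℝ) : ℂ) ^ p - modeCoeff a 0 0 0 p 0)
    (by positivity) ?_ p
  · simp only [modeCoeff, if_pos (Nat.zero_le p), iteratedDeriv_zero] at hz
    have hp : (p.factorial : ℂ) ≠ 0 := by exact_mod_cast Nat.factorial_ne_zero p
    have hτp : ((1 + τ : ℝ) : ℂ) ^ p ≠ 0 := pow_ne_zero _ (by exact_mod_cast h1τ.ne')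
    field_simp at hz
    push_cast at hz
    linear_combination hz
  · intro x hx hxδ
    have hxδ' : x < ρ₀ / 192 := by
      have : ρ₀ / 192 * (1 + τ) / 2 ≤ ρ₀ / 192 * 2 / 2 := by
        gcongr
        linarith [hτ.2]
      linarith
    -- The radius at which the outgoing ray through `(t, r) = (0, 1/x)` meets `t = τ r`.
    obtain ⟨r, hr⟩ : ∃ r, r = (x * (1 - τ))⁻¹ := ⟨_, rfl⟩
    have hr0 : 0 < r := by rw [hr]; positivity
    have hρτ : r / (r ^ 2 - (τ * r) ^ 2) = x / (1 + τ) := by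
      have h1 : r ^ 2 - (τ * r) ^ 2 = r ^ 2 * ((1 - τ) * (1 + τ)) := by ring
      rw [h1, hr]
      field_simp
    have hρ0 : x⁻¹ / (x⁻¹ ^ 2 - 0 ^ 2) = x := by field_simp; simp
    have ht : |τ * r| < r := by
      rw [abs_mul, abs_of_pos hr0]
      exact mul_lt_of_lt_one_left hr0 (abs_lt.2 hτ)
    have ht0 : |(0 : ℝ)| < x⁻¹ := by
      rw [abs_zero]
      positivity
    have hb1 : r / (r ^ 2 - (τ * r) ^ 2) ≤ ρ₀ / 192 := by
      rw [hρτ, div_le_iff₀ h1τ]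
      have : 0 < ρ₀ / 192 * (1 + τ) := by positivity
      linarith
    have hs1 := hasSum_sphMode hρ₀ hΦ (ℓ := 0) (m := 0) (by simp) ht hb1
    have hs2 := hasSum_sphMode hρ₀ hΦ (ℓ := 0) (m := 0) (by simp) ht0 (by rw [hρ0]; exact hxδ'.le)
    have hm1 : (0, x⁻¹) ∈ coneRegion ρ₀ := ⟨ht0, by simp only; rw [hρ0]; linarith⟩
    have e1 : r = x⁻¹ + τ * r := by
      rw [hr]
      field_simp
      ring
    have hm2 : (0 + τ * r, x⁻¹ + τ * r) ∈ coneRegion ρ₀ := by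
      rw [zero_add, ← e1]
      exact ⟨ht, by simp only; linarith⟩
    have heq := sphMode_zero_outgoing hφ hm1 hm2
    rw [← e1, zero_add] at heq
    rw [heq] at hs1
    have hs := hs1.sub hs2
    rw [sub_self] at hs
    refine hs.congr_fun ?_
    intro p
    rw [hρτ, hρ0, mul_div_assoc, div_self hr0.ne', mul_one, zero_div]
    push_cast
    rw [div_pow]
    ring

lemma deriv_monopole {ρ₀ : ℝ} (hρ₀ : 0 < ρ₀) {a : ℕ → ℕ → ℤ → ℝ → ℂ} {Φ φ : Spacetime → ℂ}
    (hΦ : HasCylinderExpansion ρ₀ a Φ) (hφ : IsUglyBuiltFrom ρ₀ Φ φ) (p : ℕ) :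
    deriv (a p 0 0) 0 = p * a p 0 0 0 := by
  have h1 : a p 0 0 =ᶠ[𝓝 0] fun τ : ℝ => a p 0 0 0 * (1 + (τ : ℂ)) ^ p := by
    filter_upwards [isOpen_Ioo.mem_nhds (show (0 : ℝ) ∈ Ioo (-1 : ℝ) 1 by norm_num)] with τ hτ
      using monopole_modes hρ₀ hΦ hφ p hτ
  have h2 : HasDerivAt (fun τ : ℝ => a p 0 0 0 * (1 + (τ : ℂ)) ^ p) (p * a p 0 0 0) 0 := by
    have h3 : HasDerivAt (fun τ : ℝ => 1 + (τ : ℂ)) 1 0 :=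
      ((hasDerivAt_id (0 : ℝ)).ofReal_comp).const_add 1
    refine ((h3.fun_pow p).const_mul (a p 0 0 0)).congr_deriv ?_
    simp
    ring
  rw [h1.deriv_eq, h2.deriv]

/-! ## Bounds near past null infinity -/

/-- The modes are bounded up to the critical sets `τ = ±1`. -/
def ModesBounded (ρ₀ : ℝ) (a : ℕ → ℕ → ℤ → ℝ → ℂ) (M X : ℝ) : Prop :=
  0 ≤ M ∧ 2 / ρ₀ ≤ X ∧ ∀ (p ℓ : ℕ) (m : ℤ), ℓ ≤ p → |m| ≤ (ℓ : ℤ) →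
    ∀ τ ∈ Ioo (-1 : ℝ) 1, ‖a p ℓ m τ‖ ≤ M * p.factorial * X ^ p

/-- The wave equation alone would allow a logarithm in `a_{0;0,0}`, unbounded at `τ = ±1`. Constancy
of the monopole along outgoing rays excludes it, and the energy estimate handles `p ≥ 1`. -/
lemma exists_modesBounded {ρ₀ : ℝ} (hρ₀ : 0 < ρ₀) {a : ℕ → ℕ → ℤ → ℝ → ℂ} {Φ φ : Spacetime → ℂ}
    (hΦ : HasCylinderExpansion ρ₀ a Φ) (hφ : IsUglyBuiltFrom ρ₀ Φ φ) :
    ∃ M X : ℝ, ModesBounded ρ₀ a M X := by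
  obtain ⟨M, X, hM, hX, hb⟩ := exists_uniform_bound hρ₀ hΦ hφ.contDiffOn_good hφ.good
  have hX0 : 0 ≤ X := le_trans (by positivity) hX
  refine ⟨max M ‖a 0 0 0 0‖, X, le_max_of_le_left hM, hX, fun p ℓ m hℓ hm τ hτ => ?_⟩
  rcases Nat.eq_zero_or_pos p with rfl | hp
  · obtain rfl : ℓ = 0 := Nat.le_zero.1 hℓ
    obtain rfl : m = 0 := by simpa using hm
    rw [monopole_modes hρ₀ hΦ hφ 0 hτ]
    simp
  · refine (hb p ℓ m hp hℓ hm τ hτ).trans ?_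
    gcongr
    exact le_max_left _ _

lemma ModesBounded.pos {ρ₀ : ℝ} (hρ₀ : 0 < ρ₀) {a : ℕ → ℕ → ℤ → ℝ → ℂ} {M X : ℝ}
    (h : ModesBounded ρ₀ a M X) : 0 < X :=
  lt_of_lt_of_le (by positivity) h.2.1

lemma abs_lt_of_null {u v : ℝ} (hu : u < 0) (hv : 0 < v) : |(u + v) / 2| < (v - u) / 2 :=
  abs_lt.2 ⟨by linarith, by linarith⟩

lemma rho_of_null {u v : ℝ} (hu : u < 0) (hv : 0 < v) :
    (v - u) / 2 / (((v - u) / 2) ^ 2 - ((u + v) / 2) ^ 2) = (v⁻¹ + (-u)⁻¹) / 2 := by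
  have h1 : ((v - u) / 2) ^ 2 - ((u + v) / 2) ^ 2 = v * -u := by ring
  have h2 : u ≠ 0 := hu.ne
  rw [h1, inv_neg]
  field_simp
  ring

lemma ModesBounded.rho_le {ρ₀ : ℝ} (hρ₀ : 0 < ρ₀) {a : ℕ → ℕ → ℤ → ℝ → ℂ} {M X : ℝ}
    (h : ModesBounded ρ₀ a M X) {x : ℝ} (hx : 96 * X * x ≤ 1) : x ≤ ρ₀ / 192 := by
  have hX := h.pos hρ₀
  have h2 : 2 ≤ X * ρ₀ := (div_le_iff₀ hρ₀).1 h.2.1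
  by_contra! hlt
  have h3 : 96 * X * (ρ₀ / 192) < 96 * X * x := mul_lt_mul_of_pos_left hlt (by positivity)
  linarith

lemma ModesBounded.mem_coneRegion {ρ₀ : ℝ} (hρ₀ : 0 < ρ₀) {a : ℕ → ℕ → ℤ → ℝ → ℂ} {M X : ℝ}
    (h : ModesBounded ρ₀ a M X) {u v : ℝ} (hu : u < 0) (hv : 0 < v)
    (hX : 48 * X * (v⁻¹ + (-u)⁻¹) ≤ 1) : ((u + v) / 2, (v - u) / 2) ∈ coneRegion ρ₀ := by
  refine ⟨abs_lt_of_null hu hv, ?_⟩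
  simp only
  rw [rho_of_null hu hv]
  exact (h.rho_le hρ₀ (by linarith)).trans_lt (by linarith)

/-- The remainders of the expansion of the good field. -/
lemma ModesBounded.norm_expansion_sub_le {ρ₀ : ℝ} (hρ₀ : 0 < ρ₀) {a : ℕ → ℕ → ℤ → ℝ → ℂ}
    {Φ : Spacetime → ℂ} (hΦ : HasCylinderExpansion ρ₀ a Φ) {M X : ℝ} (h : ModesBounded ρ₀ a M X)
    {u v : ℝ} (hu : u < 0) (hv : 0 < v) (hX : 48 * X * (v⁻¹ + (-u)⁻¹) ≤ 1) {n : Space}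
    (hn : n ∈ unitSphere) (N : ℕ) :
    ‖(((v - u) / 2 : ℝ) : ℂ) * Φ ((u + v) / 2, ((v - u) / 2) • n)
      - ∑ p ∈ Finset.range N, ((((v⁻¹ + (-u)⁻¹) / 2) ^ p / (p.factorial : ℝ) : ℝ) : ℂ)
        * modeSum a p ((u + v) / 2 / ((v - u) / 2)) n‖
      ≤ 2 * M * (24 * X * (v⁻¹ + (-u)⁻¹)) ^ N := by
  have hs := hasSum_expansion hΦ (h.mem_coneRegion hρ₀ hu hv hX) hn
  have hXp := h.pos hρ₀
  have hu' : 0 < -u := by linarith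
  rw [rho_of_null hu hv] at hs
  have := norm_sub_sum_range_le hs (y := 48 * X * ((v⁻¹ + (-u)⁻¹) / 2)) h.1 (by positivity)
    (by linarith) (fun p => norm_expansion_term_le h.1 hXp.le (by positivity)
      (fun ℓ m hℓ hm => h.2.2 p ℓ m hℓ hm _ (abs_lt.1 (abs_div_lt_one (abs_lt_of_null hu hv)))) hn) N
  refine this.trans_eq ?_
  ring

/-- A function on an incoming null ray that vanishes at past null infinity. -/
lemma norm_le_of_incoming {f f' : ℝ → ℂ} {u v C : ℝ} (huv : u < v)
    (hf : ∀ s ≤ u, HasDerivAt f (f' s) s) (hb : ∀ s ≤ u, ‖f' s‖ ≤ 2 * C / (v - s) ^ 2)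
    (hlim : Tendsto f atBot (𝓝 0)) : ‖f u‖ ≤ C / ((v - u) / 2) := by
  have hC : 0 ≤ C := by
    have h1 := (norm_nonneg _).trans (hb u le_rfl)
    have h2 : 0 < (v - u) ^ 2 := pow_pos (by linarith) 2
    rw [le_div_iff₀ h2] at h1
    linarith
  have key : ∀ u₀ ≤ u, ‖f u - f u₀‖ ≤ C / ((v - u) / 2) := by
    intro u₀ hu₀
    -- A primitive of the bound on the derivative. Its value at `u` is at most `2C/(v-u) = C/r`
    -- whatever `u₀` is, so `u₀ → -∞` is harmless.
    have hB : ∀ s ≤ u, HasDerivAt (fun s : ℝ => 2 * C / (v - s) - 2 * C / (v - u₀))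
        (2 * C / (v - s) ^ 2) s := by
      intro s hs
      have h1 : HasDerivAt (fun s : ℝ => v - s) (-1) s := (hasDerivAt_id s).const_sub v
      have h2 := (h1.fun_inv (by linarith)).const_mul (2 * C)
      simp only [← div_eq_mul_inv] at h2
      refine (h2.sub_const _).congr_deriv ?_
      ring
    have := image_norm_le_of_norm_deriv_right_le_deriv_boundary' (f := fun s => f s - f u₀)
      (f' := f') (a := u₀) (b := u) (B := fun s => 2 * C / (v - s) - 2 * C / (v - u₀))
      (B' := fun s => 2 * C / (v - s) ^ 2)
      (fun s hs => ((hf s hs.2).sub_const _).continuousAt.continuousWithinAt)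
      (fun s hs => ((hf s hs.2.le).sub_const _).hasDerivWithinAt) (by simp)
      (fun s hs => (hB s hs.2).continuousAt.continuousWithinAt)
      (fun s hs => (hB s hs.2.le).hasDerivWithinAt) (fun s hs => hb s hs.2.le)
      (right_mem_Icc.2 hu₀)
    have h1 : 0 ≤ 2 * C / (v - u₀) := div_nonneg (by linarith) (by linarith)
    calc _ ≤ _ := this
      _ ≤ 2 * C / (v - u) := by linarith
      _ = _ := by rw [div_div_eq_mul_div, mul_comm]
  have h1 : Tendsto (fun u₀ => ‖f u - f u₀‖) atBot (𝓝 ‖f u‖) := by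
    simpa using (hlim.const_sub (f u)).norm
  exact le_of_tendsto h1 ((eventually_le_atBot u).mono key)

/-- At constant `v`, `∂_u = (∂_t - ∂_r)/2`, and `Φ/(2r)` is written through `rΦ` because that is the
quantity with an expansion. -/
lemma hasDerivAt_incoming {ρ₀ : ℝ} {Φ φ : Spacetime → ℂ} (hφ : IsUglyBuiltFrom ρ₀ Φ φ) {u v : ℝ}
    (h : ((u + v) / 2, (v - u) / 2) ∈ coneRegion ρ₀) {n : Space} (hn : n ∈ unitSphere) :
    HasDerivAt (fun u : ℝ => φ ((u + v) / 2, ((v - u) / 2) • n))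
      (2 * ((((v - u) / 2 : ℝ) : ℂ) * Φ ((u + v) / 2, ((v - u) / 2) • n)) / (((v - u) ^ 2 : ℝ) : ℂ))
      u := by
  have hpos := coneRegion_pos h
  have hmem := mem_nearCylinder h hn
  have hd : DifferentiableAt ℝ φ ((u + v) / 2, ((v - u) / 2) • n) :=
    (hφ.contDiffOn_ugly.contDiffAt ((isOpen_nearCylinder ρ₀).mem_nhds hmem)).differentiableAt
      two_ne_zero
  have hline : HasDerivAt (fun u : ℝ => (((u + v) / 2, ((v - u) / 2) • n) : Spacetime))
      (1 / 2, (-1 / 2 : ℝ) • n) u :=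
    (((hasDerivAt_id u).add_const v).div_const 2).prodMk
      ((((hasDerivAt_id u).const_sub v).div_const 2).smul_const n)
  refine (hd.hasFDerivAt.comp_hasDerivAt u hline).congr_deriv ?_
  have e1 : ((1 / 2, (-1 / 2 : ℝ) • n) : Spacetime) = (1 / 2 : ℝ) • ((1, 0) - (0, n)) := by
    ext1
    · simp
    · simp [neg_div, neg_smul]
  have hne : ((v - u : ℝ) : ℂ) ≠ 0 := by
    have : v - u ≠ 0 := by linarith
    exact_mod_cast this
  rw [hφ.auxiliary _ hmem, e1, map_smul, map_sub]
  simp only [incomingDeriv, timeDeriv, radialDeriv, norm_smul_unit hpos hn,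
    direction_smul hpos (show ‖n‖ = 1 by simpa using hn), Complex.real_smul]
  push_cast at hne ⊢
  field_simp

lemma two_mul_div_sq_norm_le {w : ℂ} {C x : ℝ} (hx : 0 < x) (h : ‖w‖ ≤ C) :
    ‖2 * w / ((x ^ 2 : ℝ) : ℂ)‖ ≤ 2 * C / x ^ 2 := by
  rw [norm_div, norm_mul, Complex.norm_real, Real.norm_of_nonneg (by positivity),
    Complex.norm_ofNat]
  gcongr

lemma inv_add_inv_neg_mono {u v s : ℝ} (hu : u < 0) (hs : s ≤ u) :
    v⁻¹ + (-s)⁻¹ ≤ v⁻¹ + (-u)⁻¹ := by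
  have : (-s)⁻¹ ≤ (-u)⁻¹ := inv_anti₀ (by linarith) (by linarith)
  linarith

lemma ModesBounded.tendsto_ugly {ρ₀ : ℝ} (hρ₀ : 0 < ρ₀) {a : ℕ → ℕ → ℤ → ℝ → ℂ}
    {Φ φ : Spacetime → ℂ} (hφ : IsUglyBuiltFrom ρ₀ Φ φ) {M X : ℝ} (h : ModesBounded ρ₀ a M X)
    {u v : ℝ} (hu : u < 0) (hv : 0 < v) (hX : 48 * X * (v⁻¹ + (-u)⁻¹) ≤ 1) {n : Space}
    (hn : n ∈ unitSphere) :
    Tendsto (fun u : ℝ => φ ((u + v) / 2, ((v - u) / 2) • n)) atBot (𝓝 0) := by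
  refine hφ.pastNull v ?_ n (by simpa using hn)
  have hXp := h.pos hρ₀
  have h0 : 0 ≤ X * (-u)⁻¹ := mul_nonneg hXp.le (inv_nonneg.2 (by linarith))
  have h1 := h.rho_le hρ₀ (x := v⁻¹ / 2) (by linarith)
  have h2 : v⁻¹ < 2 * ρ₀ := by linarith
  rw [one_div]
  exact inv_lt_of_inv_lt₀ hv h2

/-- The ugly field is bounded by `1 / r`. -/
lemma ModesBounded.norm_ugly_le {ρ₀ : ℝ} (hρ₀ : 0 < ρ₀) {a : ℕ → ℕ → ℤ → ℝ → ℂ}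
    {Φ φ : Spacetime → ℂ} (hΦ : HasCylinderExpansion ρ₀ a Φ) (hφ : IsUglyBuiltFrom ρ₀ Φ φ) {M X : ℝ}
    (h : ModesBounded ρ₀ a M X) {u v : ℝ} (hu : u < 0) (hv : 0 < v)
    (hX : 48 * X * (v⁻¹ + (-u)⁻¹) ≤ 1) {n : Space} (hn : n ∈ unitSphere) :
    ‖φ ((u + v) / 2, ((v - u) / 2) • n)‖ ≤ 2 * M / ((v - u) / 2) := by
  have hXs : ∀ s ≤ u, 48 * X * (v⁻¹ + (-s)⁻¹) ≤ 1 := fun s hs =>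
    (mul_le_mul_of_nonneg_left (inv_add_inv_neg_mono hu hs)
      (by linarith [h.pos hρ₀])).trans hX
  refine norm_le_of_incoming (by linarith) (fun s hs => hasDerivAt_incoming hφ
    (h.mem_coneRegion hρ₀ (hs.trans_lt hu) hv (hXs s hs)) hn) (fun s hs => ?_)
    (h.tendsto_ugly hρ₀ hφ hu hv hX hn)
  refine two_mul_div_sq_norm_le (by linarith) ?_
  -- With no terms subtracted, the remainder estimate is the bound `‖rΦ‖ ≤ 2M`.
  simpa using h.norm_expansion_sub_le hρ₀ hΦ (hs.trans_lt hu) hv (hXs s hs) hn 0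

/-! ## The dipole -/

/-- The odd solution of the equation of the modes `a_{1;1,m}`, which is
`(1-τ²) ∫₀^τ ds/(1-s²)²`. -/
def dipoleSol (τ : ℝ) : ℝ :=
  τ / 2 + ((1 - τ) * ((1 + τ) * Real.log (1 + τ)) - (1 + τ) * ((1 - τ) * Real.log (1 - τ))) / 4

/-- The logarithms are grouped as `x log x`, which is continuous at `0`; this gives continuity up to
`τ = ±1`, where the value is needed. -/
lemma continuous_dipoleSol : Continuous dipoleSol := by
  have h1 : Continuous fun τ : ℝ => (1 + τ) * Real.log (1 + τ) :=
    Real.continuous_mul_log.comp (continuous_const.add continuous_id)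
  have h2 : Continuous fun τ : ℝ => (1 - τ) * Real.log (1 - τ) :=
    Real.continuous_mul_log.comp (continuous_const.sub continuous_id)
  unfold dipoleSol
  fun_prop

lemma dipoleSol_zero : dipoleSol 0 = 0 := by simp [dipoleSol]

lemma dipoleSol_neg_one : dipoleSol (-1) = -1 / 2 := by simp [dipoleSol]

lemma hasDerivAt_dipoleSol {τ : ℝ} (hτ : τ ∈ Ioo (-1 : ℝ) 1) :
    HasDerivAt dipoleSol (1 - τ / 2 * (Real.log (1 + τ) - Real.log (1 - τ))) τ := by
  have hp : 1 + τ ≠ 0 := by linarith [hτ.1]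
  have hm : 1 - τ ≠ 0 := by linarith [hτ.2]
  have h1 : HasDerivAt (fun τ : ℝ => 1 + τ) 1 τ := (hasDerivAt_id τ).const_add 1
  have h2 : HasDerivAt (fun τ : ℝ => 1 - τ) (-1) τ := (hasDerivAt_id τ).const_sub 1
  refine (((hasDerivAt_id τ).div_const 2).add (((h2.mul (h1.mul (h1.log hp))).sub
    (h1.mul (h2.mul (h2.log hm)))).div_const 4)).congr_deriv ?_
  simp only [Pi.mul_apply]
  field_simp
  ring

/-- The modes `a_{1;1,m}`. -/
lemma dipole_modes {ρ₀ : ℝ} (hρ₀ : 0 < ρ₀) {a : ℕ → ℕ → ℤ → ℝ → ℂ} {Φ φ : Spacetime → ℂ}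
    (hΦ : HasCylinderExpansion ρ₀ a Φ) (hφ : IsUglyBuiltFrom ρ₀ Φ φ) {m : ℤ} (hm : |m| ≤ 1) {τ : ℝ}
    (hτ : τ ∈ Ioo (-1 : ℝ) 1) :
    a 1 1 m τ = ((1 - τ ^ 2 : ℝ) : ℂ) * a 1 1 m 0 + deriv (a 1 1 m) 0 * dipoleSol τ := by
  have hm' : |m| ≤ ((1 : ℕ) : ℤ) := by simpa using hm
  have hpos : ∀ s ∈ Ioo (-1 : ℝ) 1, ((1 - s ^ 2 : ℝ) : ℂ) ≠ 0 := fun s hs => by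
    have : 1 - s ^ 2 ≠ 0 := by nlinarith [hs.1, hs.2]
    exact_mod_cast this
  have h0 : (0 : ℝ) ∈ Ioo (-1 : ℝ) 1 := by norm_num
  have hd0 : ∀ s ∈ Ioo (-1 : ℝ) 1, HasDerivAt (a 1 1 m) (deriv (a 1 1 m) s) s := fun s hs => by
    simpa using hasDerivAt_mode hΦ.1 le_rfl hm' (k := 0) (by norm_num) hs
  have hd1 : ∀ s ∈ Ioo (-1 : ℝ) 1,
      HasDerivAt (deriv (a 1 1 m)) (iteratedDeriv 2 (a 1 1 m) s) s := fun s hs => by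
    simpa using hasDerivAt_mode hΦ.1 le_rfl hm' (k := 1) le_rfl hs
  have hq : ∀ s : ℝ, HasDerivAt (fun s : ℝ => ((1 - s ^ 2 : ℝ) : ℂ)) ((-(2 * s) : ℝ) : ℂ) s := by
    intro s
    have : HasDerivAt (fun s : ℝ => 1 - s ^ 2) (-(2 * s)) s := by
      simpa using ((hasDerivAt_id s).fun_pow 2).const_sub 1
    exact this.ofReal_comp
  have hs2 : ∀ s : ℝ, HasDerivAt (fun s : ℝ => ((2 * s : ℝ) : ℂ)) ((2 : ℝ) : ℂ) s := by
    intro s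
    have : HasDerivAt (fun s : ℝ => 2 * s) 2 s := by simpa using (hasDerivAt_id s).const_mul 2
    exact this.ofReal_comp
  -- The Wronskian with the solution `1 - s²` is constant. For `dipoleSol` it equals `1`, so
  -- subtracting the right multiple leaves a multiple of `1 - s²`.
  have hW : ∀ s ∈ Ioo (-1 : ℝ) 1, ((1 - s ^ 2 : ℝ) : ℂ) * deriv (a 1 1 m) s
      + ((2 * s : ℝ) : ℂ) * a 1 1 m s = deriv (a 1 1 m) 0 := by
    have hd : ∀ s ∈ Ioo (-1 : ℝ) 1, HasDerivAt (fun s : ℝ => ((1 - s ^ 2 : ℝ) : ℂ)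
        * deriv (a 1 1 m) s + ((2 * s : ℝ) : ℂ) * a 1 1 m s) 0 s := by
      intro s hs
      refine (((hq s).mul (hd1 s hs)).add ((hs2 s).mul (hd0 s hs))).congr_deriv ?_
      have h := mode_equation hρ₀ hΦ hφ.contDiffOn_good hφ.good le_rfl hm' hs
      push_cast at h ⊢
      linear_combination h
    intro s hs
    have := isOpen_Ioo.is_const_of_deriv_eq_zero isPreconnected_Ioo
      (fun s hs => (hd s hs).differentiableAt.differentiableWithinAt) (fun s hs => (hd s hs).deriv)
      hs h0
    simpa using this
  have hd : ∀ s ∈ Ioo (-1 : ℝ) 1, HasDerivAt (fun s : ℝ =>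
      (a 1 1 m s - deriv (a 1 1 m) 0 * dipoleSol s) / ((1 - s ^ 2 : ℝ) : ℂ)) 0 s := by
    intro s hs
    refine (((hd0 s hs).sub ((hasDerivAt_dipoleSol hs).ofReal_comp.const_mul
      (deriv (a 1 1 m) 0))).div (hq s) (hpos s hs)).congr_deriv ?_
    have h := hW s hs
    refine div_eq_zero_iff.2 (Or.inl ?_)
    simp only [Pi.sub_apply, dipoleSol]
    push_cast at h ⊢
    linear_combination h
  have := isOpen_Ioo.is_const_of_deriv_eq_zero isPreconnected_Ioo
    (fun s hs => (hd s hs).differentiableAt.differentiableWithinAt) (fun s hs => (hd s hs).deriv)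
    hτ h0
  rw [div_eq_iff (hpos τ hτ)] at this
  simp only [dipoleSol_zero] at this
  push_cast at this ⊢
  linear_combination this

/-- The dipole of the good field has the same limit at past null infinity on all rays. -/
lemma ModesBounded.norm_dipole_outgoing_le {ρ₀ : ℝ} (hρ₀ : 0 < ρ₀) {a : ℕ → ℕ → ℤ → ℝ → ℂ}
    {Φ φ : Spacetime → ℂ} (hΦ : HasCylinderExpansion ρ₀ a Φ) (hφ : IsUglyBuiltFrom ρ₀ Φ φ) {M X : ℝ}
    (h : ModesBounded ρ₀ a M X) {m : ℤ} (hm : |m| ≤ 1) {v : ℝ} (hv : 96 * X ≤ v) :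
    ∃ C : ℝ, ∀ u ≤ -(96 * X),
      ‖(((2 * v - u) / 2 : ℝ) : ℂ) * sphMode 1 m Φ ((u + 2 * v) / 2) ((2 * v - u) / 2)
        - (((v - u) / 2 : ℝ) : ℂ) * sphMode 1 m Φ ((u + v) / 2) ((v - u) / 2)‖ ≤ C / (v - u) := by
  have hXp := h.pos hρ₀
  have hm' : |m| ≤ ((1 : ℕ) : ℤ) := by simpa using hm
  -- The factor `ℓ(ℓ+1) = 2` times the bound for the projected ugly field, times the parameter
  -- length `v/2` of the outgoing segment from `v` to `2v`. The dependence on `v` does no harm,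
  -- since only `u → -∞` is taken.
  refine ⟨2 * (2 * M * 2 * 8 * sphereMeasure.real univ) / ‖sphNormSq 1 m‖ * (v / 2), fun u hu => ?_⟩
  have hv0 : 0 < v := by linarith
  have hu0 : u < 0 := by linarith
  have hcond : ∀ w, v ≤ w → 48 * X * (w⁻¹ + (-u)⁻¹) ≤ 1 := by
    intro w hw
    have h1 : w⁻¹ ≤ (96 * X)⁻¹ := inv_anti₀ (by positivity) (by linarith)
    have h2 : (-u)⁻¹ ≤ (96 * X)⁻¹ := inv_anti₀ (by positivity) (by linarith)
    calc _ ≤ 48 * X * ((96 * X)⁻¹ + (96 * X)⁻¹) := by gcongr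
      _ = 1 := by field_simp; norm_num
  have hmem : ∀ s ∈ Icc (0 : ℝ) (v / 2), ((u + v) / 2 + s, (v - u) / 2 + s) ∈ coneRegion ρ₀ := by
    intro s hs
    have := h.mem_coneRegion hρ₀ hu0 (v := v + 2 * s) (by linarith [hs.1])
      (hcond _ (by linarith [hs.1]))
    convert this using 2 <;> ring
  have hd : ∀ s ∈ Icc (0 : ℝ) (v / 2), HasDerivWithinAt (fun s : ℝ => (((v - u) / 2 + s : ℝ) : ℂ)
      * sphProj 1 m Φ ((u + v) / 2 + s) ((v - u) / 2 + s))
      (-(((1 : ℕ) : ℂ) * (((1 : ℕ) : ℂ) + 1)) * sphProj 1 m φ ((u + v) / 2 + s) ((v - u) / 2 + s))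
      (Icc (0 : ℝ) (v / 2)) s := fun s hs =>
    (hasDerivAt_sphProj_good hφ 1 m (hmem s hs)).hasDerivWithinAt
  have hb : ∀ s ∈ Icc (0 : ℝ) (v / 2),
      ‖-(((1 : ℕ) : ℂ) * (((1 : ℕ) : ℂ) + 1)) * sphProj 1 m φ ((u + v) / 2 + s) ((v - u) / 2 + s)‖
        ≤ 2 * (2 * M * 2 * 8 * sphereMeasure.real univ) / (v - u) := by
    intro s hs
    have hM := h.1
    have hvu : 0 < v - u := by linarith
    have hp : ‖sphProj 1 m φ ((u + v) / 2 + s) ((v - u) / 2 + s)‖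
        ≤ 2 * M / ((v - u) / 2) * 8 * sphereMeasure.real univ := by
      refine norm_integral_sphere_le fun n hn => ?_
      have h1 := h.norm_ugly_le hρ₀ hΦ hφ hu0 (v := v + 2 * s) (by linarith [hs.1])
        (hcond _ (by linarith [hs.1])) hn
      have e1 : (u + (v + 2 * s)) / 2 = (u + v) / 2 + s := by ring
      have e2 : (v + 2 * s - u) / 2 = (v - u) / 2 + s := by ring
      rw [e1, e2] at h1
      rw [norm_mul]
      refine mul_le_mul (h1.trans ?_) ?_ (norm_nonneg _) (by positivity)
      · have := hs.1
        gcongr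
        linarith
      · rw [sphHarmConj, Complex.norm_conj]
        simpa using norm_sphHarm_le hm' hn
    rw [norm_mul]
    calc _ = 2 * ‖sphProj 1 m φ ((u + v) / 2 + s) ((v - u) / 2 + s)‖ := by norm_num
      _ ≤ 2 * (2 * M / ((v - u) / 2) * 8 * sphereMeasure.real univ) := by gcongr
      _ = _ := by
        field_simp
  have hmv := (convex_Icc (0 : ℝ) (v / 2)).norm_image_sub_le_of_norm_hasDerivWithin_le hd hb
    (left_mem_Icc.2 (by positivity)) (right_mem_Icc.2 (by positivity))
  have e1 : (u + v) / 2 + v / 2 = (u + 2 * v) / 2 := by ring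
  have e2 : (v - u) / 2 + v / 2 = (2 * v - u) / 2 := by ring
  rw [add_zero, add_zero, e1, e2, sub_zero, Real.norm_of_nonneg (by positivity)] at hmv
  have hne : 0 < ‖sphNormSq 1 m‖ := norm_pos_iff.2 (sphNormSq_ne_zero hm')
  simp only [sphMode]
  rw [← mul_div_assoc, ← mul_div_assoc, ← sub_div, norm_div, div_le_iff₀ hne]
  refine hmv.trans_eq ?_
  field_simp

/-- The dipole of the good field, up to the second order in `ρ`. -/
lemma ModesBounded.norm_dipole_sub_le {ρ₀ : ℝ} (hρ₀ : 0 < ρ₀) {a : ℕ → ℕ → ℤ → ℝ → ℂ}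
    {Φ : Spacetime → ℂ} (hΦ : HasCylinderExpansion ρ₀ a Φ) {M X : ℝ}
    (h : ModesBounded ρ₀ a M X) {m : ℤ} (hm : |m| ≤ 1) {u v : ℝ} (hu : u < 0) (hv : 0 < v)
    (hX : 48 * X * (v⁻¹ + (-u)⁻¹) ≤ 1) :
    ‖(((v - u) / 2 : ℝ) : ℂ) * sphMode 1 m Φ ((u + v) / 2) ((v - u) / 2)
      - a 1 1 m ((u + v) / 2 / ((v - u) / 2)) * (((v⁻¹ + (-u)⁻¹) / 2 : ℝ) : ℂ)‖
      ≤ 2 * M * (X * ((v⁻¹ + (-u)⁻¹) / 2)) ^ 2 := by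
  have hXp := h.pos hρ₀
  have hm' : |m| ≤ ((1 : ℕ) : ℤ) := by simpa using hm
  have hu' : 0 < -u := by linarith
  have hτ := abs_lt.1 (abs_div_lt_one (abs_lt_of_null hu hv))
  have hs := hasSum_sphMode hρ₀ hΦ hm' (abs_lt_of_null hu hv)
    (by rw [rho_of_null hu hv]; exact h.rho_le hρ₀ (by linarith))
  rw [rho_of_null hu hv] at hs
  have hx : 0 < v⁻¹ + (-u)⁻¹ := by positivity
  have := norm_sub_sum_range_le hs (M := M) (y := X * ((v⁻¹ + (-u)⁻¹) / 2)) h.1 (by positivity)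
    (by nlinarith [mul_pos hXp hx]) (fun p => ?_) 2
  · simpa [Finset.sum_range_succ, modeCoeff] using this
  · have hM := h.1
    rw [norm_mul, norm_pow, Complex.norm_real, Real.norm_of_nonneg (by positivity), mul_pow,
      ← mul_assoc]
    refine mul_le_mul_of_nonneg_right ?_ (by positivity)
    unfold modeCoeff
    split_ifs with hp
    · have hp0 : (0 : ℝ) < p.factorial := by exact_mod_cast Nat.factorial_pos p
      rw [norm_div, Complex.norm_natCast, div_le_iff₀ hp0, iteratedDeriv_zero]
      refine (h.2.2 p 1 m hp hm' _ hτ).trans_eq ?_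
      ring
    · rw [norm_zero]
      positivity

lemma tendsto_tau_atBot (v : ℝ) :
    Tendsto (fun u : ℝ => (u + v) / 2 / ((v - u) / 2)) atBot (𝓝 (-1)) := by
  have h1 : Tendsto (fun u : ℝ => 2 * v / (v - u) - 1) atBot (𝓝 (0 - 1)) :=
    ((tendsto_const_nhds).div_atTop
      (tendsto_atTop_add_const_left _ v tendsto_neg_atBot_atTop)).sub_const 1
  rw [zero_sub] at h1
  refine h1.congr' ?_
  filter_upwards [eventually_lt_atBot v] with u hu
  have : v - u ≠ 0 := by linarith
  field_simp
  ring

/-- The integral of the good field from past null infinity excludes the odd dipole. -/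
lemma deriv_dipole {ρ₀ : ℝ} (hρ₀ : 0 < ρ₀) {a : ℕ → ℕ → ℤ → ℝ → ℂ} {Φ φ : Spacetime → ℂ}
    (hΦ : HasCylinderExpansion ρ₀ a Φ) (hφ : IsUglyBuiltFrom ρ₀ Φ φ) {m : ℤ} (hm : |m| ≤ 1) :
    deriv (a 1 1 m) 0 = 0 := by
  obtain ⟨M, X, h⟩ := exists_modesBounded hρ₀ hΦ hφ
  have hXp := h.pos hρ₀
  -- The limit of `a_{1;1,m}` at `τ = -1`, to which the even solution `1 - τ²` does not contribute.
  set α : ℂ := deriv (a 1 1 m) 0 * (dipoleSol (-1) : ℝ) with hα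
  have hinv : Tendsto (fun u : ℝ => (-u)⁻¹) atBot (𝓝 0) :=
    tendsto_inv_atTop_zero.comp tendsto_neg_atBot_atTop
  have hx : ∀ v : ℝ, Tendsto (fun u : ℝ => (v⁻¹ + (-u)⁻¹) / 2) atBot (𝓝 (v⁻¹ / 2)) := fun v => by
    simpa using (hinv.const_add v⁻¹).div_const 2
  have ha : ∀ v : ℝ, 0 < v → Tendsto (fun u : ℝ => a 1 1 m ((u + v) / 2 / ((v - u) / 2))) atBot
      (𝓝 α) := by
    intro v hv
    have hc : Continuous fun τ : ℝ =>
        ((1 - τ ^ 2 : ℝ) : ℂ) * a 1 1 m 0 + deriv (a 1 1 m) 0 * dipoleSol τ := by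
      have := continuous_dipoleSol
      fun_prop
    have h1 := (hc.tendsto (-1)).comp (tendsto_tau_atBot v)
    have h2 : ((1 - (-1) ^ 2 : ℝ) : ℂ) * a 1 1 m 0 + deriv (a 1 1 m) 0 * dipoleSol (-1) = α := by
      simp [hα]
    rw [h2] at h1
    refine h1.congr' ?_
    filter_upwards [eventually_lt_atBot 0] with u hu
    exact (dipole_modes hρ₀ hΦ hφ hm (abs_lt.1 (abs_div_lt_one (abs_lt_of_null hu hv)))).symm
  -- At `u = -∞` one has `ρ = 1/(2v)`. The leading terms at `v` and `2v` differ by `α/(4v)`, while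
  -- both remainders are quadratic in `1/v`.
  have key : ∀ v : ℝ, 96 * X ≤ v → ‖α‖ ≤ 4 * M * X ^ 2 / v := by
    intro v hv
    have hv0 : 0 < v := by linarith
    obtain ⟨C, hC⟩ := h.norm_dipole_outgoing_le hρ₀ hΦ hφ hm hv
    have hlim : Tendsto (fun u : ℝ => ‖a 1 1 m ((u + 2 * v) / 2 / ((2 * v - u) / 2))
        * ((((2 * v)⁻¹ + (-u)⁻¹) / 2 : ℝ) : ℂ)
        - a 1 1 m ((u + v) / 2 / ((v - u) / 2)) * (((v⁻¹ + (-u)⁻¹) / 2 : ℝ) : ℂ)‖) atBot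
        (𝓝 ‖α * (((2 * v)⁻¹ / 2 : ℝ) : ℂ) - α * ((v⁻¹ / 2 : ℝ) : ℂ)‖) :=
      (((ha (2 * v) (by positivity)).mul (Complex.continuous_ofReal.tendsto _ |>.comp
        (hx (2 * v)))).sub ((ha v hv0).mul (Complex.continuous_ofReal.tendsto _ |>.comp
        (hx v)))).norm
    have hlim2 : Tendsto (fun u : ℝ => 2 * M * (X * (((2 * v)⁻¹ + (-u)⁻¹) / 2)) ^ 2 + C / (v - u)
        + 2 * M * (X * ((v⁻¹ + (-u)⁻¹) / 2)) ^ 2) atBot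
        (𝓝 (2 * M * (X * ((2 * v)⁻¹ / 2)) ^ 2 + 0 + 2 * M * (X * (v⁻¹ / 2)) ^ 2)) :=
      (((((hx (2 * v)).const_mul X).pow 2).const_mul (2 * M)).add
        (tendsto_const_nhds.div_atTop
          (tendsto_atTop_add_const_left _ v tendsto_neg_atBot_atTop))).add
        ((((hx v).const_mul X).pow 2).const_mul (2 * M))
    have hle := le_of_tendsto_of_tendsto hlim hlim2 ?_
    · have e1 : α * (((2 * v)⁻¹ / 2 : ℝ) : ℂ) - α * ((v⁻¹ / 2 : ℝ) : ℂ)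
          = -(α * ((v⁻¹ / 4 : ℝ) : ℂ)) := by
        push_cast
        rw [mul_inv]
        ring
      rw [e1, norm_neg, norm_mul, Complex.norm_real, Real.norm_of_nonneg (by positivity),
        mul_inv] at hle
      have h2 : ‖α‖ * (v⁻¹ / 4) ≤ M * X ^ 2 / v * (v⁻¹) := by
        refine hle.trans ?_
        have : 0 ≤ M * X ^ 2 * (v⁻¹) ^ 2 := mul_nonneg (mul_nonneg h.1 (sq_nonneg X)) (sq_nonneg _)
        have e2 : M * X ^ 2 / v * v⁻¹ = M * X ^ 2 * (v⁻¹) ^ 2 := by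
          rw [div_eq_mul_inv]
          ring
        rw [e2]
        linarith
      have h3 : 0 < v⁻¹ := by positivity
      have h4 : ‖α‖ * v⁻¹ ≤ 4 * M * X ^ 2 / v * v⁻¹ := by
        calc _ = 4 * (‖α‖ * (v⁻¹ / 4)) := by ring
          _ ≤ 4 * (M * X ^ 2 / v * (v⁻¹)) := by linarith
          _ = _ := by ring
      exact le_of_mul_le_mul_right h4 h3
    · filter_upwards [eventually_le_atBot (-(96 * X))] with u hu
      have hu0 : u < 0 := by linarith
      have hcond : ∀ w, v ≤ w → 48 * X * (w⁻¹ + (-u)⁻¹) ≤ 1 := by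
        intro w hw
        have h1 : w⁻¹ ≤ (96 * X)⁻¹ := inv_anti₀ (by positivity) (by linarith)
        have h2 : (-u)⁻¹ ≤ (96 * X)⁻¹ := inv_anti₀ (by positivity) (by linarith)
        calc _ ≤ 48 * X * ((96 * X)⁻¹ + (96 * X)⁻¹) := by gcongr
          _ = 1 := by field_simp; norm_num
      have h1 := h.norm_dipole_sub_le hρ₀ hΦ hm hu0 hv0 (hcond v le_rfl)
      have h2 := h.norm_dipole_sub_le hρ₀ hΦ hm hu0 (v := 2 * v) (by positivity)
        (hcond _ (by linarith))
      have h3 := hC u hu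
      rw [norm_sub_rev] at h2
      have h4 := norm_add₃_le.trans (add_le_add (add_le_add h2 h3) h1)
      refine le_trans (le_of_eq ?_) h4
      congr 1
      ring
  have hα0 : ‖α‖ ≤ 0 :=
    ge_of_tendsto (tendsto_const_nhds.div_atTop tendsto_id) ((eventually_ge_atTop (96 * X)).mono key)
  have hα1 : α = 0 := norm_le_zero_iff.1 hα0
  rw [hα, dipoleSol_neg_one] at hα1
  refine (mul_eq_zero.1 hα1).resolve_right ?_
  norm_num

/-! ## The expansion of the ugly field -/

/-- The explicit part of the expansion along an incoming null ray. -/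
lemma uglyExpansion_ray (a : ℕ → ℕ → ℤ → ℝ → ℂ) {u v : ℝ} (hu : u < 0) (hv : 0 < v) {n : Space}
    (hn : n ∈ unitSphere) :
    uglyExpansion a ((u + v) / 2, ((v - u) / 2) • n)
      = 2 * (constC a 0 0 * sphHarm 0 0 n) / ((v - u : ℝ) : ℂ)
        - constB100 a * sphHarm 0 0 n / v / ((v - u : ℝ) : ℂ)
        - constB100 a * sphHarm 0 0 n / v ^ 2 * (Real.log (-u / (v - u)) : ℂ)
        + (∑ m ∈ Finset.Icc (-1 : ℤ) 1, constC a 1 m * sphHarm 1 m n) / 2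
          / (((v - u) ^ 2 : ℝ) : ℂ) := by
  have hr : 0 < (v - u) / 2 := by linarith
  have e1 : (u + v) / 2 + (v - u) / 2 = v := by ring
  have e2 : (u + v) / 2 - (v - u) / 2 = u := by ring
  have e3 : 2 * ((v - u) / 2) = v - u := by ring
  have hne : ((v - u : ℝ) : ℂ) ≠ 0 := by
    have : v - u ≠ 0 := by linarith
    exact_mod_cast this
  have hvC : (v : ℂ) ≠ 0 := by exact_mod_cast hv.ne'
  simp only [uglyExpansion, advanced, retarded, norm_smul_unit hr hn,
    direction_smul hr (show ‖n‖ = 1 by simpa using hn), e1, e2, e3]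
  push_cast at hne ⊢
  field_simp
  ring

/-- The logarithm is produced by integrating `1/((-u)(v-u)²)` in partial fractions, and so only by
the `B₁₀₀` term. -/
lemma hasDerivAt_uglyExpansion_ray (c b d : ℂ) {u v : ℝ} (hu : u < 0) (hv : 0 < v) :
    HasDerivAt (fun u : ℝ => 2 * c / ((v - u : ℝ) : ℂ) - b / v / ((v - u : ℝ) : ℂ)
        - b / v ^ 2 * (Real.log (-u / (v - u)) : ℂ) + d / 2 / (((v - u) ^ 2 : ℝ) : ℂ))
      (2 * (c + b / (2 * ((-u : ℝ) : ℂ)) + d / (2 * ((v - u : ℝ) : ℂ))) / (((v - u) ^ 2 : ℝ) : ℂ))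
      u := by
  have hvu : v - u ≠ 0 := by linarith
  have hu' : -u ≠ 0 := by linarith
  have hvC : (v : ℂ) ≠ 0 := by exact_mod_cast hv.ne'
  have huC : (u : ℂ) ≠ 0 := by exact_mod_cast hu.ne
  have hvuC : (v : ℂ) - u ≠ 0 := by exact_mod_cast hvu
  have h1 : HasDerivAt (fun u : ℝ => v - u) (-1) u := (hasDerivAt_id u).const_sub v
  have h2 : HasDerivAt (fun u : ℝ => -u) (-1) u := hasDerivAt_neg u
  have hlog := (((h2.fun_div h1 hvu).log (div_ne_zero hu' hvu)).ofReal_comp).const_mul (b / v ^ 2)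
  have h3 : HasDerivAt (fun u : ℝ => ((v - u : ℝ) : ℂ)) ((-1 : ℝ) : ℂ) u := h1.ofReal_comp
  have h4 : HasDerivAt (fun u : ℝ => (((v - u) ^ 2 : ℝ) : ℂ)) _ u := (h1.fun_pow 2).ofReal_comp
  have hc : ∀ w : ℂ, HasDerivAt (fun _ : ℝ => w) 0 u := fun w => hasDerivAt_const u w
  have hne : ((v - u : ℝ) : ℂ) ≠ 0 := by exact_mod_cast hvu
  have hne2 : (((v - u) ^ 2 : ℝ) : ℂ) ≠ 0 := by exact_mod_cast pow_ne_zero 2 hvu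
  refine (((((hc (2 * c)).fun_div h3 hne).fun_sub ((hc (b / v)).fun_div h3 hne)).fun_sub
    hlog).fun_add ((hc (d / 2)).fun_div h4 hne2)).congr_deriv ?_
  push_cast
  field_simp
  ring

/-- This fixes the constant of integration: among the primitives, this one matches the condition at
past null infinity, as `-u/(v-u) → 1`. -/
lemma tendsto_uglyExpansion_ray (c b d : ℂ) (v : ℝ) :
    Tendsto (fun u : ℝ => 2 * c / ((v - u : ℝ) : ℂ) - b / v / ((v - u : ℝ) : ℂ)
        - b / v ^ 2 * (Real.log (-u / (v - u)) : ℂ) + d / 2 / (((v - u) ^ 2 : ℝ) : ℂ))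
      atBot (𝓝 0) := by
  have h0 : Tendsto (fun u : ℝ => v - u) atBot atTop :=
    tendsto_atTop_add_const_left _ v tendsto_neg_atBot_atTop
  have hdiv : ∀ (w : ℂ) {g : ℝ → ℝ}, Tendsto g atBot atTop →
      Tendsto (fun u => w / (g u : ℂ)) atBot (𝓝 0) := by
    intro w g hg
    have h1 := (Complex.continuous_ofReal.tendsto 0).comp (tendsto_inv_atTop_zero.comp hg)
    simpa [div_eq_mul_inv, Function.comp_def] using h1.const_mul w
  have hlog : Tendsto (fun u : ℝ => Real.log (-u / (v - u))) atBot (𝓝 0) := by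
    have h1 : Tendsto (fun u : ℝ => 1 - v / (v - u)) atBot (𝓝 (1 - 0)) :=
      (tendsto_const_nhds.div_atTop h0).const_sub 1
    rw [sub_zero] at h1
    have h2 : Tendsto (fun u : ℝ => -u / (v - u)) atBot (𝓝 1) := by
      refine h1.congr' ?_
      filter_upwards [eventually_lt_atBot v] with u hu
      have : v - u ≠ 0 := by linarith
      field_simp
      ring
    simpa using h2.log one_ne_zero
  have hlogC := ((Complex.continuous_ofReal.tendsto 0).comp hlog).const_mul (b / v ^ 2)
  simpa using (((hdiv (2 * c) h0).sub (hdiv (b / v) h0)).sub hlogC).add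
    (hdiv (d / 2) ((tendsto_pow_atTop two_ne_zero).comp h0))

/-- The first two terms of the expansion of the good field. -/
lemma sum_expansion_two {ρ₀ : ℝ} (hρ₀ : 0 < ρ₀) {a : ℕ → ℕ → ℤ → ℝ → ℂ} {Φ φ : Spacetime → ℂ}
    (hΦ : HasCylinderExpansion ρ₀ a Φ) (hφ : IsUglyBuiltFrom ρ₀ Φ φ) {u v : ℝ} (hu : u < 0)
    (hv : 0 < v) (n : Space) :
    ∑ p ∈ Finset.range 2, ((((v⁻¹ + (-u)⁻¹) / 2) ^ p / (p.factorial : ℝ) : ℝ) : ℂ)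
        * modeSum a p ((u + v) / 2 / ((v - u) / 2)) n
      = constC a 0 0 * sphHarm 0 0 n + constB100 a * sphHarm 0 0 n / (2 * ((-u : ℝ) : ℂ))
        + (∑ m ∈ Finset.Icc (-1 : ℤ) 1, constC a 1 m * sphHarm 1 m n)
          / (2 * ((v - u : ℝ) : ℂ)) := by
  have hτ := abs_lt.1 (abs_div_lt_one (abs_lt_of_null hu hv))
  have hdip : ∀ m ∈ Finset.Icc (-1 : ℤ) 1,
      a 1 1 m ((u + v) / 2 / ((v - u) / 2)) * sphHarm 1 m n
        = ((1 - ((u + v) / 2 / ((v - u) / 2)) ^ 2 : ℝ) : ℂ) / 4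
          * (constC a 1 m * sphHarm 1 m n) := by
    intro m hm
    have hm' : |m| ≤ 1 := abs_le.2 (Finset.mem_Icc.1 hm)
    rw [dipole_modes hρ₀ hΦ hφ hm' hτ, deriv_dipole hρ₀ hΦ hφ hm', constC]
    ring
  have hvC : (v : ℂ) ≠ 0 := by exact_mod_cast hv.ne'
  have huC : (u : ℂ) ≠ 0 := by exact_mod_cast hu.ne
  have hvuC : (v : ℂ) - u ≠ 0 := by
    have : v - u ≠ 0 := by linarith
    exact_mod_cast this
  simp only [Finset.sum_range_succ, Finset.sum_range_zero, modeSum, zero_add, Nat.cast_zero,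
    neg_zero, Finset.Icc_self, Finset.sum_singleton, Nat.cast_one]
  -- The rest is `ρ(1+τ) = 1/(-u)`, `ρ(1-τ²) = 2/(v-u)` and `B₁₀₀ = 2 a_{1;0,0}(0)`.
  rw [Finset.sum_congr rfl hdip, ← Finset.mul_sum, monopole_modes hρ₀ hΦ hφ 0 hτ,
    monopole_modes hρ₀ hΦ hφ 1 hτ, constB100, deriv_monopole hρ₀ hΦ hφ 1, constC]
  generalize (∑ m ∈ Finset.Icc (-1 : ℤ) 1, constC a 1 m * sphHarm 1 m n) = S
  simp only [Nat.factorial_zero, Nat.factorial_one, pow_zero, pow_one, mul_zero]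
  push_cast
  field_simp
  ring

/-- The error of the expansion. -/
lemma ModesBounded.norm_ugly_sub_le {ρ₀ : ℝ} (hρ₀ : 0 < ρ₀) {a : ℕ → ℕ → ℤ → ℝ → ℂ}
    {Φ φ : Spacetime → ℂ} (hΦ : HasCylinderExpansion ρ₀ a Φ) (hφ : IsUglyBuiltFrom ρ₀ Φ φ) {M X : ℝ}
    (h : ModesBounded ρ₀ a M X) {u v : ℝ} (hu : u < 0) (hv : 0 < v)
    (hX : 48 * X * (v⁻¹ + (-u)⁻¹) ≤ 1) {n : Space} (hn : n ∈ unitSphere) :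
    ‖φ ((u + v) / 2, ((v - u) / 2) • n) - uglyExpansion a ((u + v) / 2, ((v - u) / 2) • n)‖
      ≤ 2 * M * (24 * X * (v⁻¹ + (-u)⁻¹)) ^ 2 / ((v - u) / 2) := by
  have hXp := h.pos hρ₀
  have hXs : ∀ s ≤ u, 48 * X * (v⁻¹ + (-s)⁻¹) ≤ 1 := fun s hs =>
    (mul_le_mul_of_nonneg_left (inv_add_inv_neg_mono hu hs) (by positivity)).trans hX
  rw [uglyExpansion_ray a hu hv hn]
  set c := constC a 0 0 * sphHarm 0 0 n with hc
  set b := constB100 a * sphHarm 0 0 n with hb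
  set d := ∑ m ∈ Finset.Icc (-1 : ℤ) 1, constC a 1 m * sphHarm 1 m n with hd
  have hderiv := fun s (hs : s ≤ u) => (hasDerivAt_incoming hφ
    (h.mem_coneRegion hρ₀ (hs.trans_lt hu) hv (hXs s hs)) hn).fun_sub
    (hasDerivAt_uglyExpansion_ray c b d (hs.trans_lt hu) hv)
  have hlim := (h.tendsto_ugly hρ₀ hφ hu hv hX hn).sub (tendsto_uglyExpansion_ray c b d v)
  rw [sub_zero] at hlim
  refine norm_le_of_incoming (by linarith) hderiv (fun s hs => ?_) hlim
  have hs0 := hs.trans_lt hu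
  have hs' : 0 < -s := by linarith
  have h1 := h.norm_expansion_sub_le hρ₀ hΦ hs0 hv (hXs s hs) hn 2
  rw [sum_expansion_two hρ₀ hΦ hφ hs0 hv, ← hc, ← hb, ← hd] at h1
  have hM := h.1
  -- Towards past null infinity `ρ` decreases, so the remainder at the endpoint `u` dominates on the
  -- whole ray.
  have hmono : 2 * M * (24 * X * (v⁻¹ + (-s)⁻¹)) ^ 2 ≤ 2 * M * (24 * X * (v⁻¹ + (-u)⁻¹)) ^ 2 := by
    have := inv_add_inv_neg_mono (v := v) hu hs
    gcongr
  have h2 := two_mul_div_sq_norm_le (x := v - s) (by linarith) (h1.trans hmono)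
  rwa [mul_sub, sub_div] at h2

end

end GBU

theorem mainTheorem4 (ρ₀ : ℝ) (hρ₀ : 0 < ρ₀) (a : ℕ → ℕ → ℤ → ℝ → ℂ)
    (Φ φ : GBU.Spacetime → ℂ)
    (hΦ : GBU.HasCylinderExpansion ρ₀ a Φ)
    (hφ : GBU.IsUglyBuiltFrom ρ₀ Φ φ) :
    GBU.constA100 a = 0 ∧ GBU.constD a 0 0 = 0 ∧
      (∀ m ∈ Finset.Icc (-1 : ℤ) 1, GBU.constD a 1 m = 0) ∧
      ∀ τ₁ ∈ Set.Ioo (0 : ℝ) 1, ∃ K R : ℝ, 0 < R ∧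
        ∀ q : GBU.Spacetime, R ≤ ‖q.2‖ → |q.1| ≤ τ₁ * ‖q.2‖ →
          q ∈ GBU.nearCylinder ρ₀ ∧
            ‖φ q - GBU.uglyExpansion a q‖ ≤ K / ‖q.2‖ ^ 3 := by
  refine ⟨?_, ?_, ?_, ?_⟩
  · rw [GBU.constA100, GBU.deriv_monopole hρ₀ hΦ hφ 1]
    simp
  · rw [GBU.constD, GBU.deriv_monopole hρ₀ hΦ hφ 0]
    simp
  · intro m hm
    rw [GBU.constD, GBU.deriv_dipole hρ₀ hΦ hφ (abs_le.2 (Finset.mem_Icc.1 hm)), mul_zero]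
  · intro τ₁ hτ₁
    obtain ⟨M, X, h⟩ := GBU.exists_modesBounded hρ₀ hΦ hφ
    have hXp := h.pos hρ₀
    have hτ : 0 < 1 - τ₁ := by linarith [hτ₁.2]
    -- Both `v` and `-u` are at least `(1-τ₁) r`, so `1/v + 1/(-u) ≤ 2/((1-τ₁) r)`. Inserted into
    -- the error bound this gives `K`, and into its smallness condition it gives `R`.
    refine ⟨2 * M * (48 * X / (1 - τ₁)) ^ 2, 96 * X / (1 - τ₁), by positivity, ?_⟩
    rintro ⟨t, x⟩ hR ht
    simp only at hR ht ⊢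
    have hr : 0 < ‖x‖ := lt_of_lt_of_le (by positivity) hR
    have hx : x ≠ 0 := norm_pos_iff.1 hr
    have hn : GBU.direction x ∈ GBU.unitSphere := by simpa using GBU.norm_direction hx
    have ht' := abs_le.1 ht
    have hv : (1 - τ₁) * ‖x‖ ≤ t + ‖x‖ := by linarith
    have hu : (1 - τ₁) * ‖x‖ ≤ -(t - ‖x‖) := by linarith
    have hb : 0 < (1 - τ₁) * ‖x‖ := by positivity
    have hinv : (t + ‖x‖)⁻¹ + (-(t - ‖x‖))⁻¹ ≤ 2 / ((1 - τ₁) * ‖x‖) := by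
      have h1 := inv_anti₀ hb hv
      have h2 := inv_anti₀ hb hu
      rw [div_eq_mul_inv]
      linarith
    have hX : 48 * X * ((t + ‖x‖)⁻¹ + (-(t - ‖x‖))⁻¹) ≤ 1 := by
      rw [div_le_iff₀ hτ] at hR
      calc _ ≤ 48 * X * (2 / ((1 - τ₁) * ‖x‖)) := by gcongr
        _ ≤ 1 := by
          rw [mul_div_assoc', div_le_one hb]
          linarith
    have hu0 : t - ‖x‖ < 0 := by linarith
    have hv0 : 0 < t + ‖x‖ := by linarith
    have e1 : (t - ‖x‖ + (t + ‖x‖)) / 2 = t := by ring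
    have e2 : (t + ‖x‖ - (t - ‖x‖)) / 2 = ‖x‖ := by ring
    have hmem := h.mem_coneRegion hρ₀ hu0 hv0 hX
    have hle := h.norm_ugly_sub_le hρ₀ hΦ hφ hu0 hv0 hX hn
    rw [e1, e2] at hmem
    rw [e1, e2, GBU.norm_smul_direction hx] at hle
    refine ⟨by rw [GBU.nearCylinder_eq]; exact hmem, hle.trans ?_⟩
    have hM := h.1
    have hu1 : 0 < -(t - ‖x‖) := by linarith
    calc _ ≤ 2 * M * (24 * X * (2 / ((1 - τ₁) * ‖x‖))) ^ 2 / ‖x‖ := by gcongr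
      _ = _ := by
        field_simp
        ring
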